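/- Let $a>b>c>d>0$ and let $\mathbb{E}_{a,b,c,d}\subset\mathbb{R}^4$ be the ellipsoid $\frac{x^2}{a^2}+\frac{y^2}{b^2}+\frac{z^2}{c^2}+\frac{w^2}{d^2}=1$, oriented by its inner unit normal $N$, with principal curvatures $k_1\le k_2\le k_3$ (the eigenvalues of $D(-N)$ on the tangent spaces). For $i=1,2,3$ let $\mathcal F_i$ be the $i$-th principal foliation, whose leaves are the integral curves of the line field of eigenvectors for $k_i$, defined where $k_i$ is a simple eigenvalue. Let $\mathcal U=\{k_1=k_2=k_3\}$, $\mathcal P_{12}=\{k_1=k_2<k_3\}$ and $\mathcal P_{23}=\{k_1<k_2=k_3\}$. For $\lambda\in(d^2,c^2)\cup(c^2,b^2)\cup(b^2,a^2)$ let $Q_\lambda$ be the intersection of $\mathbb{E}_{a,b,c,d}$ with the quadric $\frac{x^2}{a^2-\lambda}+\frac{y^2}{b^2-\lambda}+\frac{z^2}{c^2-\lambda}+\frac{w^2}{d^2-\lambda}=1$. Say that $\mathcal F_i$ and $\mathcal F_j$ restrict to a set $C\subset\mathbb{E}_{a,b,c,d}$ with singular set $S$ if through every point of $C\setminus S$ there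 pass a leaf of $\mathcal F_i$ and a leaf of $\mathcal F_j$, all leaves of $\mathcal F_i$ and $\mathcal F_j$ through points of $C$ are contained in $C$, and neither foliation has a leaf through a point of $C\cap S$. The resulting configuration on $C$ is called principally equivalent to a smooth oriented surface $M\subset\mathbb{R}^3$ if there is a homeomorphism $C\to M$ that maps the leaves of $\mathcal F_i$ (with $i<j$) onto the leaves of the minimal principal foliation of $M$, those of $\mathcal F_j$ onto the leaves of the maximal one, and $C\cap S$ onto the set of umbilic points of $M$. (1) If $\lambda\in(d^2,c^2)$, then $Q_\lambda$ has exactly two connected components. On each of them $\mathcal F_1$ and $\mathcal F_2$ restrict with singular set $\mathcal P_{12}$, and this configuration is principally equivalent to every ellipsoid $\frac{x^2}{a'^2}+\frac{y^2}{b'^2}+\frac{z^2}{c'^2}=1$, $a'>b'>c'>0$, with three distinct axes in $\mathbb{R}^3$ (oriented by the inner normal). (2) If $\lambda\in(b^2,a^2)$, then $Q_\lambda$ has exactly two connected components. On each of them $\mathcal F_2$ and $\mathcal F_3$ restrict with singular set $\mathcal P_{23}$, and this configuration is principally equivalent to every ellipsoid with three distinct axes in $\mathbb{R}^3$ (oriented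 by the inner normal). (3) If $\lambda\in(c^2,b^2)$, then $\mathcal F_1$ and $\mathcal F_3$ restrict to $Q_\lambda$ with singular set $\mathcal U\cup\mathcal P_{12}\cup\mathcal P_{23}$, and this configuration is principally equivalent to every torus of revolution $\left(\sqrt{x^2+y^2}-R\right)^2+z^2=r^2$, $R>r>0$, in $\mathbb{R}^3$ (oriented by the inner normal); in particular it has no singular points, as such a torus has no umbilic points. -/

import Mathlib

open Set

noncomputable section

namespace PrincipalNet

/-- Euclidean space of dimension `n`, with the Euclidean norm and scalar product. -/
abbrev Euc (n : ℕ) : Type := EuclideanSpace ℝ (Fin n)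

/-- The hypersurface of `ℝ^(m+1)` defined implicitly by `F = 0`. -/
def hypersurface {m : ℕ} (F : Euc (m + 1) → ℝ) : Set (Euc (m + 1)) := {p | F p = 0}

/-- The unit normal field `N = -∇F / |∇F|`. For the functions used below (quadrics with positive
coefficients, tori of revolution), `F` is negative inside, and `N` is the inner normal. -/
def unitNormal {m : ℕ} (F : Euc (m + 1) → ℝ) (p : Euc (m + 1)) : Euc (m + 1) :=
  -(‖gradient F p‖⁻¹ • gradient F p)

/-- `v` is tangent at `p` to the level hypersurface of `F` through `p`. -/
def IsTangent {m : ℕ} (F : Euc (m + 1) → ℝ) (p v : Euc (m + 1)) : Prop :=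
  fderiv ℝ F p v = 0

/-- `v` is a tangent vector with `D(-N) v = κ v`. If `v ≠ 0` this says that `v` is a principal
direction with principal curvature `κ`. -/
def IsCurvatureVector {m : ℕ} (F : Euc (m + 1) → ℝ) (p : Euc (m + 1)) (κ : ℝ)
    (v : Euc (m + 1)) : Prop :=
  IsTangent F p v ∧ -(fderiv ℝ (unitNormal F) p v) = κ • v

/-- `k 0 ≤ k 1 ≤ … ≤ k (m-1)` are the principal curvatures at `p` of the hypersurface, that is,
the eigenvalues, with multiplicity, of the (symmetric) operator `D(-N)` on the `m`-dimensional
tangent space: there is an orthonormal basis of the tangent space made of corresponding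
eigenvectors. -/
def HasPrincipalCurvatures {m : ℕ} (F : Euc (m + 1) → ℝ) (p : Euc (m + 1))
    (k : Fin m → ℝ) : Prop :=
  Monotone k ∧ ∃ e : Fin m → Euc (m + 1), Orthonormal ℝ e ∧ ∀ i, IsCurvatureVector F p (k i) (e i)

/-- The umbilic points: all principal curvatures coincide. -/
def umbilicSet {m : ℕ} (F : Euc (m + 1) → ℝ) : Set (Euc (m + 1)) :=
  {p | p ∈ hypersurface F ∧ ∃ k, HasPrincipalCurvatures F p k ∧ ∀ i j, k i = k j}

/-- The partially umbilic points of a hypersurface of `ℝ⁴` with `k₁ = k₂ < k₃`. -/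
def partiallyUmbilic12 (F : Euc 4 → ℝ) : Set (Euc 4) :=
  {p | p ∈ hypersurface F ∧ ∃ k : Fin 3 → ℝ, HasPrincipalCurvatures F p k ∧
    k 0 = k 1 ∧ k 1 < k 2}

/-- The partially umbilic points of a hypersurface of `ℝ⁴` with `k₁ < k₂ = k₃`. -/
def partiallyUmbilic23 (F : Euc 4 → ℝ) : Set (Euc 4) :=
  {p | p ∈ hypersurface F ∧ ∃ k : Fin 3 → ℝ, HasPrincipalCurvatures F p k ∧
    k 0 < k 1 ∧ k 1 = k 2}

/-- The `i`-th principal line field: the `i`-th principal curvature (in increasing order, counted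
from `0`) is simple at `p`, and `v` belongs to its eigenspace. -/
def MemLineField {m : ℕ} (F : Euc (m + 1) → ℝ) (i : Fin m) (p v : Euc (m + 1)) : Prop :=
  ∃ k : Fin m → ℝ, HasPrincipalCurvatures F p k ∧ (∀ j, j ≠ i → k j ≠ k i) ∧
    IsCurvatureVector F p (k i) v

/-- A principal line of the `i`-th family: a regular `C¹` curve on an open interval `(s₀, s₁)`,
lying on the hypersurface and everywhere tangent to the `i`-th principal line field. -/
def IsPrincipalLine {m : ℕ} (F : Euc (m + 1) → ℝ) (i : Fin m) (γ : ℝ → Euc (m + 1))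
    (s₀ s₁ : ℝ) : Prop :=
  ContDiffOn ℝ 1 γ (Ioo s₀ s₁) ∧ ∀ s ∈ Ioo s₀ s₁,
    γ s ∈ hypersurface F ∧ deriv γ s ≠ 0 ∧ MemLineField F i (γ s) (deriv γ s)

/-- The leaf through `p` of the `i`-th principal foliation: all points that lie together with `p`
on a principal line of the `i`-th family. It is empty if the `i`-th line field is singular
at `p`. -/
def leaf {m : ℕ} (F : Euc (m + 1) → ℝ) (i : Fin m) (p : Euc (m + 1)) : Set (Euc (m + 1)) :=
  {q | ∃ (γ : ℝ → Euc (m + 1)) (s₀ s₁ : ℝ), IsPrincipalLine F i γ s₀ s₁ ∧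
    ∃ s ∈ Ioo s₀ s₁, ∃ t ∈ Ioo s₀ s₁, γ s = p ∧ γ t = q}

/-- The `i`-th and `j`-th principal foliations of the hypersurface `F = 0` restrict to a pair of
foliations of the subset `C` with singular set `S ∩ C`: through every point of `C` outside `S`
passes a leaf of each of them, and these leaves stay in `C`. At the points of `S ∩ C` neither
of the two foliations is defined. -/
def CarriesNet {m : ℕ} (F : Euc (m + 1) → ℝ) (i j : Fin m) (S C : Set (Euc (m + 1))) : Prop :=
  C ⊆ hypersurface F ∧
  (∀ p ∈ C, p ∉ S → p ∈ leaf F i p ∧ p ∈ leaf F j p) ∧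
  (∀ p ∈ C, p ∈ S → leaf F i p = ∅ ∧ leaf F j p = ∅) ∧
  (∀ p ∈ C, leaf F i p ⊆ C ∧ leaf F j p ⊆ C)

/-- Principal equivalence between a subset `C` of the hypersurface `F = 0`, with the net of the
`i`-th and `j`-th principal foliations and the singular set `S`, and the surface `G = 0` of `ℝ³`,
with its minimal and maximal principal foliations and its umbilic set: a homeomorphism that maps
leaves onto leaves, for each of the two foliations, and singular points onto singular points. -/
def PrincipallyEquivalent {m : ℕ} (F : Euc (m + 1) → ℝ) (i j : Fin m) (S C : Set (Euc (m + 1)))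
    (G : Euc 3 → ℝ) : Prop :=
  ∃ h : C ≃ₜ hypersurface G,
    (∀ p q : C, (q : Euc (m + 1)) ∈ leaf F i p ↔ (h q : Euc 3) ∈ leaf G 0 (h p)) ∧
    (∀ p q : C, (q : Euc (m + 1)) ∈ leaf F j p ↔ (h q : Euc 3) ∈ leaf G 1 (h p)) ∧
    (∀ p : C, (p : Euc (m + 1)) ∈ S ↔ (h p : Euc 3) ∈ umbilicSet G)

/-- The diagonal quadric `∑ᵢ xᵢ² / Aᵢ - 1`. -/
def quadric {n : ℕ} (A : Fin n → ℝ) (p : Euc n) : ℝ := ∑ i, p i ^ 2 / A i - 1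

/-- The ellipsoid `x²/a² + y²/b² + z²/c² = 1` of `ℝ³`. -/
def ellipsoid3 (a b c : ℝ) : Euc 3 → ℝ := quadric ![a ^ 2, b ^ 2, c ^ 2]

/-- The ellipsoid `x²/a² + y²/b² + z²/c² + w²/d² = 1` of `ℝ⁴`. -/
def ellipsoid4 (a b c d : ℝ) : Euc 4 → ℝ := quadric ![a ^ 2, b ^ 2, c ^ 2, d ^ 2]

/-- The torus of revolution about the `z`-axis generated by the circle of radius `r` centered at
distance `R` from the axis (`0 < r < R`), `(√(x² + y²) - R)² + z² = r²`, in its polynomial form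
`(x² + y² + z² + R² - r²)² = 4 R² (x² + y²)`. -/
def torus (R r : ℝ) (p : Euc 3) : ℝ :=
  (p 0 ^ 2 + p 1 ^ 2 + p 2 ^ 2 + R ^ 2 - r ^ 2) ^ 2 - 4 * R ^ 2 * (p 0 ^ 2 + p 1 ^ 2)

/-- The quartic surface `Q_μ`: the intersection of the ellipsoid of `ℝ⁴` with the confocal quadric
`x²/(a²-μ) + y²/(b²-μ) + z²/(c²-μ) + w²/(d²-μ) = 1`. -/
def quartic (a b c d μ : ℝ) : Set (Euc 4) :=
  {p | p ∈ hypersurface (ellipsoid4 a b c d) ∧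
    quadric ![a ^ 2 - μ, b ^ 2 - μ, c ^ 2 - μ, d ^ 2 - μ] p = 0}

end PrincipalNet

end

open PrincipalNet

open PrincipalNet

/-! Write `A` for the tuple of squared semi-axes. At a point `p` of the quadric `∑ pₗ² / Aₗ = 1` the
symmetric matrix `diag A - p pᵀ` annihilates the normal vector with entries `pₗ / Aₗ`, and its
tangent eigenvectors are the principal directions: an eigenvalue `r` corresponds to the principal
curvature `2 / (r |∇F|)`. So the characteristic polynomial `secular A p` carries all the
information. Its roots other than `0` are the ellipsoidal coordinates of `p`; listed in decreasing
order they correspond to the increasing curvatures, and the quartic surface is the set where `μ` is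
one of them.

Along a curve whose velocity is an eigenvector for the root `ν`, the value of `secular` at a fixed
`μ ≠ ν` solves a homogeneous linear equation, so a zero persists (`IsConfocalVector.secular_deriv`,
`IsPrincipalLine.eventually_secular_eq_zero`). Only the root `ν` varies along such a curve. Hence
the principal lines of the two families that do not move `μ` stay on the surface, and on each of
them the remaining coordinate is constant (`ConfocalNet.line_mem`, `ConfocalNet.line_snd`).

With `μ` fixed, the two other roots `v` and `u` run over intervals between axes. Lagrange
interpolation at the axes expresses each `xₗ²` as a constant times a function of `v` times a
function of `u`, and the substitution `v = A p sin² + A q cos²` makes the square roots smooth. This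
yields a global parametrization by pairs of angles whose coordinate curves are principal lines
wherever they are regular and the two roots differ.

If `μ` is the smallest or the largest root, the two intervals share an endpoint `A c`, and the
`c`-th coordinate is a multiple of `sin α sin β`. The parametrization is then a double cover of a
sphere by a torus, identifying `(α, β)` with `(-α, -β)` and branched at four points, where `v = u`:
the pillow. The triaxial ellipsoid of `ℝ³` has the same description. A coordinate that never
vanishes separates the two components. If `μ` is the middle root, the intervals are disjoint, and
the parametrization is a torus whose leaves are the coordinate circles, like the parallels and
meridians of a torus of revolution.

A `NetChart` records such a model. Compactness turns two charts with the same model into a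
homeomorphism that respects leaves and singular points (`NetChart.principallyEquivalent`). -/

namespace PrincipalNet

open Filter Topology

/-! ### Principal curvatures of a level hypersurface. -/

section Curvature

variable {m : ℕ} {F : Euc (m + 1) → ℝ} {p : Euc (m + 1)} {g : Euc (m + 1) → Euc (m + 1)}
  {H : Euc (m + 1) →L[ℝ] Euc (m + 1)}

/-- The subtracted multiple of `g p` is the normal component of `H v`: up to the factor `‖g p‖⁻¹`,
the shape operator is the Hessian followed by the orthogonal projection to the tangent space. -/
theorem neg_fderiv_unitNormal (hF : ∀ᶠ x in 𝓝 p, HasGradientAt F (g x) x)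
    (hg : HasFDerivAt g H p) (h0 : g p ≠ 0) (v : Euc (m + 1)) :
    -(fderiv ℝ (unitNormal F) p v) =
      ‖g p‖⁻¹ • (H v - (inner ℝ (g p) (H v) / ‖g p‖ ^ 2) • g p) := by
  have hn : ‖g p‖ ≠ 0 := norm_ne_zero_iff.mpr h0
  have hn2 : ‖g p‖ ^ 2 ≠ 0 := pow_ne_zero 2 hn
  -- Writing the norm as the square root of `‖g x‖ ^ 2` reduces the computation to the derivative of
  -- the squared norm.
  have heq : unitNormal F =ᶠ[𝓝 p] fun x => -((Real.sqrt (‖g x‖ ^ 2))⁻¹ • g x) := by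
    filter_upwards [hF] with x hx
    simp only [unitNormal, hx.gradient, Real.sqrt_sq (norm_nonneg _)]
  have hs : HasDerivAt (fun y : ℝ => (Real.sqrt y)⁻¹)
      (-(1 / (2 * Real.sqrt (‖g p‖ ^ 2))) / Real.sqrt (‖g p‖ ^ 2) ^ 2) (‖g p‖ ^ 2) :=
    (Real.hasDerivAt_sqrt hn2).fun_inv (by rw [Real.sqrt_sq (norm_nonneg _)]; exact hn)
  have h1 := hs.comp_hasFDerivAt p hg.norm_sq
  have h2 := (h1.smul hg).neg
  have h3 := h2.congr_of_eventuallyEq heq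
  rw [h3.fderiv]
  simp only [Function.comp, add_apply, neg_apply, smul_apply,
    ContinuousLinearMap.smulRight_apply, ContinuousLinearMap.comp_apply, innerSL_apply_apply,
    Real.sqrt_sq (norm_nonneg _), neg_neg, smul_eq_mul, nsmul_eq_mul]
  push_cast
  match_scalars <;> field_simp

theorem isTangent_iff (hF : HasGradientAt F (g p) p) (v : Euc (m + 1)) :
    IsTangent F p v ↔ inner ℝ (g p) v = 0 := by
  rw [IsTangent, hF.hasFDerivAt.fderiv]
  simp

/-- A tangent vector is principal with curvature `κ` iff the Hessian maps it to `κ|∇F|` times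
itself, up to a normal vector. -/
theorem isCurvatureVector_iff (hF : ∀ᶠ x in 𝓝 p, HasGradientAt F (g x) x)
    (hg : HasFDerivAt g H p) (h0 : g p ≠ 0) (κ : ℝ) (v : Euc (m + 1)) :
    IsCurvatureVector F p κ v ↔
      inner ℝ (g p) v = 0 ∧ ∃ s : ℝ, H v = (κ * ‖g p‖) • v + s • g p := by
  have hn : ‖g p‖ ≠ 0 := norm_ne_zero_iff.mpr h0
  rw [IsCurvatureVector, isTangent_iff hF.self_of_nhds, neg_fderiv_unitNormal hF hg h0]
  refine and_congr_right fun hv => ⟨fun h => ⟨inner ℝ (g p) (H v) / ‖g p‖ ^ 2, ?_⟩, ?_⟩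
  · have h' := congrArg (fun w => ‖g p‖ • w) h
    simp only [smul_smul, mul_inv_cancel₀ hn, one_smul] at h'
    rw [mul_comm κ, ← h']
    abel
  · rintro ⟨s, hs⟩
    have : inner ℝ (g p) (H v) = s * ‖g p‖ ^ 2 := by
      rw [hs, inner_add_right, inner_smul_right, inner_smul_right, hv,
        real_inner_self_eq_norm_sq]
      ring
    rw [this, hs, mul_div_cancel_right₀ _ (pow_ne_zero 2 hn), add_sub_cancel_right, smul_smul]
    congr 1
    field_simp

/-- Orthonormal principal vectors span the tangent space. -/
theorem span_range_eq_ker_fderiv (h0 : fderiv ℝ F p ≠ 0) {e : Fin m → Euc (m + 1)}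
    (he : Orthonormal ℝ e) (het : ∀ i, IsTangent F p (e i)) :
    Submodule.span ℝ (range e) = LinearMap.ker (fderiv ℝ F p : Euc (m + 1) →ₗ[ℝ] ℝ) := by
  have hker : Module.finrank ℝ (LinearMap.ker (fderiv ℝ F p : Euc (m + 1) →ₗ[ℝ] ℝ)) = m := by
    have h1 := Module.Dual.finrank_ker_add_one_of_ne_zero
      (f := (fderiv ℝ F p : Euc (m + 1) →ₗ[ℝ] ℝ))
      (fun h => h0 (ContinuousLinearMap.coe_injective h))
    simpa using h1
  apply Submodule.eq_of_le_of_finrank_eq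
  · rw [Submodule.span_le]
    rintro _ ⟨i, rfl⟩
    exact het i
  · rw [finrank_span_eq_card he.linearIndependent, hker, Fintype.card_fin]

/-- Both sides of the eigenvector equation are compared coefficientwise in the basis `e`. -/
theorem IsCurvatureVector.coeff_mul_eq {e : Fin m → Euc (m + 1)} {k : Fin m → ℝ}
    (he : Orthonormal ℝ e) (hek : ∀ i, IsCurvatureVector F p (k i) (e i)) {κ : ℝ}
    {c : Fin m → ℝ} (h : IsCurvatureVector F p κ (∑ j, c j • e j)) (j : Fin m) :
    c j * (k j - κ) = 0 := by
  have h1 := h.2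
  rw [map_sum, ← Finset.sum_neg_distrib, Finset.smul_sum] at h1
  have h2 : ∑ l, (c l * k l - κ * c l) • e l = 0 := by
    simp only [sub_smul, Finset.sum_sub_distrib, sub_eq_zero, mul_smul]
    rw [← h1]
    refine Finset.sum_congr rfl fun l _ => ?_
    rw [map_smul, ← smul_neg, (hek l).2]
  have h3 := (Fintype.linearIndependent_iff.mp he.linearIndependent) _ h2 j
  linarith

/-- The eigenspace of a simple principal curvature is a line. -/
theorem IsCurvatureVector.exists_eq_smul (h0 : fderiv ℝ F p ≠ 0) {e : Fin m → Euc (m + 1)}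
    {k : Fin m → ℝ} (he : Orthonormal ℝ e) (hek : ∀ i, IsCurvatureVector F p (k i) (e i))
    {i : Fin m} (hi : ∀ j, j ≠ i → k j ≠ k i) {v : Euc (m + 1)}
    (h : IsCurvatureVector F p (k i) v) : ∃ c : ℝ, v = c • e i := by
  obtain ⟨c, rfl⟩ : ∃ c : Fin m → ℝ, ∑ j, c j • e j = v := by
    apply (Submodule.mem_span_range_iff_exists_fun ℝ).mp
    rw [span_range_eq_ker_fderiv h0 he fun i => (hek i).1]
    exact h.1
  refine ⟨c i, Finset.sum_eq_single i (fun j _ hj => ?_) (by simp)⟩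
  rw [(mul_eq_zero.mp (h.coeff_mul_eq he hek j)).resolve_right (sub_ne_zero.mpr (hi j hj)),
    zero_smul]

/-- The transition matrix between two orthonormal eigenbases is invertible, so its determinant has a
nonzero term. The permutation of that term matches equal eigenvalues, and two monotone
rearrangements of one tuple coincide. -/
theorem HasPrincipalCurvatures.unique (h0 : fderiv ℝ F p ≠ 0) {k k' : Fin m → ℝ}
    (h : HasPrincipalCurvatures F p k) (h' : HasPrincipalCurvatures F p k') : k = k' := by
  obtain ⟨hk, e, he, hek⟩ := h
  obtain ⟨hk', e', he', hek'⟩ := h'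
  have hc : ∀ i, ∃ c : Fin m → ℝ, ∑ j, c j • e j = e' i := by
    intro i
    apply (Submodule.mem_span_range_iff_exists_fun ℝ).mp
    rw [span_range_eq_ker_fderiv h0 he fun i => (hek i).1]
    exact (hek' i).1
  choose c hc using hc
  have hcc : Matrix.of c * (Matrix.of c).transpose = 1 := by
    ext i j
    have h1 := (orthonormal_iff_ite.mp he') i j
    rw [← hc i, ← hc j, he.inner_sum] at h1
    simpa [Matrix.mul_apply, Matrix.one_apply] using h1
  have hdet : (Matrix.of c).det ≠ 0 := by
    intro h
    have := congrArg Matrix.det hcc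
    simp [h] at this
  have hev : ∀ i j, c i j ≠ 0 → k' i = k j := by
    intro i j hij
    have h4 := IsCurvatureVector.coeff_mul_eq he hek (κ := k' i) (c := c i)
      (by rw [hc i]; exact hek' i) j
    linarith [(mul_eq_zero.mp h4).resolve_left hij]
  rw [Matrix.det_apply] at hdet
  obtain ⟨σ, -, hσ⟩ := Finset.exists_ne_zero_of_sum_ne_zero hdet
  have hσ' : ∀ i, c (σ i) i ≠ 0 := by
    intro i hi
    apply hσ
    rw [Finset.prod_eq_zero (Finset.mem_univ i) (by simpa using hi), smul_zero]
  have hkσ : k = k' ∘ σ := funext fun i => (hev _ _ (hσ' i)).symm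
  have := Tuple.unique_monotone (f := k') (σ := σ) (τ := 1) (hkσ ▸ hk) (by simpa using hk')
  rw [hkσ, this]
  simp

/-- When the principal curvatures are known, they are the ones that enter the definition of the
principal line fields. -/
theorem memLineField_iff (h0 : fderiv ℝ F p ≠ 0) {k : Fin m → ℝ}
    (h : HasPrincipalCurvatures F p k) (i : Fin m) (v : Euc (m + 1)) :
    MemLineField F i p v ↔ (∀ j, j ≠ i → k j ≠ k i) ∧ IsCurvatureVector F p (k i) v := by
  constructor
  · rintro ⟨k', hk', hs, hv⟩
    obtain rfl := HasPrincipalCurvatures.unique h0 h hk'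
    exact ⟨hs, hv⟩
  · rintro ⟨hs, hv⟩
    exact ⟨k, h, hs, hv⟩

end Curvature

/-- Two real tuples with the same multiset of values differ by a permutation. -/
theorem exists_perm_comp_eq {n : ℕ} {f g : Fin n → ℝ}
    (h : Finset.univ.val.map f = Finset.univ.val.map g) : ∃ σ : Equiv.Perm (Fin n), f ∘ σ = g := by
  have hp : ∀ {f : Fin n → ℝ} (σ : Equiv.Perm (Fin n)),
      Finset.univ.val.map (f ∘ σ) = Finset.univ.val.map f := fun {f} σ => by
    rw [← Multiset.map_map, Multiset.map_univ_val_equiv]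
  have key : ∀ {f g : Fin n → ℝ}, Monotone f → Monotone g →
      Finset.univ.val.map f = Finset.univ.val.map g → f = g := by
    intro f g hf hg h
    apply List.ofFn_injective
    refine List.Perm.eq_of_pairwise' (r := (· ≤ ·)) ?_ ?_ ?_
    · exact List.sortedLE_iff_pairwise.mp hf.sortedLE_ofFn
    · exact List.sortedLE_iff_pairwise.mp hg.sortedLE_ofFn
    · rw [← Multiset.coe_eq_coe, ← Fin.univ_val_map, ← Fin.univ_val_map, h]
  have h2 := key (Tuple.monotone_sort f) (Tuple.monotone_sort g) (by rw [hp, hp, h])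
  refine ⟨(Tuple.sort g)⁻¹.trans (Tuple.sort f), funext fun i => ?_⟩
  have := congrFun h2 ((Tuple.sort g)⁻¹ i)
  simpa using this

/-! ### The secular polynomial of a diagonal quadric. -/

section Quadric

variable {n : ℕ} (A : Fin n → ℝ)

/-- The gradient of the quadric `∑ xᵢ² / Aᵢ - 1`, as a linear map. -/
noncomputable def quadricGrad : Euc n →L[ℝ] Euc n :=
  LinearMap.toContinuousLinearMap
    { toFun := fun v => WithLp.toLp 2 fun i => 2 * v i / A i
      map_add' := fun v w => by ext i; simp; ring
      map_smul' := fun c v => by ext i; simp; ring }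

@[simp] theorem quadricGrad_apply (v : Euc n) (i : Fin n) :
    quadricGrad A v i = 2 * v i / A i := rfl

theorem hasGradientAt_quadric (p : Euc n) : HasGradientAt (quadric A) (quadricGrad A p) p := by
  rw [hasGradientAt_iff_hasFDerivAt]
  have h : ∀ i ∈ Finset.univ, HasFDerivAt (fun x : Euc n => x i ^ 2 / A i)
      ((2 * p i / A i) • (EuclideanSpace.proj i : StrongDual ℝ (Euc n))) p := by
    intro i _
    have h1 : HasFDerivAt (fun x : Euc n => x i) (EuclideanSpace.proj i : StrongDual ℝ (Euc n)) p :=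
      (EuclideanSpace.proj i : StrongDual ℝ (Euc n)).hasFDerivAt
    refine ((h1.pow 2).mul_const (A i)⁻¹).congr_fderiv ?_
    ext v
    simp
    ring
  refine ((HasFDerivAt.fun_sum h).sub_const 1).congr_fderiv ?_
  ext v
  simp [PiLp.inner_apply]
  exact Finset.sum_congr rfl fun i _ => by ring

/-- The characteristic polynomial of `diag A - x xᵀ`. Its roots other than `0` at a point `x` of the
quadric `∑ xᵢ² / Aᵢ = 1` are the ellipsoidal coordinates of `x`. -/
def secular (x : Euc n) (t : ℝ) : ℝ :=
  ∏ k, (t - A k) + ∑ l, x l ^ 2 * ∏ k ∈ Finset.univ.erase l, (t - A k)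

theorem secular_eq_prod_mul (x : Euc n) {t : ℝ} (ht : ∀ k, t ≠ A k) :
    secular A x t = (∏ k, (t - A k)) * (1 + ∑ l, x l ^ 2 / (t - A l)) := by
  rw [secular, mul_add, mul_one, Finset.mul_sum]
  congr 1
  refine Finset.sum_congr rfl fun l _ => ?_
  rw [← Finset.mul_prod_erase Finset.univ (fun k => t - A k) (Finset.mem_univ l)]
  field_simp [sub_ne_zero.mpr (ht l)]

/-- `x` lies on the confocal quadric of parameter `t` iff `t` is a root of `secular A x`. -/
theorem quadric_sub_eq_zero_iff (x : Euc n) {t : ℝ} (ht : ∀ k, t ≠ A k) :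
    quadric (fun i => A i - t) x = 0 ↔ secular A x t = 0 := by
  rw [secular_eq_prod_mul A x ht, mul_eq_zero, or_iff_right
    (Finset.prod_ne_zero_iff.mpr fun k _ => sub_ne_zero.mpr (ht k)), quadric]
  have : ∑ l, x l ^ 2 / (t - A l) = -∑ l, x l ^ 2 / (A l - t) := by
    rw [← Finset.sum_neg_distrib]
    refine Finset.sum_congr rfl fun l _ => ?_
    rw [← neg_sub (A l) t, div_neg]
  rw [this]
  constructor <;> intro h <;> linarith

theorem mem_hypersurface_quadric_iff {m : ℕ} {A : Fin (m + 1) → ℝ} (hA : ∀ k, 0 < A k)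
    (x : Euc (m + 1)) : x ∈ hypersurface (quadric A) ↔ secular A x 0 = 0 := by
  rw [← quadric_sub_eq_zero_iff A x fun k => (hA k).ne]
  simp [hypersurface]

theorem continuous_secular (t : ℝ) : Continuous fun x => secular A x t := by
  unfold secular
  fun_prop

/-- Every other term contains the factor `A l - A l`. The values at the axes thus give the squares
of the cartesian coordinates, and their signs locate the roots. -/
theorem secular_apply_self (x : Euc n) (l : Fin n) :
    secular A x (A l) = x l ^ 2 * ∏ k ∈ Finset.univ.erase l, (A l - A k) := by
  rw [secular, Finset.prod_eq_zero (Finset.mem_univ l) (sub_self _), zero_add]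
  refine Finset.sum_eq_single l (fun b _ hb => ?_) (by simp)
  rw [Finset.prod_eq_zero (Finset.mem_erase.mpr ⟨hb.symm, Finset.mem_univ l⟩) (sub_self _),
    mul_zero]

/-- The symmetric matrix `diag A - x xᵀ`. -/
def confocalMatrix (x : Euc n) : Matrix (Fin n) (Fin n) ℝ :=
  Matrix.diagonal A - Matrix.vecMulVec x x

theorem isHermitian_confocalMatrix (x : Euc n) : (confocalMatrix A x).IsHermitian := by
  ext i j
  by_cases h : i = j
  · simp [h, confocalMatrix]
  · simp [confocalMatrix, Matrix.vecMulVec_apply, Matrix.diagonal_apply_ne _ h,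
      Matrix.diagonal_apply_ne _ (Ne.symm h), mul_comm]

theorem confocalMatrix_mulVec (x v : Euc n) (l : Fin n) :
    (confocalMatrix A x).mulVec v l = A l * v l - inner ℝ x v * x l := by
  simp [confocalMatrix, Matrix.sub_mulVec, Matrix.mulVec_diagonal, Matrix.vecMulVec_mulVec,
    dotProduct, PiLp.inner_apply, mul_comm]

/-- This is the determinant formula for a rank-one perturbation of an invertible diagonal matrix,
which is why `t` has to avoid the axes. -/
theorem eval_charpoly_confocalMatrix (x : Euc n) {t : ℝ} (ht : ∀ k, t ≠ A k) :
    (confocalMatrix A x).charpoly.eval t = secular A x t := by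
  have h1 : Matrix.scalar (Fin n) t - confocalMatrix A x =
      Matrix.diagonal (fun k => t - A k) +
        Matrix.replicateCol Unit x.ofLp * Matrix.replicateRow Unit x.ofLp := by
    ext i j
    by_cases h : i = j
    · subst h; simp [confocalMatrix, Matrix.vecMulVec_apply, Matrix.mul_apply]; ring
    · simp [confocalMatrix, Matrix.vecMulVec_apply, Matrix.mul_apply, h]
  have hu : IsUnit (fun k => t - A k) :=
    Pi.isUnit_iff.mpr fun k => (sub_ne_zero.mpr (ht k)).isUnit
  rw [Matrix.eval_charpoly, h1, Matrix.det_add_replicateCol_mul_replicateRow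
    (by rw [Matrix.det_diagonal]
        exact (Finset.prod_ne_zero_iff.mpr fun k _ => sub_ne_zero.mpr (ht k)).isUnit),
    Matrix.det_diagonal, secular_eq_prod_mul A x ht]
  congr 1
  simp only [Matrix.det_unique, Matrix.add_apply, Matrix.one_apply_eq, Matrix.mul_apply,
    Matrix.replicateRow_apply, Matrix.replicateCol_apply, Matrix.inv_diagonal]
  congr 1
  refine Finset.sum_congr rfl fun l _ => ?_
  rw [Finset.sum_eq_single l (fun b _ hb => by rw [Matrix.diagonal_apply_ne _ hb, mul_zero])
    (by simp), Matrix.diagonal_apply_eq]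
  obtain ⟨u, hu⟩ := hu
  rw [← hu, Ring.inverse_unit]
  have h2 : (u : Fin n → ℝ) l * (↑u⁻¹ : Fin n → ℝ) l = 1 := congrFun u.mul_inv l
  have h3 : (u : Fin n → ℝ) l = t - A l := congrFun hu l
  rw [h3] at h2
  rw [eq_div_iff (sub_ne_zero.mpr (ht l))]
  linear_combination x l ^ 2 * h2

end Quadric

/-! ### Principal directions of a quadric as eigenvectors. -/

section Curvatures

variable {m : ℕ} {A : Fin (m + 1) → ℝ} {p : Euc (m + 1)}

theorem quadricGrad_ne_zero (hA : ∀ k, 0 < A k) (hp : p ∈ hypersurface (quadric A)) :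
    quadricGrad A p ≠ 0 := by
  intro h
  have h1 : ∀ l, p l = 0 := fun l => by
    have := congrArg (fun w : Euc (m + 1) => w l) h
    simpa [(hA l).ne'] using this
  have h2 : quadric A p = 0 := hp
  simp [quadric, h1] at h2

theorem fderiv_quadric_ne_zero (hA : ∀ k, 0 < A k) (hp : p ∈ hypersurface (quadric A)) :
    fderiv ℝ (quadric A) p ≠ 0 := by
  rw [(hasGradientAt_quadric A p).hasFDerivAt.fderiv]
  simpa using quadricGrad_ne_zero hA hp

theorem inner_quadricGrad (v : Euc (m + 1)) :
    inner ℝ (quadricGrad A p) v = 2 * ∑ l, p l * v l / A l := by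
  rw [PiLp.inner_apply, Finset.mul_sum]
  refine Finset.sum_congr rfl fun l _ => ?_
  simp
  ring

theorem sum_sq_div_eq_one (hp : p ∈ hypersurface (quadric A)) : ∑ l, p l ^ 2 / A l = 1 := by
  have : quadric A p = 0 := hp
  rw [quadric] at this
  linarith

/-- The principal vectors of a quadric at `p` are the tangent eigenvectors of `diag A - p pᵀ`. -/
theorem isCurvatureVector_quadric_iff (hA : ∀ k, 0 < A k) (hp : p ∈ hypersurface (quadric A))
    {r : ℝ} (hr : r ≠ 0) (v : Euc (m + 1)) :
    IsCurvatureVector (quadric A) p (2 / (r * ‖quadricGrad A p‖)) v ↔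
      ∑ l, p l * v l / A l = 0 ∧ ∀ l, (A l - r) * v l = inner ℝ p v * p l := by
  have hg := quadricGrad_ne_zero hA hp
  have hn : ‖quadricGrad A p‖ ≠ 0 := norm_ne_zero_iff.mpr hg
  rw [isCurvatureVector_iff (Eventually.of_forall (hasGradientAt_quadric A))
    (quadricGrad A).hasFDerivAt hg, inner_quadricGrad]
  simp only [mul_eq_zero, OfNat.ofNat_ne_zero, false_or]
  refine and_congr_right fun hv => ?_
  have hin : inner ℝ p v = ∑ l, p l * v l := by
    rw [PiLp.inner_apply]
    exact Finset.sum_congr rfl fun l _ => by simp [mul_comm]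
  have hκ : 2 / (r * ‖quadricGrad A p‖) * ‖quadricGrad A p‖ = 2 / r := by field_simp
  rw [hκ]
  constructor
  · rintro ⟨s, hs⟩
    have h1 : ∀ l, (A l - r) * v l = -(s * r) * p l := fun l => by
      have h2 : 2 * v l / A l = 2 / r * v l + s * (2 * p l / A l) := by
        simpa using congrArg (fun w : Euc (m + 1) => w l) hs
      have := (hA l).ne'
      field_simp at h2
      linarith
    -- Weighting the equations by `p l / A l` and summing, tangency and the equation of the quadric
    -- identify the unknown normal coefficient.
    have h2 : inner ℝ p v = -(s * r) := by
      have h3 : ∀ l, p l * v l - r * (p l * v l / A l) = -(s * r) * (p l ^ 2 / A l) := fun l => by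
        have := (hA l).ne'
        field_simp
        linear_combination p l * h1 l
      have h4 := Finset.sum_congr (rfl : Finset.univ = Finset.univ) fun l _ => h3 l
      rw [Finset.sum_sub_distrib, ← Finset.mul_sum, ← Finset.mul_sum, hv, sum_sq_div_eq_one hp,
        ← hin] at h4
      linarith
    intro l
    rw [h2, h1]
  · intro h
    refine ⟨-(inner ℝ p v / r), ?_⟩
    ext l
    have h1 := h l
    have := (hA l).ne'
    simp only [quadricGrad_apply, PiLp.add_apply, PiLp.smul_apply, smul_eq_mul]
    field_simp
    linarith

/-- The principal curvatures of a quadric in terms of the factorization of `secular`. -/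
theorem hasPrincipalCurvatures_quadric (hA : ∀ k, 0 < A k) (hp : p ∈ hypersurface (quadric A))
    {r : Fin m → ℝ} (hr : Antitone r) (hr0 : ∀ j, 0 < r j)
    (hfac : ∀ t, secular A p t = t * ∏ j, (t - r j)) :
    HasPrincipalCurvatures (quadric A) p fun j => 2 / (r j * ‖quadricGrad A p‖) := by
  have hn : 0 < ‖quadricGrad A p‖ := norm_pos_iff.mpr (quadricGrad_ne_zero hA hp)
  refine ⟨fun i j hij => ?_, ?_⟩
  · have := hr0 j
    have := hr0 i
    exact div_le_div_of_nonneg_left zero_le_two (by positivity)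
      (mul_le_mul_of_nonneg_right (hr hij) hn.le)
  have hB := isHermitian_confocalMatrix A p
  -- The two polynomials agree off the finitely many axes. The additional root `0` belongs to the
  -- normal direction.
  have hchar : (confocalMatrix A p).charpoly =
      ∏ i, (Polynomial.X - Polynomial.C ((Fin.cons 0 r : Fin (m + 1) → ℝ) i)) := by
    apply Polynomial.eq_of_infinite_eval_eq
    refine ((Set.finite_range A).infinite_compl).mono fun t ht => ?_
    have ht' : ∀ k, t ≠ A k := fun k hk => ht ⟨k, hk.symm⟩
    rw [mem_ofPred_eq, eval_charpoly_confocalMatrix A p ht', hfac, Fin.prod_univ_succ]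
    simp [Polynomial.eval_prod]
  have hroots : Finset.univ.val.map hB.eigenvalues =
      Finset.univ.val.map (Fin.cons 0 r : Fin (m + 1) → ℝ) := by
    have h1 := hB.roots_charpoly_eq_eigenvalues
    rw [hchar] at h1
    have h2 := Polynomial.roots_multiset_prod_X_sub_C
      (Finset.univ.val.map (Fin.cons 0 r : Fin (m + 1) → ℝ))
    rw [Multiset.map_map] at h2
    exact h1.symm.trans h2
  obtain ⟨σ, hσ⟩ := exists_perm_comp_eq hroots
  have hev : ∀ j : Fin m, hB.eigenvalues (σ j.succ) = r j := fun j => by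
    simpa using congrFun hσ j.succ
  refine ⟨fun j => hB.eigenvectorBasis (σ j.succ), ?_, fun j => ?_⟩
  · exact hB.eigenvectorBasis.orthonormal.comp _
      (σ.injective.comp (Fin.succ_injective m))
  · set v := hB.eigenvectorBasis (σ j.succ) with hv
    have h1 : ∀ l, A l * v l - inner ℝ p v * p l = r j * v l := fun l => by
      rw [← confocalMatrix_mulVec, hv, hB.mulVec_eigenvectorBasis, hev]
      simp
    rw [isCurvatureVector_quadric_iff hA hp (hr0 j).ne']
    refine ⟨?_, fun l => by linarith [h1 l]⟩
    -- Summed over `l`, this leaves `r j * ∑ l, p l * v l / A l = 0`, so tangency follows from `r j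
    -- ≠ 0`.
    have h2 : ∀ l, p l * v l - inner ℝ p v * (p l ^ 2 / A l) = r j * (p l * v l / A l) :=
      fun l => by
        have := (hA l).ne'
        field_simp
        linear_combination p l * h1 l
    have h3 := Finset.sum_congr (rfl : Finset.univ = Finset.univ) fun l _ => h2 l
    have hin : inner ℝ p v = ∑ l, p l * v l := by
      rw [PiLp.inner_apply]
      exact Finset.sum_congr rfl fun l _ => by simp [mul_comm]
    rw [Finset.sum_sub_distrib, ← Finset.mul_sum, ← Finset.mul_sum, sum_sq_div_eq_one hp,
      ← hin, mul_one, sub_self] at h3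
    rcases mul_eq_zero.mp h3.symm with h | h
    · exact absurd h (hr0 j).ne'
    · exact h

/-- `v` is a tangent vector at `p` and an eigenvector of `diag A - p pᵀ` for the eigenvalue `r`. -/
def IsConfocalVector (A : Fin (m + 1) → ℝ) (p : Euc (m + 1)) (r : ℝ) (v : Euc (m + 1)) : Prop :=
  ∑ l, p l * v l / A l = 0 ∧ ∀ l, (A l - r) * v l = inner ℝ p v * p l

theorem memLineField_quadric_iff (hA : ∀ k, 0 < A k) (hp : p ∈ hypersurface (quadric A))
    {r : Fin m → ℝ} (hr : Antitone r) (hr0 : ∀ j, 0 < r j)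
    (hfac : ∀ t, secular A p t = t * ∏ j, (t - r j)) (i : Fin m) (v : Euc (m + 1)) :
    MemLineField (quadric A) i p v ↔ (∀ j, j ≠ i → r j ≠ r i) ∧ IsConfocalVector A p (r i) v := by
  have hn : ‖quadricGrad A p‖ ≠ 0 := norm_ne_zero_iff.mpr (quadricGrad_ne_zero hA hp)
  rw [memLineField_iff (fderiv_quadric_ne_zero hA hp)
    (hasPrincipalCurvatures_quadric hA hp hr hr0 hfac),
    isCurvatureVector_quadric_iff hA hp (hr0 i).ne']
  refine and_congr_left fun _ => forall₂_congr fun j _ => not_congr ?_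
  have := (hr0 i).ne'
  have := (hr0 j).ne'
  constructor
  · intro h
    field_simp at h
    exact h.symm
  · intro h
    rw [h]

end Curvatures

/-- Connectedness of the interval: `P` holds on a nonempty, relatively open and closed subset. -/
theorem forall_mem_Ioo_of_clopen {P : ℝ → Prop} {a b t₀ : ℝ} (ht₀ : t₀ ∈ Ioo a b) (h₀ : P t₀)
    (hopen : ∀ t ∈ Ioo a b, P t → ∀ᶠ t' in 𝓝 t, P t')
    (hclosed : ∀ t ∈ Ioo a b, (∃ᶠ t' in 𝓝 t, t' ∈ Ioo a b ∧ P t') → P t) : ∀ t ∈ Ioo a b, P t := by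
  have h := (isPreconnected_Ioo (a := a) (b := b)).subset_of_closure_inter_subset
    (u := {t | t ∈ Ioo a b ∧ P t})
    (isOpen_iff_eventually.mpr fun t ht =>
      (isOpen_Ioo.eventually_mem ht.1).and (hopen t ht.1 ht.2))
    ⟨t₀, ht₀, ht₀, h₀⟩
    (fun t ht => ⟨ht.2, hclosed t ht.2 (mem_closure_iff_frequently.mp ht.1)⟩)
  exact fun t ht => (h ht).2

/-- Uniqueness for `φ' = k φ`, by comparison with the zero solution. Continuity of `k` at the single
point `t₀` bounds it nearby, and the bound is the Lipschitz constant. -/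
theorem eventually_eq_zero_of_hasDerivAt_mul {φ k : ℝ → ℝ} {t₀ : ℝ} (hk : ContinuousAt k t₀)
    (h : ∀ᶠ t in 𝓝 t₀, HasDerivAt φ (k t * φ t) t) (h₀ : φ t₀ = 0) : ∀ᶠ t in 𝓝 t₀, φ t = 0 := by
  have hb : ∀ᶠ t in 𝓝 t₀, |k t| < |k t₀| + 1 :=
    hk.abs.eventually_lt continuousAt_const (lt_add_one _)
  obtain ⟨a, b, hab, hs⟩ := mem_nhds_iff_exists_Ioo_subset.mp (h.and hb)
  have := ODE_solution_unique_of_mem_Ioo (v := fun t x => k t * x) (s := fun _ => univ)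
    (K := ⟨|k t₀| + 1, by positivity⟩) (f := φ) (g := fun _ => 0) (a := a) (b := b) (t₀ := t₀)
    (fun t ht => by
      refine LipschitzOnWith.of_dist_le_mul fun x _ y _ => ?_
      rw [Real.dist_eq, Real.dist_eq, ← mul_sub, abs_mul]
      exact mul_le_mul_of_nonneg_right (hs ht).2.le (abs_nonneg _))
    hab (fun t ht => ⟨(hs ht).1, mem_univ _⟩)
    (fun t _ => ⟨by simpa using hasDerivAt_const t (0 : ℝ), mem_univ _⟩) h₀
  filter_upwards [isOpen_Ioo.mem_nhds hab] with t ht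
  exact this ht

/-! ### First integrals of the principal lines. -/

section FirstIntegral

variable {m : ℕ} {A : Fin (m + 1) → ℝ}

theorem hasDerivAt_apply {n : ℕ} {γ : ℝ → Euc n} {γ' : Euc n} {t : ℝ} (h : HasDerivAt γ γ' t)
    (l : Fin n) : HasDerivAt (fun s => γ s l) (γ' l) t :=
  ((EuclideanSpace.proj l : StrongDual ℝ (Euc n)).hasFDerivAt.comp_hasDerivAt t h)

theorem hasDerivAt_secular {n : ℕ} {A : Fin n → ℝ} {γ : ℝ → Euc n} {γ' : Euc n} {t : ℝ}
    (h : HasDerivAt γ γ' t) (μ : ℝ) :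
    HasDerivAt (fun s => secular A (γ s) μ)
      (∑ l, 2 * (γ t l * γ' l) * ∏ k ∈ Finset.univ.erase l, (μ - A k)) t := by
  have h1 : ∀ l ∈ Finset.univ, HasDerivAt
      (fun s => γ s l ^ 2 * ∏ k ∈ Finset.univ.erase l, (μ - A k))
      (2 * (γ t l * γ' l) * ∏ k ∈ Finset.univ.erase l, (μ - A k)) t := fun l _ => by
    have := ((hasDerivAt_apply h l).fun_pow 2).mul_const (∏ k ∈ Finset.univ.erase l, (μ - A k))
    refine this.congr_deriv ?_
    push_cast
    ring
  exact (HasDerivAt.fun_sum h1).const_add _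

/-- The polynomials `secular A · μ` are, up to a factor, first integrals of the principal lines. -/
theorem IsConfocalVector.secular_deriv {p v : Euc (m + 1)} {ν : ℝ}
    (h : IsConfocalVector A p ν v) (μ : ℝ) :
    (μ - ν) * ∑ l, 2 * (p l * v l) * ∏ k ∈ Finset.univ.erase l, (μ - A k) =
      2 * inner ℝ p v * secular A p μ := by
  have hin : inner ℝ p v = ∑ l, p l * v l := by
    rw [PiLp.inner_apply]
    exact Finset.sum_congr rfl fun l _ => by simp [mul_comm]
  -- Split `μ - ν = (μ - A l) + (A l - ν)`: the first summand completes the product, the second acts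
  -- on `v l` through the eigenvector equation.
  have h1 : ∀ l, (μ - ν) * (2 * (p l * v l) * ∏ k ∈ Finset.univ.erase l, (μ - A k)) =
      2 * (p l * v l) * ∏ k, (μ - A k) +
        2 * inner ℝ p v * (p l ^ 2 * ∏ k ∈ Finset.univ.erase l, (μ - A k)) := fun l => by
    rw [← Finset.mul_prod_erase Finset.univ (fun k => μ - A k) (Finset.mem_univ l)]
    linear_combination (2 * p l * ∏ k ∈ Finset.univ.erase l, (μ - A k)) * h.2 l
  rw [Finset.mul_sum, Finset.sum_congr rfl fun l _ => h1 l, Finset.sum_add_distrib,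
    ← Finset.mul_sum, ← Finset.sum_mul, ← Finset.mul_sum, ← hin, secular]
  ring

/-- The eigenvalue of `diag A - p pᵀ` for the tangent eigenvector `v`. -/
noncomputable def rayleigh (A : Fin (m + 1) → ℝ) (v : Euc (m + 1)) : ℝ :=
  (∑ l, v l ^ 2) / ∑ l, v l ^ 2 / A l

theorem rayleigh_denominator_pos (hA : ∀ k, 0 < A k) {v : Euc (m + 1)} (hv : v ≠ 0) :
    0 < ∑ l, v l ^ 2 / A l := by
  refine lt_of_le_of_ne (Finset.sum_nonneg fun l _ => div_nonneg (sq_nonneg _) (hA l).le)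
    fun h1 => hv ?_
  ext l
  have := (Finset.sum_eq_zero_iff_of_nonneg
    (fun l _ => div_nonneg (sq_nonneg (v l)) (hA l).le)).mp h1.symm l (Finset.mem_univ l)
  simpa [(hA l).ne'] using this

/-- Pairing the eigenvector equation with `v l / A l`, tangency kills the right-hand side. The
moving root thus becomes a continuous function of the velocity of a principal line. -/
theorem IsConfocalVector.rayleigh_eq (hA : ∀ k, 0 < A k) {p v : Euc (m + 1)} {r : ℝ} (hv : v ≠ 0)
    (h : IsConfocalVector A p r v) : rayleigh A v = r := by
  have h2 : ∀ l, v l ^ 2 - r * (v l ^ 2 / A l) = inner ℝ p v * (p l * v l / A l) := fun l => by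
    have := (hA l).ne'
    field_simp
    linear_combination v l * h.2 l
  have h3 := Finset.sum_congr (rfl : Finset.univ = Finset.univ) fun l _ => h2 l
  rw [Finset.sum_sub_distrib, ← Finset.mul_sum, ← Finset.mul_sum, h.1, mul_zero] at h3
  rw [rayleigh, div_eq_iff (rayleigh_denominator_pos hA hv).ne']
  linarith

/-- A vanishing curvature would make `v` a multiple of `p`, which tangency excludes. So the
curvature has the form `2 / (r |∇F|)` with `r ≠ 0`, and `r` must be the Rayleigh quotient. -/
theorem IsCurvatureVector.isConfocalVector (hA : ∀ k, 0 < A k) {p v : Euc (m + 1)}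
    (hp : p ∈ hypersurface (quadric A)) {κ : ℝ} (hv : v ≠ 0)
    (h : IsCurvatureVector (quadric A) p κ v) : IsConfocalVector A p (rayleigh A v) v := by
  have hg := quadricGrad_ne_zero hA hp
  have hn : ‖quadricGrad A p‖ ≠ 0 := norm_ne_zero_iff.mpr hg
  have hκ : κ ≠ 0 := by
    rintro rfl
    rw [isCurvatureVector_iff (Eventually.of_forall (hasGradientAt_quadric A))
      (quadricGrad A).hasFDerivAt hg, inner_quadricGrad] at h
    obtain ⟨h1, s, hs⟩ := h
    have h2 : ∀ l, v l = s * p l := fun l => by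
      have h2 : 2 * v l / A l = s * (2 * p l / A l) := by
        simpa using congrArg (fun w : Euc (m + 1) => w l) hs
      have := (hA l).ne'
      field_simp at h2
      exact h2
    have h3 : ∑ l, p l * v l / A l = s * ∑ l, p l ^ 2 / A l := by
      rw [Finset.mul_sum]
      exact Finset.sum_congr rfl fun l _ => by rw [h2]; ring
    rw [h3, sum_sq_div_eq_one hp] at h1
    have hs0 : s = 0 := by linarith
    exact hv (by ext l; simp [h2, hs0])
  have hr : 2 / (κ * ‖quadricGrad A p‖) ≠ 0 := by positivity
  have hκ' : κ = 2 / (2 / (κ * ‖quadricGrad A p‖) * ‖quadricGrad A p‖) := by field_simp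
  rw [hκ', isCurvatureVector_quadric_iff hA hp hr] at h
  rw [IsConfocalVector.rayleigh_eq hA hv h]
  exact h

section Line

variable {i : Fin m} {γ : ℝ → Euc (m + 1)} {s₀ s₁ : ℝ}

theorem IsPrincipalLine.hasDerivAt {F : Euc (m + 1) → ℝ} (h : IsPrincipalLine F i γ s₀ s₁) {t : ℝ}
    (ht : t ∈ Ioo s₀ s₁) : HasDerivAt γ (deriv γ t) t :=
  ((h.1.differentiableOn one_ne_zero).differentiableAt (isOpen_Ioo.mem_nhds ht)).hasDerivAt

theorem IsPrincipalLine.continuousAt_deriv {F : Euc (m + 1) → ℝ} (h : IsPrincipalLine F i γ s₀ s₁)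
    {t : ℝ} (ht : t ∈ Ioo s₀ s₁) : ContinuousAt (deriv γ) t :=
  (h.1.continuousOn_deriv_of_isOpen isOpen_Ioo le_rfl).continuousAt (isOpen_Ioo.mem_nhds ht)

theorem IsPrincipalLine.isConfocalVector (hA : ∀ k, 0 < A k)
    (h : IsPrincipalLine (quadric A) i γ s₀ s₁) {t : ℝ} (ht : t ∈ Ioo s₀ s₁) :
    IsConfocalVector A (γ t) (rayleigh A (deriv γ t)) (deriv γ t) := by
  obtain ⟨h1, h2, k, -, -, h3⟩ := h.2 t ht
  exact h3.isConfocalVector hA h1 h2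

theorem IsPrincipalLine.continuousAt_rayleigh (hA : ∀ k, 0 < A k)
    (h : IsPrincipalLine (quadric A) i γ s₀ s₁) {t : ℝ} (ht : t ∈ Ioo s₀ s₁) :
    ContinuousAt (fun s => rayleigh A (deriv γ s)) t := by
  have h1 := h.continuousAt_deriv ht
  have h2 : ∀ l, ContinuousAt (fun s => deriv γ s l) t := fun l =>
    (EuclideanSpace.proj l : StrongDual ℝ (Euc (m + 1))).continuous.continuousAt.comp h1
  unfold rayleigh
  refine ContinuousAt.div (tendsto_finsetSum _ fun l _ => (h2 l).pow 2)
    (tendsto_finsetSum _ fun l _ => ((h2 l).pow 2).div_const _)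
    (rayleigh_denominator_pos hA (h.2 t ht).2.1).ne'

/-- By `IsConfocalVector.secular_deriv`, the value of `secular` at `μ` solves a homogeneous linear
equation as long as the moving root stays away from `μ`, which continuity guarantees near `t`. -/
theorem IsPrincipalLine.eventually_secular_eq_zero (hA : ∀ k, 0 < A k)
    (h : IsPrincipalLine (quadric A) i γ s₀ s₁) {t : ℝ} (ht : t ∈ Ioo s₀ s₁) {μ : ℝ}
    (h0 : secular A (γ t) μ = 0) (hμ : rayleigh A (deriv γ t) ≠ μ) :
    ∀ᶠ t' in 𝓝 t, secular A (γ t') μ = 0 := by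
  have hν := h.continuousAt_rayleigh hA ht
  refine eventually_eq_zero_of_hasDerivAt_mul
    (k := fun s => 2 * inner ℝ (γ s) (deriv γ s) / (μ - rayleigh A (deriv γ s))) ?_ ?_ h0
  · exact ((((h.hasDerivAt ht).continuousAt.inner (𝕜 := ℝ) (h.continuousAt_deriv ht)).const_mul
      2)).div (continuousAt_const.sub hν) (sub_ne_zero.mpr hμ.symm)
  · filter_upwards [hν.eventually_ne hμ, isOpen_Ioo.mem_nhds ht] with s hs hs'
    refine (hasDerivAt_secular (h.hasDerivAt hs') μ).congr_deriv ?_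
    have h1 := (h.isConfocalVector hA hs').secular_deriv μ
    have h2 : μ - rayleigh A (deriv γ s) ≠ 0 := sub_ne_zero.mpr hs.symm
    rw [div_mul_eq_mul_div, eq_div_iff h2]
    linarith

end Line

end FirstIntegral

/-! ### Leaves of a net in ellipsoidal coordinates. -/

section Net

variable {m : ℕ}

/-- The point with coordinates `X l α * Y l β`. -/
def separated {n : ℕ} (X Y : Fin n → ℝ → ℝ) (α β : ℝ) : Euc n :=
  WithLp.toLp 2 fun l => X l α * Y l β

@[simp] theorem separated_apply {n : ℕ} (X Y : Fin n → ℝ → ℝ) (α β : ℝ) (l : Fin n) :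
    separated X Y α β l = X l α * Y l β := rfl

theorem separated_swap {n : ℕ} (X Y : Fin n → ℝ → ℝ) (α β : ℝ) :
    separated Y X β α = separated X Y α β := by
  ext l
  simp [mul_comm]

/-- A parametrization with separated variables of a surface `C` in the quadric `∑ xₗ² / Aₗ = 1`, on
which all ellipsoidal coordinates `r k` but the `i`-th and the `j`-th ones are constant, the latter
being `v α` and `u β`. -/
structure ConfocalNet (A : Fin (m + 1) → ℝ) (i j : Fin m) (r : ℝ → ℝ → Fin m → ℝ)
    (ρ : Fin m → ℝ) (C : Set (Euc (m + 1))) (X Y : Fin (m + 1) → ℝ → ℝ) (v u : ℝ → ℝ) :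
    Prop where
  pos : ∀ k, 0 < A k
  ne : i ≠ j
  anti : ∀ α β, Antitone (r α β)
  root_pos : ∀ α β k, 0 < r α β k
  root_fst : ∀ α β, r α β i = v α
  root_snd : ∀ α β, r α β j = u β
  root_other : ∀ α β k, k ≠ i → k ≠ j → r α β k = ρ k
  sep_fst : ∀ k, k ≠ i → k ≠ j → ∀ α, ρ k ≠ v α
  sep_snd : ∀ k, k ≠ i → k ≠ j → ∀ β, ρ k ≠ u β
  secular_eq : ∀ α β t, secular A (separated X Y α β) t = t * ∏ k, (t - r α β k)
  range_eq : C = range fun x : ℝ × ℝ => separated X Y x.1 x.2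
  isClosed : IsClosed C
  -- This allows `C` to be a single component of the set on which the constant roots take their
  -- prescribed values.
  subset_of_connected : ∀ s : Set (Euc (m + 1)), IsPreconnected s →
    (∀ x ∈ s, secular A x 0 = 0 ∧ ∀ k, k ≠ i → k ≠ j → secular A x (ρ k) = 0) →
    (s ∩ C).Nonempty → s ⊆ C
  smooth_fst : ∀ l, ContDiff ℝ 1 (X l)
  smooth_snd : ∀ l, ContDiff ℝ 1 (Y l)
  -- Multiplied by `Y l β`, this is the eigenvector equation for the velocity of the curve with `β`
  -- fixed.
  ode_fst : ∀ l α, (A l - v α) * deriv (X l) α = -(deriv v α / 2) * X l α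
  ode_snd : ∀ l β, (A l - u β) * deriv (Y l) β = -(deriv u β / 2) * Y l β
  sq_fst : ∀ l α α', v α = v α' → X l α ^ 2 = X l α' ^ 2
  sq_snd : ∀ l β β', u β = u β' → Y l β ^ 2 = Y l β' ^ 2

variable {A : Fin (m + 1) → ℝ} {i j : Fin m} {r : ℝ → ℝ → Fin m → ℝ} {ρ : Fin m → ℝ}
  {C : Set (Euc (m + 1))} {X Y : Fin (m + 1) → ℝ → ℝ} {v u : ℝ → ℝ}

namespace ConfocalNet

/-- The two variables play symmetric roles, so that results on the `i`-th foliation serve for the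
`j`-th one as well. -/
theorem swap (h : ConfocalNet A i j r ρ C X Y v u) :
    ConfocalNet A j i (fun β α => r α β) ρ C Y X u v where
  pos := h.pos
  ne := h.ne.symm
  anti α β := h.anti β α
  root_pos α β := h.root_pos β α
  root_fst α β := h.root_snd β α
  root_snd α β := h.root_fst β α
  root_other α β k hi hj := h.root_other β α k hj hi
  sep_fst k hi hj := h.sep_snd k hj hi
  sep_snd k hi hj := h.sep_fst k hj hi
  secular_eq α β t := by rw [separated_swap, h.secular_eq]
  range_eq := by
    rw [h.range_eq]
    ext x
    constructor
    · rintro ⟨⟨a, b⟩, rfl⟩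
      exact ⟨⟨b, a⟩, separated_swap _ _ _ _⟩
    · rintro ⟨⟨a, b⟩, rfl⟩
      exact ⟨⟨b, a⟩, separated_swap _ _ _ _⟩
  isClosed := h.isClosed
  subset_of_connected s hs hx := h.subset_of_connected s hs fun x hxs =>
    ⟨(hx x hxs).1, fun k hi hj => (hx x hxs).2 k hj hi⟩
  smooth_fst := h.smooth_snd
  smooth_snd := h.smooth_fst
  ode_fst := h.ode_snd
  ode_snd := h.ode_fst
  sq_fst := h.sq_snd
  sq_snd := h.sq_fst

variable (h : ConfocalNet A i j r ρ C X Y v u)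
include h

theorem mem (α β : ℝ) : separated X Y α β ∈ C := by
  rw [h.range_eq]
  exact ⟨(α, β), rfl⟩

theorem mem_hypersurface (α β : ℝ) : separated X Y α β ∈ hypersurface (quadric A) := by
  rw [mem_hypersurface_quadric_iff h.pos, h.secular_eq, zero_mul]

theorem subset_hypersurface : C ⊆ hypersurface (quadric A) := by
  rw [h.range_eq]
  rintro _ ⟨x, rfl⟩
  exact h.mem_hypersurface _ _

theorem hasPrincipalCurvatures (α β : ℝ) :
    HasPrincipalCurvatures (quadric A) (separated X Y α β)
      fun k => 2 / (r α β k * ‖quadricGrad A (separated X Y α β)‖) :=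
  hasPrincipalCurvatures_quadric h.pos (h.mem_hypersurface α β) (h.anti α β) (h.root_pos α β)
    (h.secular_eq α β)

/-- The constant roots are separated from `v`, so the `i`-th root can only collide with the `j`-th
one. -/
theorem memLineField_iff (α β : ℝ) (w : Euc (m + 1)) :
    MemLineField (quadric A) i (separated X Y α β) w ↔
      v α ≠ u β ∧ IsConfocalVector A (separated X Y α β) (v α) w := by
  rw [memLineField_quadric_iff h.pos (h.mem_hypersurface α β) (h.anti α β) (h.root_pos α β)
    (h.secular_eq α β), h.root_fst]
  refine and_congr_left fun _ => ⟨fun hk hvu => ?_, fun hvu k hk => ?_⟩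
  · exact hk j h.ne.symm (by rw [h.root_snd, hvu])
  · by_cases hkj : k = j
    · rw [hkj, h.root_snd]
      exact hvu.symm
    · rw [h.root_other _ _ _ hk hkj]
      exact h.sep_fst _ hk hkj _

theorem prod_eq (α β t : ℝ) : ∏ k, (t - r α β k) =
    (t - v α) * ((t - u β) * ∏ k ∈ (Finset.univ.erase i).erase j, (t - ρ k)) := by
  rw [← Finset.mul_prod_erase Finset.univ _ (Finset.mem_univ i), h.root_fst,
    ← Finset.mul_prod_erase (Finset.univ.erase i) _
      (Finset.mem_erase.mpr ⟨h.ne.symm, Finset.mem_univ j⟩), h.root_snd]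
  congr 2
  refine Finset.prod_congr rfl fun k hk => ?_
  simp only [Finset.mem_erase, Finset.mem_univ, and_true] at hk
  rw [h.root_other _ _ _ hk.2 hk.1]

/-- The roots are positive, so none of them is `-1`, and evaluation there recovers `u β` from the
point and `v α`. Along a principal line this shows that `u` varies continuously even if the
parameter `β` is not chosen continuously. -/
theorem snd_eq (α β : ℝ) : u β = -1 + secular A (separated X Y α β) (-1) /
    ((-1 - v α) * ∏ k ∈ (Finset.univ.erase i).erase j, (-1 - ρ k)) := by
  have h1 : (-1 - v α) ≠ 0 := by
    have := h.root_pos α β i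
    rw [h.root_fst] at this
    linarith
  have h2 : ∏ k ∈ (Finset.univ.erase i).erase j, (-1 - ρ k) ≠ 0 := by
    refine Finset.prod_ne_zero_iff.mpr fun k hk => ?_
    simp only [Finset.mem_erase, Finset.mem_univ, and_true] at hk
    have := h.root_pos α β k
    rw [h.root_other _ _ _ hk.2 hk.1] at this
    linarith
  rw [h.secular_eq, h.prod_eq]
  field_simp
  ring

section Line

variable {γ : ℝ → Euc (m + 1)} {s₀ s₁ t₀ : ℝ}

/-- A principal line that meets the surface stays in it. -/
theorem line_mem (hγ : IsPrincipalLine (quadric A) i γ s₀ s₁) (ht₀ : t₀ ∈ Ioo s₀ s₁)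
    (h₀ : γ t₀ ∈ C) : ∀ t ∈ Ioo s₀ s₁, γ t ∈ C := by
  refine forall_mem_Ioo_of_clopen ht₀ h₀ (fun t ht htC => ?_) fun t ht hf => ?_
  · have hr := htC
    rw [h.range_eq] at hr
    obtain ⟨⟨α, β⟩, hαβ⟩ := hr
    have hmem := (hγ.2 t ht).2.2
    rw [← hαβ, h.memLineField_iff] at hmem
    have hν : rayleigh A (deriv γ t) = v α := hmem.2.rayleigh_eq h.pos (hγ.2 t ht).2.1
    have hsec : ∀ k, k ≠ i → k ≠ j → secular A (γ t) (ρ k) = 0 := fun k hki hkj => by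
      rw [← hαβ, h.secular_eq, ← h.root_other α β k hki hkj,
        Finset.prod_eq_zero (Finset.mem_univ k) (sub_self _), mul_zero]
    -- The moving root is `v α`, different from every `ρ k`, so the equations for the constant roots
    -- persist along the line.
    have hev : ∀ᶠ t' in 𝓝 t, ∀ k, k ≠ i → k ≠ j → secular A (γ t') (ρ k) = 0 := by
      refine eventually_all.mpr fun k => ?_
      by_cases hki : k = i
      · simp [hki]
      by_cases hkj : k = j
      · simp [hkj]
      filter_upwards [hγ.eventually_secular_eq_zero h.pos ht (hsec k hki hkj)
        (hν ▸ (h.sep_fst k hki hkj α).symm)] with t' ht' _ _ using ht'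
    obtain ⟨a, b, hab, hs⟩ :=
      mem_nhds_iff_exists_Ioo_subset.mp (hev.and (isOpen_Ioo.mem_nhds ht))
    have hcon : IsPreconnected (γ '' Ioo a b) := isPreconnected_Ioo.image _
      (hγ.1.continuousOn.mono fun s hs' => (hs hs').2)
    have hsub := h.subset_of_connected _ hcon (by
      rintro _ ⟨s, hs', rfl⟩
      exact ⟨(mem_hypersurface_quadric_iff h.pos _).mp (hγ.2 s (hs hs').2).1, (hs hs').1⟩)
      ⟨γ t, mem_image_of_mem _ hab, htC⟩
    filter_upwards [isOpen_Ioo.mem_nhds hab] with s hs'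
    exact hsub (mem_image_of_mem _ hs')
  · exact h.isClosed.mem_of_frequently_of_tendsto (hf.mono fun _ h' => h'.2)
      (hγ.hasDerivAt ht).continuousAt

/-- The parameters `a`, `b` need not be continuous. For openness, the root `u (b t₀)` persists along
the line and can be neither the moving root nor one of the constant ones, so it is `u (b s)`. For
closedness, `snd_eq` writes `u (b s)` as a continuous function of `s`. -/
theorem line_snd (hγ : IsPrincipalLine (quadric A) i γ s₀ s₁) (ht₀ : t₀ ∈ Ioo s₀ s₁)
    {a b : ℝ → ℝ} (hab : ∀ t ∈ Ioo s₀ s₁, γ t = separated X Y (a t) (b t)) :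
    ∀ t ∈ Ioo s₀ s₁, u (b t) = u (b t₀) := by
  have hmem : ∀ t ∈ Ioo s₀ s₁, v (a t) ≠ u (b t) ∧ rayleigh A (deriv γ t) = v (a t) :=
    fun t ht => by
      have hmem := (hγ.2 t ht).2.2
      rw [hab t ht, h.memLineField_iff] at hmem
      exact ⟨hmem.1, hmem.2.rayleigh_eq h.pos (hγ.2 t ht).2.1⟩
  refine forall_mem_Ioo_of_clopen ht₀ rfl (fun t ht htu => ?_) fun t ht hf => ?_
  · have hne : rayleigh A (deriv γ t) ≠ u (b t₀) := by
      rw [(hmem t ht).2, ← htu]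
      exact (hmem t ht).1
    have h0 : secular A (γ t) (u (b t₀)) = 0 := by
      rw [← htu, hab t ht, h.secular_eq, ← h.root_snd (a t) (b t),
        Finset.prod_eq_zero (Finset.mem_univ j) (sub_self _), mul_zero]
    filter_upwards [hγ.eventually_secular_eq_zero h.pos ht h0 hne,
      (hγ.continuousAt_rayleigh h.pos ht).eventually_ne hne, isOpen_Ioo.mem_nhds ht]
      with s hs hs1 hs2
    rw [hab s hs2, h.secular_eq] at hs
    have hu : u (b t₀) ≠ 0 := by
      rw [← h.root_snd (a t₀)]
      exact (h.root_pos _ _ _).ne'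
    obtain ⟨k, -, hk⟩ := Finset.prod_eq_zero_iff.mp ((mul_eq_zero.mp hs).resolve_left hu)
    by_cases hki : k = i
    · rw [hki, h.root_fst, ← (hmem s hs2).2] at hk
      exact absurd (sub_eq_zero.mp hk).symm hs1
    by_cases hkj : k = j
    · rw [hkj, h.root_snd] at hk
      exact (sub_eq_zero.mp hk).symm
    · rw [h.root_other _ _ _ hki hkj] at hk
      exact absurd (sub_eq_zero.mp hk).symm (h.sep_snd k hki hkj _)
  · set f : ℝ → ℝ := fun s => -1 + secular A (γ s) (-1) /
      ((-1 - rayleigh A (deriv γ s)) * ∏ k ∈ (Finset.univ.erase i).erase j, (-1 - ρ k)) with hfdef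
    have hfu : ∀ s ∈ Ioo s₀ s₁, f s = u (b s) := fun s hs => by
      rw [hfdef, h.snd_eq (a s) (b s), ← hab s hs, ← (hmem s hs).2]
    have hden : (-1 - rayleigh A (deriv γ t)) *
        ∏ k ∈ (Finset.univ.erase i).erase j, (-1 - ρ k) ≠ 0 := by
      rw [(hmem t ht).2]
      refine mul_ne_zero ?_ (Finset.prod_ne_zero_iff.mpr fun k hk => ?_)
      · have := h.root_pos (a t) (b t) i
        rw [h.root_fst] at this
        linarith
      · simp only [Finset.mem_erase, Finset.mem_univ, and_true] at hk
        have := h.root_pos (a t) (b t) k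
        rw [h.root_other _ _ _ hk.2 hk.1] at this
        linarith
    have hfc : ContinuousAt f t := by
      refine continuousAt_const.add (ContinuousAt.div ?_ ?_ hden)
      · exact (continuous_secular A (-1)).continuousAt.comp (hγ.hasDerivAt ht).continuousAt
      · exact (continuousAt_const.sub (hγ.continuousAt_rayleigh h.pos ht)).mul continuousAt_const
    rw [← hfu t ht]
    exact isClosed_singleton.mem_of_frequently_of_tendsto
      (hf.mono fun s hs => show f s ∈ ({u (b t₀)} : Set ℝ) from (hfu s hs.1).trans hs.2) hfc

end Line

/-- On a leaf of the `i`-th foliation the coordinate `β` is constant, up to the ambiguity of the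
parametrization. -/
theorem leaf_subset {α β : ℝ} {q : Euc (m + 1)}
    (hq : q ∈ leaf (quadric A) i (separated X Y α β)) :
    v α ≠ u β ∧ ∃ α' β', q = separated X Y α' β' ∧ v α' ≠ u β' ∧ u β' = u β ∧
      ∀ l, (∀ a, 0 < X l a) → Y l β' = Y l β := by
  obtain ⟨γ, s₀, s₁, hγ, s, hs, t, ht, hps, rfl⟩ := hq
  have hC := h.line_mem hγ hs (hps ▸ h.mem α β)
  have hex : ∀ t, ∃ x : ℝ × ℝ, t ∈ Ioo s₀ s₁ → γ t = separated X Y x.1 x.2 := fun t => by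
    by_cases ht : t ∈ Ioo s₀ s₁
    · have := hC t ht
      rw [h.range_eq] at this
      obtain ⟨x, hx⟩ := this
      exact ⟨x, fun _ => hx.symm⟩
    · exact ⟨0, fun h' => absurd h' ht⟩
  choose x hx using hex
  have hne : ∀ t ∈ Ioo s₀ s₁, ∀ α β, γ t = separated X Y α β → v α ≠ u β :=
    fun t ht α β hαβ => by
      have hmem := (hγ.2 t ht).2.2
      rw [hαβ, h.memLineField_iff] at hmem
      exact hmem.1
  -- The choice of parameters is modified at `s` so as to be `(α, β)` there.
  obtain ⟨y, hy, hys⟩ : ∃ y : ℝ → ℝ × ℝ, (∀ t ∈ Ioo s₀ s₁, γ t = separated X Y (y t).1 (y t).2) ∧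
      y s = (α, β) := by
    refine ⟨Function.update x s (α, β), fun t ht => ?_, by simp⟩
    by_cases hts : t = s
    · subst hts
      simpa using hps
    · simpa [hts] using hx t ht
  have hu := h.line_snd hγ hs (a := fun t => (y t).1) (b := fun t => (y t).2) hy
  simp only [hys] at hu
  refine ⟨hne s hs α β hps, (y t).1, (y t).2, hy t ht, hne t ht _ _ (hy t ht), hu t ht,
    fun l hl => ?_⟩
  have hsq : ∀ t ∈ Ioo s₀ s₁, Y l (y t).2 ^ 2 = Y l β ^ 2 := fun t ht => h.sq_snd _ _ _ (hu t ht)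
  have hval : ∀ t ∈ Ioo s₀ s₁, γ t l = X l (y t).1 * Y l (y t).2 := fun t ht => by
    rw [hy t ht, separated_apply]
  rcases sq_eq_sq_iff_eq_or_eq_neg.mp (hsq t ht) with h1 | h1
  · exact h1
  by_contra hcon
  have hβ : Y l β ≠ 0 := fun h0 => hcon (by rw [h1, h0, neg_zero])
  have hcont : ContinuousOn (fun t => γ t l) (Ioo s₀ s₁) :=
    (EuclideanSpace.proj l : StrongDual ℝ (Euc (m + 1))).continuous.comp_continuousOn
      hγ.1.continuousOn
  have hs' : γ s l = X l α * Y l β := by rw [hps, separated_apply]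
  have ht' : γ t l = -(X l (y t).1 * Y l β) := by rw [hval t ht, h1, mul_neg]
  obtain ⟨c, hc, hc0⟩ : ∃ c ∈ Ioo s₀ s₁, γ c l = 0 := by
    rcases lt_or_gt_of_ne hβ with hneg | hpos
    · have ha : γ s l ≤ 0 := by rw [hs']; nlinarith [hl α]
      have hb : 0 ≤ γ t l := by rw [ht']; nlinarith [hl (y t).1]
      exact isPreconnected_Ioo.intermediate_value hs ht hcont ⟨ha, hb⟩
    · have ha : 0 ≤ γ s l := by rw [hs']; nlinarith [hl α]
      have hb : γ t l ≤ 0 := by rw [ht']; nlinarith [hl (y t).1]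
      exact isPreconnected_Ioo.intermediate_value ht hs hcont ⟨hb, ha⟩
  rw [hval c hc] at hc0
  have h2 : Y l (y c).2 = 0 := (mul_eq_zero.mp hc0).resolve_left (hl _).ne'
  have h3 := hsq c hc
  rw [h2] at h3
  exact hβ (pow_eq_zero_iff two_ne_zero |>.mp (by linarith))

/-- The velocity is tangent because the curve lies on the quadric. The equations `ode_fst` make it
an eigenvector once `-(deriv v s / 2)` is identified with the scalar product of point and velocity,
by summing them with the weights `p l / A l`. -/
theorem isPrincipalLine {a b β : ℝ}
    (hreg : ∀ s ∈ Ioo a b, v s ≠ u β ∧ ∃ l, deriv (X l) s * Y l β ≠ 0) :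
    IsPrincipalLine (quadric A) i (fun s => separated X Y s β) a b := by
  have hsm : ContDiff ℝ 1 fun s => separated X Y s β :=
    (contDiff_euclidean (𝕜 := ℝ)).mpr fun l => (h.smooth_fst l).mul contDiff_const
  refine ⟨hsm.contDiffOn, fun s hs => ⟨h.mem_hypersurface s β, ?_⟩⟩
  have hder : ∀ s, HasDerivAt (fun s => separated X Y s β)
      (deriv (fun s => separated X Y s β) s) s := fun s =>
    (hsm.differentiable one_ne_zero).differentiableAt.hasDerivAt
  have hcoord : ∀ s l, deriv (fun s => separated X Y s β) s l = deriv (X l) s * Y l β :=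
    fun s l => (hasDerivAt_apply (hder s) l).unique
      (((h.smooth_fst l).differentiable one_ne_zero).differentiableAt.hasDerivAt.mul_const _)
  obtain ⟨hvu, l₀, hl₀⟩ := hreg s hs
  refine ⟨fun h0 => hl₀ (by rw [← hcoord, h0]; rfl), ?_⟩
  rw [h.memLineField_iff]
  refine ⟨hvu, ?_⟩
  set p := separated X Y s β with hp
  set w := deriv (fun s => separated X Y s β) s with hw
  have htan : ∑ l, p l * w l / A l = 0 := by
    have h1 := (hasGradientAt_quadric A p).hasFDerivAt.comp_hasDerivAt s (hder s)
    have h2 : (quadric A ∘ fun s => separated X Y s β) = fun _ => 0 :=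
      funext fun s => h.mem_hypersurface s β
    rw [h2] at h1
    have h3 := h1.unique (hasDerivAt_const s (0 : ℝ))
    rw [InnerProductSpace.toDual_apply_apply, ← hw, inner_quadricGrad] at h3
    linarith
  have hode : ∀ l, (A l - v s) * w l = -(deriv v s / 2) * p l := fun l => by
    rw [hcoord, hp, separated_apply]
    linear_combination Y l β * h.ode_fst l s
  have hin : inner ℝ p w = -(deriv v s / 2) := by
    have h3 : ∀ l, p l * w l - v s * (p l * w l / A l) = -(deriv v s / 2) * (p l ^ 2 / A l) :=
      fun l => by
        have := (h.pos l).ne'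
        field_simp
        linear_combination 2 * p l * hode l
    have h4 := Finset.sum_congr (rfl : Finset.univ = Finset.univ) fun l _ => h3 l
    rw [Finset.sum_sub_distrib, ← Finset.mul_sum, ← Finset.mul_sum, htan,
      sum_sq_div_eq_one (h.mem_hypersurface s β)] at h4
    rw [PiLp.inner_apply]
    have h5 : ∑ l, inner ℝ (p l) (w l) = ∑ l, p l * w l :=
      Finset.sum_congr rfl fun l _ => by simp [mul_comm]
    rw [h5]
    linarith
  exact ⟨htan, fun l => by rw [hode, hin]⟩

theorem mem_leaf {a b α α' β : ℝ} (hα : α ∈ Ioo a b) (hα' : α' ∈ Ioo a b)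
    (hreg : ∀ s ∈ Ioo a b, v s ≠ u β ∧ ∃ l, deriv (X l) s * Y l β ≠ 0) :
    separated X Y α' β ∈ leaf (quadric A) i (separated X Y α β) :=
  ⟨_, a, b, h.isPrincipalLine hreg, α, hα, α', hα', rfl, rfl⟩

end ConfocalNet

end Net

/-! ### Smooth square roots through an angle. -/

section Amplitude

variable {n : ℕ} (A : Fin n → ℝ) (p q : Fin n)

/-- A point moving between `A q` and `A p`. -/
noncomputable def ampVal (θ : ℝ) : ℝ := A p * Real.sin θ ^ 2 + A q * Real.cos θ ^ 2

/-- A square root of `|A l - ampVal A p q θ|` that is smooth in `θ`. -/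
noncomputable def amp (l : Fin n) (θ : ℝ) : ℝ :=
  if l = p then Real.sqrt |A p - A q| * Real.cos θ
  else if l = q then Real.sqrt |A p - A q| * Real.sin θ
  else Real.sqrt |A l - ampVal A p q θ|

theorem ampVal_eq_left (θ : ℝ) : ampVal A p q θ = A p - (A p - A q) * Real.cos θ ^ 2 := by
  rw [ampVal, Real.sin_sq]; ring

theorem ampVal_eq_right (θ : ℝ) : ampVal A p q θ = A q + (A p - A q) * Real.sin θ ^ 2 := by
  rw [ampVal, Real.cos_sq']; ring

variable {A p q}

theorem amp_left (θ : ℝ) : amp A p q p θ = Real.sqrt |A p - A q| * Real.cos θ := if_pos rfl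

theorem amp_right (hpq : p ≠ q) (θ : ℝ) :
    amp A p q q θ = Real.sqrt |A p - A q| * Real.sin θ := by
  rw [amp, if_neg hpq.symm, if_pos rfl]

theorem amp_other {l : Fin n} (hp : l ≠ p) (hq : l ≠ q) (θ : ℝ) :
    amp A p q l θ = Real.sqrt |A l - ampVal A p q θ| := by
  rw [amp, if_neg hp, if_neg hq]

theorem amp_sq (l : Fin n) (θ : ℝ) : amp A p q l θ ^ 2 = |A l - ampVal A p q θ| := by
  by_cases hp : l = p
  · subst hp
    rw [amp_left, mul_pow, Real.sq_sqrt (abs_nonneg _), ampVal_eq_left, sub_sub_cancel, abs_mul,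
      abs_of_nonneg (sq_nonneg (Real.cos θ))]
  by_cases hq : l = q
  · subst hq
    rw [amp_right (Ne.symm hp), mul_pow, Real.sq_sqrt (abs_nonneg _), ampVal_eq_right,
      sub_add_cancel_left, abs_neg, abs_mul, abs_of_nonneg (sq_nonneg (Real.sin θ))]
  · rw [amp_other hp hq, Real.sq_sqrt (abs_nonneg _)]

theorem contDiff_ampVal {k : WithTop ℕ∞} : ContDiff ℝ k (ampVal A p q) := by
  unfold ampVal
  exact (contDiff_const.mul (Real.contDiff_sin.pow 2)).add
    (contDiff_const.mul (Real.contDiff_cos.pow 2))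

theorem amp_pos {l : Fin n} (hp : l ≠ p) (hq : l ≠ q) {θ : ℝ} (h : A l ≠ ampVal A p q θ) :
    0 < amp A p q l θ := by
  rw [amp_other hp hq]
  exact Real.sqrt_pos.mpr (abs_pos.mpr (sub_ne_zero.mpr h))

variable (hsep : ∀ l, l ≠ p → l ≠ q → ∀ θ, A l ≠ ampVal A p q θ)

include hsep in
theorem contDiff_amp (l : Fin n) : ContDiff ℝ 1 (amp A p q l) := by
  by_cases hp : l = p
  · subst hp
    simp only [funext (amp_left (A := A) (p := l) (q := q))]
    exact contDiff_const.mul Real.contDiff_cos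
  by_cases hq : l = q
  · subst hq
    simp only [funext (amp_right (A := A) (Ne.symm hp))]
    exact contDiff_const.mul Real.contDiff_sin
  · simp only [funext (amp_other (A := A) hp hq)]
    rw [contDiff_iff_contDiffAt]
    intro θ
    have h0 : A l - ampVal A p q θ ≠ 0 := sub_ne_zero.mpr (hsep l hp hq θ)
    have h1 : ContDiffAt ℝ 1 (fun θ => A l - ampVal A p q θ) θ :=
      (contDiff_const.sub contDiff_ampVal).contDiffAt
    exact (h1.abs h0).sqrt (abs_ne_zero.mpr h0)

-- For `l` other than `p` and `q`, differentiate `amp ^ 4 = (A l - ampVal) ^ 2`; the fourth power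
-- removes the absolute value.
include hsep in
theorem amp_ode (hpq : p ≠ q) (l : Fin n) (θ : ℝ) :
    (A l - ampVal A p q θ) * deriv (amp A p q l) θ =
      -(deriv (ampVal A p q) θ / 2) * amp A p q l θ := by
  have hv : HasDerivAt (ampVal A p q) (2 * (A p - A q) * Real.sin θ * Real.cos θ) θ := by
    have := (((Real.hasDerivAt_sin θ).fun_pow 2).const_mul (A p)).fun_add
      (((Real.hasDerivAt_cos θ).fun_pow 2).const_mul (A q))
    refine this.congr_deriv ?_
    push_cast
    ring
  rw [hv.deriv]
  by_cases hp : l = p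
  · subst hp
    simp only [funext (amp_left (A := A) (p := l) (q := q))]
    rw [((Real.hasDerivAt_cos θ).const_mul _).deriv, ampVal_eq_left]
    ring
  by_cases hq : l = q
  · subst hq
    simp only [funext (amp_right (A := A) (Ne.symm hp))]
    rw [((Real.hasDerivAt_sin θ).const_mul _).deriv, ampVal_eq_right]
    ring
  · have hd := ((contDiff_amp hsep l).differentiable one_ne_zero).differentiableAt (x := θ)
      |>.hasDerivAt
    have h0 : A l - ampVal A p q θ ≠ 0 := sub_ne_zero.mpr (hsep l hp hq θ)
    have h4 : (fun θ => amp A p q l θ ^ 4) = fun θ => (A l - ampVal A p q θ) ^ 2 := by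
      funext θ
      rw [show 4 = 2 * 2 from rfl, pow_mul, amp_sq, sq_abs]
    have h5 := hd.fun_pow 4
    rw [h4] at h5
    have h6 := h5.unique ((hv.const_sub (A l)).fun_pow 2)
    have h7 := congrFun h4 θ
    push_cast at h6
    norm_num at h6
    have h8 : (A l - ampVal A p q θ) * ((A l - ampVal A p q θ) * deriv (amp A p q l) θ -
        -(2 * (A p - A q) * Real.sin θ * Real.cos θ / 2) * amp A p q l θ) = 0 := by
      linear_combination amp A p q l θ / 4 * h6 - deriv (amp A p q l) θ * h7
    exact sub_eq_zero.mp ((mul_eq_zero.mp h8).resolve_left h0)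

end Amplitude

/-! ### Interpolation at the axes. -/

section Lagrange

variable {m : ℕ} {A : Fin (m + 1) → ℝ}

open Polynomial in
/-- The ellipsoidal coordinates are determined by the squares of the cartesian ones. -/
theorem secular_eq_of_interpolation (hA : Function.Injective A) {x : Euc (m + 1)} {r : Fin m → ℝ}
    (h : ∀ l, x l ^ 2 * ∏ k ∈ Finset.univ.erase l, (A l - A k) = A l * ∏ k, (A l - r k)) (t : ℝ) :
    secular A x t = t * ∏ k, (t - r k) := by
  set P : ℝ[X] := ∏ k, (X - C (A k)) with hP
  set R : ℝ[X] := ∑ l, C (x l ^ 2) * ∏ k ∈ Finset.univ.erase l, (X - C (A k)) with hR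
  set Q : ℝ[X] := X * ∏ k, (X - C (r k)) with hQ
  have hPm : P.Monic := monic_prod_of_monic _ _ fun k _ => monic_X_sub_C _
  have hPd : P.degree = (m + 1 : ℕ) := by
    rw [hP, degree_prod]
    simp
  have hQm : Q.Monic := monic_X.mul (monic_prod_of_monic _ _ fun k _ => monic_X_sub_C _)
  have hQd : Q.degree = (m + 1 : ℕ) := by
    rw [hQ, degree_mul, degree_prod]
    simp [add_comm]
  have hRd : R.degree < (m + 1 : ℕ) := by
    refine lt_of_le_of_lt (degree_sum_le _ _) ?_
    rw [Finset.sup_lt_iff (by exact WithBot.bot_lt_coe _)]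
    intro l _
    have h1 : (∏ k ∈ Finset.univ.erase l, (X - C (A k))).degree = ((m : ℕ) : WithBot ℕ) := by
      rw [degree_prod]
      simp [Finset.card_erase_of_mem]
    refine lt_of_le_of_lt ((degree_mul_le _ _).trans (add_le_add degree_C_le le_rfl)) ?_
    rw [h1, zero_add]
    exact_mod_cast Nat.lt_succ_self m
  have hPR : (P + R - Q).degree < (m + 1 : ℕ) := by
    have h1 : (P - Q).degree < (m + 1 : ℕ) := by
      rw [← hPd]
      exact degree_sub_lt_left (hPd.trans hQd.symm) hPm.ne_zero
        (hPm.leadingCoeff.trans hQm.leadingCoeff.symm)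
    rw [add_sub_right_comm]
    exact lt_of_le_of_lt (degree_add_le _ _) (max_lt h1 hRd)
  have hev : ∀ s, (P + R).eval s = secular A x s := fun s => by
    simp [hP, hR, secular, eval_prod, eval_finsetSum]
  -- The difference has degree at most `m`, because the leading terms cancel, and it vanishes at the
  -- `m + 1` distinct axes.
  have heq : P + R = Q := by
    refine eq_of_degree_sub_lt_of_eval_finset_eq (Finset.univ.map ⟨A, hA⟩) (by simpa using hPR) ?_
    intro s hs
    obtain ⟨l, -, rfl⟩ := Finset.mem_map.mp hs
    change (P + R).eval (A l) = Q.eval (A l)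
    rw [hev, secular_apply_self, h]
    simp [hQ, eval_prod]
  rw [← hev, heq]
  simp [hQ, eval_prod]

end Lagrange

/-! ### Charts by pairs of angles; leaves in the pillow and torus models. -/

section Charts

variable {m : ℕ}

/-- A parametrization of a surface `C` of a hypersurface by pairs of angles, in which the leaves of
the two principal foliations are described by the relations `L₀`, `L₁`, the singular points by
`sing` and the pairs of angles giving the same point by `K`. -/
structure NetChart (F : Euc (m + 1) → ℝ) (i j : Fin m) (S C : Set (Euc (m + 1)))
    (Φ : ℝ × ℝ → Euc (m + 1)) (sing : ℝ × ℝ → Prop) (L₀ L₁ K : ℝ × ℝ → ℝ × ℝ → Prop) : Prop where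
  subset : C ⊆ hypersurface F
  continuous : Continuous Φ
  image : Φ '' (Icc 0 (2 * Real.pi) ×ˢ Icc 0 (2 * Real.pi)) = C
  mem : ∀ x, Φ x ∈ C
  eq_iff : ∀ x y, Φ x = Φ y ↔ K x y
  mem_singular : ∀ x, Φ x ∈ S ↔ sing x
  leaf_fst_subset : ∀ x, leaf F i (Φ x) ⊆ C
  leaf_snd_subset : ∀ x, leaf F j (Φ x) ⊆ C
  mem_leaf_fst : ∀ x y, Φ y ∈ leaf F i (Φ x) ↔ L₀ x y
  mem_leaf_snd : ∀ x y, Φ y ∈ leaf F j (Φ x) ↔ L₁ x y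

theorem exists_mem_Icc_trig (θ : ℝ) : ∃ θ' ∈ Icc 0 (2 * Real.pi),
    Real.cos θ' = Real.cos θ ∧ Real.sin θ' = Real.sin θ := by
  have h := toIcoMod_mem_Ico Real.two_pi_pos 0 θ
  rw [zero_add] at h
  refine ⟨toIcoMod Real.two_pi_pos 0 θ, ⟨h.1, h.2.le⟩, ?_, ?_⟩
  · rw [toIcoMod, zsmul_eq_mul, Real.cos_sub_int_mul_two_pi]
  · rw [toIcoMod, zsmul_eq_mul, Real.sin_sub_int_mul_two_pi]

variable {A : Fin (m + 1) → ℝ} {i j : Fin m} {r : ℝ → ℝ → Fin m → ℝ} {ρ : Fin m → ℝ}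
  {C : Set (Euc (m + 1))} {X Y : Fin (m + 1) → ℝ → ℝ} {v u : ℝ → ℝ}

namespace ConfocalNet

theorem leaf_subset_surface (h : ConfocalNet A i j r ρ C X Y v u) (α β : ℝ) :
    leaf (quadric A) i (separated X Y α β) ⊆ C := by
  intro q hq
  obtain ⟨-, α', β', rfl, -⟩ := h.leaf_subset hq
  exact h.mem _ _

theorem continuous_param (h : ConfocalNet A i j r ρ C X Y v u) :
    Continuous fun x : ℝ × ℝ => separated X Y x.1 x.2 := by
  refine (PiLp.continuous_toLp 2 _).comp (continuous_pi fun l => ?_)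
  exact ((h.smooth_fst l).continuous.comp continuous_fst).mul
    ((h.smooth_snd l).continuous.comp continuous_snd)

/-- At negative `t` the factors of the constant roots are nonzero and cancel. The values at `-1` and
`-2` give the sum and the product of `v` and `u`, and the order `u ≤ v` tells them apart. -/
theorem coords_eq (h : ConfocalNet A i j r ρ C X Y v u) (hvu : ∀ α β, u β ≤ v α)
    {α β α' β' : ℝ} (heq : separated X Y α β = separated X Y α' β') : v α = v α' ∧ u β = u β' := by
  have hρ : ∀ k ∈ (Finset.univ.erase i).erase j, 0 < ρ k := fun k hk => by
    simp only [Finset.mem_erase, Finset.mem_univ, and_true] at hk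
    rw [← h.root_other 0 0 k hk.2 hk.1]
    exact h.root_pos _ _ _
  have key : ∀ t < 0, (t - v α) * (t - u β) = (t - v α') * (t - u β') := fun t ht => by
    have h1 := h.secular_eq α β t
    rw [heq, h.secular_eq, h.prod_eq, h.prod_eq] at h1
    have h2 : ∏ k ∈ (Finset.univ.erase i).erase j, (t - ρ k) ≠ 0 :=
      Finset.prod_ne_zero_iff.mpr fun k hk => by linarith [hρ k hk]
    have h3 := mul_left_cancel₀ ht.ne h1
    rw [← mul_assoc, ← mul_assoc] at h3
    exact (mul_right_cancel₀ h2 h3).symm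
  have k1 := key (-1) (by norm_num)
  have k2 := key (-2) (by norm_num)
  have hs : v α + u β = v α' + u β' := by linarith
  have h3 : (v α - v α') * (v α - u β') = 0 := by linear_combination v α * hs - k1 + hs
  rcases mul_eq_zero.mp h3 with h4 | h4
  · exact ⟨by linarith, by linarith⟩
  · have := hvu α β
    have := hvu α' β'
    exact ⟨by linarith, by linarith⟩

/-- A positive factor `Y l` is determined by its square, hence by `u`, and can be cancelled in the
`l`-th coordinate. -/
theorem fst_eq (h : ConfocalNet A i j r ρ C X Y v u) (hvu : ∀ α β, u β ≤ v α)
    {α β α' β' : ℝ} (heq : separated X Y α β = separated X Y α' β') {l : Fin (m + 1)}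
    (hl : ∀ b, 0 < Y l b) : X l α = X l α' := by
  have h1 := h.sq_snd l _ _ (h.coords_eq hvu heq).2
  have h2 : Y l β = Y l β' :=
    (pow_left_inj₀ (hl β).le (hl β').le two_ne_zero).mp h1
  have h3 := congrArg (fun w : Euc (m + 1) => w l) heq
  simp only [separated_apply, h2] at h3
  exact mul_right_cancel₀ (hl β').ne' h3

theorem snd_eq' (h : ConfocalNet A i j r ρ C X Y v u) (hvu : ∀ α β, u β ≤ v α)
    {α β α' β' : ℝ} (heq : separated X Y α β = separated X Y α' β') {l : Fin (m + 1)}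
    (hl : ∀ a, 0 < X l a) : Y l β = Y l β' := by
  have h1 := h.sq_fst l _ _ (h.coords_eq hvu heq).1
  have h2 : X l α = X l α' :=
    (pow_left_inj₀ (hl α).le (hl α').le two_ne_zero).mp h1
  have h3 := congrArg (fun w : Euc (m + 1) => w l) heq
  simp only [separated_apply, h2] at h3
  exact mul_left_cancel₀ (hl α').ne' h3

section Pillow

variable (hker : ∀ α β α' β', separated X Y α β = separated X Y α' β' ↔
    Real.cos α = Real.cos α' ∧ Real.cos β = Real.cos β' ∧
      Real.sin α * Real.sin β = Real.sin α' * Real.sin β')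
  (hsing : ∀ α β, v α = u β ↔ Real.sin α = 0 ∧ Real.sin β = 0)

-- If `sin β ≠ 0`, the curve with `β` fixed is a regular closed leaf, run through by letting `α`
-- vary over `ℝ`. If `sin β = 0`, it is a segment between two singular points, and its interior is
-- the leaf. The coordinate supplied by `hcos` keeps the sign that `u β` forgets, so that it
-- distinguishes leaves with opposite `cos β`.
include hker hsing in
theorem pillow_mem_leaf_iff (h : ConfocalNet A i j r ρ C X Y v u)
    (hreg : ∀ s β, Real.sin s ≠ 0 ∨ Real.sin β ≠ 0 → ∃ l, deriv (X l) s * Y l β ≠ 0)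
    (hcos : ∃ l, (∀ a, 0 < X l a) ∧ ∀ β β', Y l β = Y l β' → Real.cos β = Real.cos β')
    (α β α' β' : ℝ) :
    separated X Y α' β' ∈ leaf (quadric A) i (separated X Y α β) ↔
      ¬(Real.sin α = 0 ∧ Real.sin β = 0) ∧ ¬(Real.sin α' = 0 ∧ Real.sin β' = 0) ∧
        Real.cos β = Real.cos β' := by
  have hnon : ∀ s β, Real.sin s ≠ 0 ∨ Real.sin β ≠ 0 → v s ≠ u β := fun s β hs he => by
    have := (hsing s β).mp he
    tauto
  constructor
  · intro hq
    obtain ⟨l, hl, hlc⟩ := hcos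
    obtain ⟨h1, α'', β'', h2, h3, h4, h5⟩ := h.leaf_subset hq
    have h6 := (hker _ _ _ _).mp h2
    refine ⟨fun h7 => h1 ((hsing _ _).mpr h7), fun h7 => h3 ((hsing _ _).mpr ?_), ?_⟩
    · have hα := Real.sin_sq_add_cos_sq α'
      have hα'' := Real.sin_sq_add_cos_sq α''
      have hβ := Real.sin_sq_add_cos_sq β'
      have hβ'' := Real.sin_sq_add_cos_sq β''
      rw [← h6.1] at hα''
      rw [← h6.2.1] at hβ''
      rw [h7.1] at hα
      rw [h7.2] at hβ
      exact ⟨pow_eq_zero_iff two_ne_zero |>.mp (by linarith),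
        pow_eq_zero_iff two_ne_zero |>.mp (by linarith)⟩
    · rw [h6.2.1]
      exact (hlc _ _ (h5 l hl)).symm
  · rintro ⟨h1, h2, h3⟩
    have hβ := Real.sin_sq_add_cos_sq β
    have hβ' := Real.sin_sq_add_cos_sq β'
    have hsq : Real.sin β ^ 2 = Real.sin β' ^ 2 := by rw [h3] at hβ; linarith
    by_cases hs : Real.sin β = 0
    · have hs' : Real.sin β' = 0 := by
        rw [hs] at hsq
        exact pow_eq_zero_iff two_ne_zero |>.mp (by linarith)
      have hα : Real.sin α ≠ 0 := fun h0 => h1 ⟨h0, hs⟩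
      have hα' : Real.sin α' ≠ 0 := fun h0 => h2 ⟨h0, hs'⟩
      -- When `sin β = 0` the sign of `sin α` is irrelevant, so both angles can be folded into `(0,
      -- π)`, where no singular point is met.
      have harc : ∀ θ, Real.sin θ ≠ 0 → Real.arccos (Real.cos θ) ∈ Ioo 0 Real.pi ∧
          Real.cos (Real.arccos (Real.cos θ)) = Real.cos θ := fun θ hθ => by
        have h4 := Real.sin_sq_add_cos_sq θ
        have h5 : 0 < Real.sin θ ^ 2 := by positivity
        have h6 : |Real.cos θ| < 1 := by rw [← sq_lt_one_iff_abs_lt_one]; linarith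
        rw [abs_lt] at h6
        refine ⟨⟨Real.arccos_pos.mpr h6.2, ?_⟩, Real.cos_arccos h6.1.le h6.2.le⟩
        refine lt_of_le_of_ne (Real.arccos_le_pi _) fun h7 => ?_
        rw [Real.arccos_eq_pi] at h7
        linarith
      rw [(hker α β (Real.arccos (Real.cos α)) β).mpr ⟨(harc α hα).2.symm, rfl, by simp [hs]⟩,
        (hker α' β' (Real.arccos (Real.cos α')) β).mpr
          ⟨(harc α' hα').2.symm, h3.symm, by simp [hs, hs']⟩]
      refine h.mem_leaf (harc α hα).1 (harc α' hα').1 fun s hs1 => ?_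
      have hs2 : Real.sin s ≠ 0 := (Real.sin_pos_of_pos_of_lt_pi hs1.1 hs1.2).ne'
      exact ⟨hnon _ _ (Or.inl hs2), hreg s β (Or.inl hs2)⟩
    · obtain ⟨α'', hα''⟩ : ∃ α'', separated X Y α' β' = separated X Y α'' β := by
        rcases sq_eq_sq_iff_eq_or_eq_neg.mp hsq with h4 | h4
        · exact ⟨α', (hker _ _ _ _).mpr ⟨rfl, h3.symm, by rw [h4]⟩⟩
        -- The identification of `(α, β)` with `(-α, -β)` corrects the sign of `sin β'`.
        · refine ⟨-α', (hker _ _ _ _).mpr ⟨(Real.cos_neg _).symm, h3.symm, ?_⟩⟩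
          rw [h4, Real.sin_neg]
          ring
      rw [hα'']
      refine h.mem_leaf (a := min α α'' - 1) (b := max α α'' + 1) ?_ ?_ fun s _ =>
        ⟨hnon _ _ (Or.inr hs), hreg s β (Or.inr hs)⟩
      · exact ⟨by linarith [min_le_left α α''], by linarith [le_max_left α α'']⟩
      · exact ⟨by linarith [min_le_right α α''], by linarith [le_max_right α α'']⟩

end Pillow

/-- Without singular points every circle with `β` fixed is a leaf. Two coordinates with positive `X
l`, one for the cosine and one for the sine, recover `β` up to a period. -/
theorem torus_mem_leaf_iff (h : ConfocalNet A i j r ρ C X Y v u)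
    (hker : ∀ α β α' β', separated X Y α β = separated X Y α' β' ↔
      (Real.cos α = Real.cos α' ∧ Real.sin α = Real.sin α') ∧
        Real.cos β = Real.cos β' ∧ Real.sin β = Real.sin β')
    (hsing : ∀ α β, v α ≠ u β)
    (hreg : ∀ s β, ∃ l, deriv (X l) s * Y l β ≠ 0)
    (hcos : ∃ l, (∀ a, 0 < X l a) ∧ ∀ β β', Y l β = Y l β' → Real.cos β = Real.cos β')
    (hsin : ∃ l, (∀ a, 0 < X l a) ∧ ∀ β β', Y l β = Y l β' → Real.sin β = Real.sin β')
    (α β α' β' : ℝ) :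
    separated X Y α' β' ∈ leaf (quadric A) i (separated X Y α β) ↔
      Real.cos β = Real.cos β' ∧ Real.sin β = Real.sin β' := by
  constructor
  · intro hq
    obtain ⟨l, hl, hlc⟩ := hcos
    obtain ⟨l', hl', hlc'⟩ := hsin
    obtain ⟨h1, α'', β'', h2, h3, h4, h5⟩ := h.leaf_subset hq
    have h6 := (hker _ _ _ _).mp h2
    exact ⟨by rw [h6.2.1]; exact (hlc _ _ (h5 l hl)).symm,
      by rw [h6.2.2]; exact (hlc' _ _ (h5 l' hl')).symm⟩
  · rintro ⟨h1, h2⟩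
    rw [(hker α' β' α' β).mpr ⟨⟨rfl, rfl⟩, h1.symm, h2.symm⟩]
    refine h.mem_leaf (a := min α α' - 1) (b := max α α' + 1) ?_ ?_ fun s _ =>
      ⟨hsing _ _, hreg s β⟩
    · exact ⟨by linarith [min_le_left α α'], by linarith [le_max_left α α']⟩
    · exact ⟨by linarith [min_le_right α α'], by linarith [le_max_right α α']⟩

end ConfocalNet

end Charts

/-! ### Range and symmetries of the amplitudes. -/

section AmplitudeFacts

variable {n : ℕ} {A : Fin n → ℝ} {p q : Fin n}

theorem ampVal_congr {θ θ' : ℝ} (hc : Real.cos θ = Real.cos θ') :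
    ampVal A p q θ = ampVal A p q θ' := by
  rw [ampVal_eq_left, ampVal_eq_left, hc]

theorem amp_congr_cos {l : Fin n} (hl : l ≠ q) {θ θ' : ℝ} (hc : Real.cos θ = Real.cos θ') :
    amp A p q l θ = amp A p q l θ' := by
  by_cases hp : l = p
  · subst hp
    rw [amp_left, amp_left, hc]
  · rw [amp_other hp hl, amp_other hp hl, ampVal_congr hc]

theorem amp_congr (hpq : p ≠ q) {l : Fin n} {θ θ' : ℝ} (hc : Real.cos θ = Real.cos θ')
    (hs : Real.sin θ = Real.sin θ') : amp A p q l θ = amp A p q l θ' := by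
  by_cases hq : l = q
  · subst hq
    rw [amp_right hpq, amp_right hpq, hs]
  · exact amp_congr_cos hq hc

theorem ampVal_mem_Icc (hpq : A q ≤ A p) (θ : ℝ) : ampVal A p q θ ∈ Icc (A q) (A p) := by
  constructor
  · rw [ampVal_eq_right]
    nlinarith [sq_nonneg (Real.sin θ)]
  · rw [ampVal_eq_left]
    nlinarith [sq_nonneg (Real.cos θ)]

theorem ampVal_mem_Icc' (hpq : A p ≤ A q) (θ : ℝ) : ampVal A p q θ ∈ Icc (A p) (A q) := by
  constructor
  · rw [ampVal_eq_left]
    nlinarith [sq_nonneg (Real.cos θ)]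
  · rw [ampVal_eq_right]
    nlinarith [sq_nonneg (Real.sin θ)]

/-- The required `sin² θ` is `(w - A q) / (A p - A q)`, and reflections of the angle then give the
cosine and sine the signs of `a` and `b`. The hypotheses are stated as products to cover both orders
of `A p` and `A q`. -/
theorem exists_ampVal_eq {w : ℝ} (hpq : A p ≠ A q) (hw : 0 ≤ (w - A q) * (A p - A q))
    (hw' : 0 ≤ (A p - w) * (A p - A q)) (a b : ℝ) :
    ∃ θ, ampVal A p q θ = w ∧ 0 ≤ a * Real.cos θ ∧ 0 ≤ b * Real.sin θ := by
  have hne : A p - A q ≠ 0 := sub_ne_zero.mpr hpq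
  have hpos : 0 < (A p - A q) ^ 2 := by positivity
  set τ := (w - A q) / (A p - A q) with hτ
  have hτ0 : 0 ≤ τ := by
    have : τ = ((w - A q) * (A p - A q)) / (A p - A q) ^ 2 := by rw [hτ]; field_simp
    rw [this]
    exact div_nonneg hw hpos.le
  have hτ1 : τ ≤ 1 := by
    have : 1 - τ = ((A p - w) * (A p - A q)) / (A p - A q) ^ 2 := by
      rw [hτ]; field_simp; ring
    have h1 : 0 ≤ 1 - τ := by rw [this]; exact div_nonneg hw' hpos.le
    linarith
  set φ := Real.arcsin (Real.sqrt τ) with hφ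
  have hsin : Real.sin φ = Real.sqrt τ := Real.sin_arcsin
    (by linarith [Real.sqrt_nonneg τ]) (Real.sqrt_le_one.mpr hτ1)
  have hsin0 : 0 ≤ Real.sin φ := hsin ▸ Real.sqrt_nonneg τ
  have hcos0 : 0 ≤ Real.cos φ := Real.cos_arcsin_nonneg _
  have hval : ∀ θ, Real.sin θ ^ 2 = Real.sin φ ^ 2 → ampVal A p q θ = w := fun θ hθ => by
    rw [ampVal_eq_right, hθ, hsin, Real.sq_sqrt hτ0, hτ]
    field_simp
    ring
  rcases le_total 0 a with ha | ha <;> rcases le_total 0 b with hb | hb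
  · exact ⟨φ, hval _ rfl, mul_nonneg ha hcos0, mul_nonneg hb hsin0⟩
  · refine ⟨-φ, hval _ (by rw [Real.sin_neg, neg_sq]), ?_, ?_⟩
    · rw [Real.cos_neg]; exact mul_nonneg ha hcos0
    · rw [Real.sin_neg]; nlinarith
  · refine ⟨Real.pi - φ, hval _ (by rw [Real.sin_pi_sub]), ?_, ?_⟩
    · rw [Real.cos_pi_sub]; nlinarith
    · rw [Real.sin_pi_sub]; exact mul_nonneg hb hsin0
  · refine ⟨φ + Real.pi, hval _ (by rw [Real.sin_add_pi, neg_sq]), ?_, ?_⟩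
    · rw [Real.cos_add_pi]; nlinarith
    · rw [Real.sin_add_pi]; nlinarith

end AmplitudeFacts

theorem eq_of_sq_eq_of_mul_nonneg {x y : ℝ} (h : x ^ 2 = y ^ 2) (hxy : 0 ≤ x * y) : x = y := by
  rcases sq_eq_sq_iff_eq_or_eq_neg.mp h with h1 | h1
  · exact h1
  · rw [h1] at hxy
    have : y = 0 := by nlinarith [sq_nonneg y]
    rw [h1, this, neg_zero]

/-! ### Nets and charts obtained from amplitudes. -/

section AmpNet

variable {m : ℕ}

/-- The scale of the `l`-th coordinate in ellipsoidal coordinates. -/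
noncomputable def weight (A : Fin (m + 1) → ℝ) (ρ : Fin m → ℝ) (i j : Fin m) (l : Fin (m + 1)) :
    ℝ :=
  Real.sqrt (|A l * ∏ k ∈ (Finset.univ.erase i).erase j, (A l - ρ k)| /
    |∏ k ∈ Finset.univ.erase l, (A l - A k)|)

/-- The coordinate functions of the second angle. -/
noncomputable def scaledAmp (A : Fin (m + 1) → ℝ) (ρ : Fin m → ℝ) (i j : Fin m)
    (j₁ j₀ : Fin (m + 1)) (ε : Fin (m + 1) → ℝ) (l : Fin (m + 1)) (β : ℝ) : ℝ :=
  ε l * weight A ρ i j l * amp A j₁ j₀ l β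

/-- The conditions under which ellipsoidal coordinates with `r i` moving between `A i₁` and `A i₀`,
`r j` moving between `A j₁` and `A j₀`, and constant `r k = ρ k` otherwise, parametrize a surface.
The signs `ε` select a component. -/
structure AmpData (A : Fin (m + 1) → ℝ) (i j : Fin m) (r : ℝ → ℝ → Fin m → ℝ) (ρ : Fin m → ℝ)
    (i₀ i₁ j₀ j₁ : Fin (m + 1)) (ε : Fin (m + 1) → ℝ) : Prop where
  pos : ∀ k, 0 < A k
  inj : Function.Injective A
  ne : i ≠ j
  anti : ∀ α β, Antitone (r α β)
  root_pos : ∀ α β k, 0 < r α β k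
  root_fst : ∀ α β, r α β i = ampVal A i₀ i₁ α
  root_snd : ∀ α β, r α β j = ampVal A j₁ j₀ β
  root_other : ∀ α β k, k ≠ i → k ≠ j → r α β k = ρ k
  sep_fst : ∀ k, k ≠ i → k ≠ j → ∀ α, ρ k ≠ ampVal A i₀ i₁ α
  sep_snd : ∀ k, k ≠ i → k ≠ j → ∀ β, ρ k ≠ ampVal A j₁ j₀ β
  ne_fst : i₀ ≠ i₁
  ne_snd : j₁ ≠ j₀
  axis_fst : ∀ l, l ≠ i₀ → l ≠ i₁ → ∀ θ, A l ≠ ampVal A i₀ i₁ θ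
  axis_snd : ∀ l, l ≠ j₁ → l ≠ j₀ → ∀ θ, A l ≠ ampVal A j₁ j₀ θ
  axis_other : ∀ l k, k ≠ i → k ≠ j → A l ≠ ρ k
  eps : ∀ l, ε l ^ 2 = 1
  -- This makes the value `A l * ∏ (A l - r k) / ∏ (A l - A k)`, prescribed by interpolation for the
  -- square of the `l`-th coordinate, nonnegative.
  sign : ∀ l α β, 0 ≤ (∏ k ∈ Finset.univ.erase l, (A l - A k)) * ∏ k, (A l - r α β k)

namespace AmpData

variable {A : Fin (m + 1) → ℝ} {i j : Fin m} {r : ℝ → ℝ → Fin m → ℝ} {ρ : Fin m → ℝ}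
  {i₀ i₁ j₀ j₁ : Fin (m + 1)} {ε : Fin (m + 1) → ℝ}

variable (h : AmpData A i j r ρ i₀ i₁ j₀ j₁ ε)
include h

theorem prod_axes_ne_zero (l : Fin (m + 1)) :
    ∏ k ∈ Finset.univ.erase l, (A l - A k) ≠ 0 :=
  Finset.prod_ne_zero_iff.mpr fun _ hk => sub_ne_zero.mpr fun he =>
    (Finset.mem_erase.mp hk).1 (h.inj he).symm

theorem weight_pos (l : Fin (m + 1)) : 0 < weight A ρ i j l := by
  refine Real.sqrt_pos.mpr (div_pos (abs_pos.mpr (mul_ne_zero (h.pos l).ne' ?_))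
    (abs_pos.mpr (h.prod_axes_ne_zero l)))
  refine Finset.prod_ne_zero_iff.mpr fun k hk => sub_ne_zero.mpr ?_
  simp only [Finset.mem_erase, Finset.mem_univ, and_true] at hk
  exact h.axis_other l k hk.2 hk.1

theorem eps_ne_zero (l : Fin (m + 1)) : ε l ≠ 0 := fun h0 => by
  have := h.eps l
  simp [h0] at this

theorem prod_eq (l : Fin (m + 1)) (α β : ℝ) : ∏ k, (A l - r α β k) =
    (A l - ampVal A i₀ i₁ α) * ((A l - ampVal A j₁ j₀ β) *
      ∏ k ∈ (Finset.univ.erase i).erase j, (A l - ρ k)) := by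
  rw [← Finset.mul_prod_erase Finset.univ _ (Finset.mem_univ i), h.root_fst,
    ← Finset.mul_prod_erase (Finset.univ.erase i) _
      (Finset.mem_erase.mpr ⟨h.ne.symm, Finset.mem_univ j⟩), h.root_snd]
  congr 2
  refine Finset.prod_congr rfl fun k hk => ?_
  simp only [Finset.mem_erase, Finset.mem_univ, and_true] at hk
  rw [h.root_other _ _ _ hk.2 hk.1]

/-- The amplitudes and the weight are square roots of absolute values. By `sign` the two products
have compatible signs, so all absolute values can be dropped together. -/
theorem interpolation (α β : ℝ) (l : Fin (m + 1)) :
    separated (amp A i₀ i₁) (scaledAmp A ρ i j j₁ j₀ ε) α β l ^ 2 *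
      ∏ k ∈ Finset.univ.erase l, (A l - A k) = A l * ∏ k, (A l - r α β k) := by
  have h1 := h.sign l α β
  have hD := h.prod_axes_ne_zero l
  rw [separated_apply, scaledAmp, mul_pow, mul_pow, mul_pow, h.eps, amp_sq, amp_sq, weight,
    Real.sq_sqrt (by positivity)]
  rw [h.prod_eq] at h1 ⊢
  set D := ∏ k ∈ Finset.univ.erase l, (A l - A k)
  set R := ∏ k ∈ (Finset.univ.erase i).erase j, (A l - ρ k)
  set P := A l - ampVal A i₀ i₁ α
  set Q := A l - ampVal A j₁ j₀ β
  have hkey : |P * (Q * R)| * D = |D| * (P * (Q * R)) := by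
    rcases lt_or_gt_of_ne hD with hneg | hpos
    · have : P * (Q * R) ≤ 0 := by nlinarith
      rw [abs_of_nonpos this, abs_of_neg hneg]
      ring
    · have : 0 ≤ P * (Q * R) := by nlinarith
      rw [abs_of_nonneg this, abs_of_pos hpos]
      ring
  rw [abs_mul, abs_mul] at hkey
  rw [abs_mul, abs_of_pos (h.pos l)]
  have hD' : |D| ≠ 0 := abs_ne_zero.mpr hD
  field_simp
  linear_combination A l * hkey

theorem secular_eq (α β t : ℝ) :
    secular A (separated (amp A i₀ i₁) (scaledAmp A ρ i j j₁ j₀ ε) α β) t =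
      t * ∏ k, (t - r α β k) :=
  secular_eq_of_interpolation h.inj (h.interpolation α β) t

theorem param_congr {α β α' β' : ℝ} (hα : Real.cos α = Real.cos α' ∧ Real.sin α = Real.sin α')
    (hβ : Real.cos β = Real.cos β' ∧ Real.sin β = Real.sin β') :
    separated (amp A i₀ i₁) (scaledAmp A ρ i j j₁ j₀ ε) α β =
      separated (amp A i₀ i₁) (scaledAmp A ρ i j j₁ j₀ ε) α' β' := by
  ext l
  rw [separated_apply, separated_apply, scaledAmp, scaledAmp, amp_congr h.ne_fst hα.1 hα.2,
    amp_congr h.ne_snd hβ.1 hβ.2]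

theorem image_eq_range :
    (fun x : ℝ × ℝ => separated (amp A i₀ i₁) (scaledAmp A ρ i j j₁ j₀ ε) x.1 x.2) ''
      (Icc 0 (2 * Real.pi) ×ˢ Icc 0 (2 * Real.pi)) =
    range fun x : ℝ × ℝ => separated (amp A i₀ i₁) (scaledAmp A ρ i j j₁ j₀ ε) x.1 x.2 := by
  refine (image_subset_range _ _).antisymm ?_
  rintro _ ⟨⟨α, β⟩, rfl⟩
  obtain ⟨α', hα', hα⟩ := exists_mem_Icc_trig α
  obtain ⟨β', hβ', hβ⟩ := exists_mem_Icc_trig β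
  exact ⟨(α', β'), ⟨hα', hβ'⟩, h.param_congr hα hβ⟩

theorem contDiff_scaledAmp (l : Fin (m + 1)) :
    ContDiff ℝ 1 (scaledAmp A ρ i j j₁ j₀ ε l) :=
  contDiff_const.mul (contDiff_amp h.axis_snd l)

theorem confocalNet {C : Set (Euc (m + 1))}
    (hC : C = range fun x : ℝ × ℝ =>
      separated (amp A i₀ i₁) (scaledAmp A ρ i j j₁ j₀ ε) x.1 x.2)
    (hcon : ∀ s : Set (Euc (m + 1)), IsPreconnected s →
      (∀ x ∈ s, secular A x 0 = 0 ∧ ∀ k, k ≠ i → k ≠ j → secular A x (ρ k) = 0) →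
      (s ∩ C).Nonempty → s ⊆ C) :
    ConfocalNet A i j r ρ C (amp A i₀ i₁) (scaledAmp A ρ i j j₁ j₀ ε)
      (ampVal A i₀ i₁) (ampVal A j₁ j₀) where
  pos := h.pos
  ne := h.ne
  anti := h.anti
  root_pos := h.root_pos
  root_fst := h.root_fst
  root_snd := h.root_snd
  root_other := h.root_other
  sep_fst := h.sep_fst
  sep_snd := h.sep_snd
  secular_eq := h.secular_eq
  range_eq := hC
  isClosed := by
    rw [hC, ← h.image_eq_range]
    refine ((isCompact_Icc.prod isCompact_Icc).image ?_).isClosed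
    refine (PiLp.continuous_toLp 2 _).comp (continuous_pi fun l => ?_)
    exact ((contDiff_amp h.axis_fst l).continuous.comp continuous_fst).mul
      ((h.contDiff_scaledAmp l).continuous.comp continuous_snd)
  subset_of_connected := hcon
  smooth_fst := contDiff_amp h.axis_fst
  smooth_snd := h.contDiff_scaledAmp
  ode_fst l α := amp_ode h.axis_fst h.ne_fst l α
  ode_snd l β := by
    have h1 : deriv (scaledAmp A ρ i j j₁ j₀ ε l) β =
        ε l * weight A ρ i j l * deriv (amp A j₁ j₀ l) β :=
      (((contDiff_amp h.axis_snd l).differentiable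
        one_ne_zero).differentiableAt.hasDerivAt.const_mul _).deriv
    rw [h1, scaledAmp]
    linear_combination ε l * weight A ρ i j l * amp_ode h.axis_snd h.ne_snd l β
  sq_fst l α α' he := by rw [amp_sq, amp_sq, he]
  sq_snd l β β' he := by simp only [scaledAmp, mul_pow, amp_sq, he]

theorem sq_eq_of_secular {x : Euc (m + 1)} {α β : ℝ}
    (hx : ∀ t, secular A x t = t * ∏ k, (t - r α β k)) (l : Fin (m + 1)) :
    x l ^ 2 = separated (amp A i₀ i₁) (scaledAmp A ρ i j j₁ j₀ ε) α β l ^ 2 := by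
  have h1 := hx (A l)
  rw [← h.interpolation, secular_apply_self] at h1
  exact mul_right_cancel₀ (h.prod_axes_ne_zero l) h1

theorem scaledAmp_pos {l : Fin (m + 1)} (hε : ε l = 1) (h1 : l ≠ j₁) (h0 : l ≠ j₀) (β : ℝ) :
    0 < scaledAmp A ρ i j j₁ j₀ ε l β := by
  rw [scaledAmp, hε, one_mul]
  exact mul_pos (h.weight_pos l) (amp_pos h1 h0 (h.axis_snd l h1 h0 β))

omit h in
theorem deriv_amp_left (s : ℝ) :
    deriv (amp A i₀ i₁ i₀) s = -(Real.sqrt |A i₀ - A i₁| * Real.sin s) := by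
  simp only [funext (amp_left (A := A) (p := i₀) (q := i₁))]
  rw [((Real.hasDerivAt_cos s).const_mul _).deriv]
  ring

theorem deriv_amp_right (s : ℝ) :
    deriv (amp A i₀ i₁ i₁) s = Real.sqrt |A i₀ - A i₁| * Real.cos s := by
  simp only [funext (amp_right (A := A) h.ne_fst)]
  rw [((Real.hasDerivAt_sin s).const_mul _).deriv]

omit h in
theorem deriv_scaledAmp_left (s : ℝ) : deriv (scaledAmp A ρ i j j₁ j₀ ε j₁) s =
    -(ε j₁ * weight A ρ i j j₁ * Real.sqrt |A j₁ - A j₀| * Real.sin s) := by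
  have h1 : scaledAmp A ρ i j j₁ j₀ ε j₁ = fun s =>
      ε j₁ * weight A ρ i j j₁ * (Real.sqrt |A j₁ - A j₀| * Real.cos s) :=
    funext fun s => by rw [scaledAmp, amp_left]
  rw [h1, (((Real.hasDerivAt_cos s).const_mul _).const_mul _).deriv]
  ring

theorem deriv_scaledAmp_right (s : ℝ) : deriv (scaledAmp A ρ i j j₁ j₀ ε j₀) s =
    ε j₀ * weight A ρ i j j₀ * Real.sqrt |A j₁ - A j₀| * Real.cos s := by
  have h1 : scaledAmp A ρ i j j₁ j₀ ε j₀ = fun s =>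
      ε j₀ * weight A ρ i j j₀ * (Real.sqrt |A j₁ - A j₀| * Real.sin s) :=
    funext fun s => by rw [scaledAmp, amp_right h.ne_snd]
  rw [h1, (((Real.hasDerivAt_sin s).const_mul _).const_mul _).deriv]
  ring

theorem sqrt_fst_pos : 0 < Real.sqrt |A i₀ - A i₁| :=
  Real.sqrt_pos.mpr (abs_pos.mpr (sub_ne_zero.mpr fun he => h.ne_fst (h.inj he)))

theorem sqrt_snd_pos : 0 < Real.sqrt |A j₁ - A j₀| :=
  Real.sqrt_pos.mpr (abs_pos.mpr (sub_ne_zero.mpr fun he => h.ne_snd (h.inj he)))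

theorem coeff_ne_zero (l : Fin (m + 1)) :
    ε l * weight A ρ i j l * Real.sqrt |A j₁ - A j₀| ≠ 0 :=
  mul_ne_zero (mul_ne_zero (h.eps_ne_zero l) (h.weight_pos l).ne') h.sqrt_snd_pos.ne'

end AmpData

/-- The pairs of angles at which both sines vanish: the four umbilics of an ellipsoid. -/
def pillowSing (x : ℝ × ℝ) : Prop := Real.sin x.1 = 0 ∧ Real.sin x.2 = 0

/-- Two pairs of angles represent the same point of the pillow. -/
def pillowKer (x y : ℝ × ℝ) : Prop := Real.cos x.1 = Real.cos y.1 ∧ Real.cos x.2 = Real.cos y.2 ∧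
  Real.sin x.1 * Real.sin x.2 = Real.sin y.1 * Real.sin y.2

/-- Two points of the pillow lie on the same leaf of the first foliation. -/
def pillowLeafFst (x y : ℝ × ℝ) : Prop :=
  ¬pillowSing x ∧ ¬pillowSing y ∧ Real.cos x.2 = Real.cos y.2

/-- Two points of the pillow lie on the same leaf of the second foliation. -/
def pillowLeafSnd (x y : ℝ × ℝ) : Prop :=
  ¬pillowSing x ∧ ¬pillowSing y ∧ Real.cos x.1 = Real.cos y.1

/-- Two angles differ by a period. -/
def angleEq (α α' : ℝ) : Prop := Real.cos α = Real.cos α' ∧ Real.sin α = Real.sin α'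

/-- The two moving roots share the axis `c`. The `c`-th coordinate is a multiple of `sin α sin β`,
all others depend on the cosines only. The coordinates `p` and `q`, in which one factor is positive,
recover `cos α` and `cos β`, so `pillowKer` is the exact identification. -/
theorem AmpData.pillow_netChart {A : Fin (m + 1) → ℝ} {i j : Fin m} {r : ℝ → ℝ → Fin m → ℝ}
    {ρ : Fin m → ℝ} {p c q : Fin (m + 1)} {ε : Fin (m + 1) → ℝ}
    (h : AmpData A i j r ρ p c c q ε) (hqc : A q < A c) (hcp : A c < A p) (hp : ε p = 1)
    {C S : Set (Euc (m + 1))}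
    (hnet : ConfocalNet A i j r ρ C (amp A p c) (scaledAmp A ρ i j q c ε)
      (ampVal A p c) (ampVal A q c))
    (hS : ∀ α β, separated (amp A p c) (scaledAmp A ρ i j q c ε) α β ∈ S ↔
      ampVal A p c α = ampVal A q c β) :
    NetChart (quadric A) i j S C
      (fun x => separated (amp A p c) (scaledAmp A ρ i j q c ε) x.1 x.2)
      pillowSing pillowLeafFst pillowLeafSnd pillowKer := by
  have hpc : p ≠ c := h.ne_fst
  have hqc' : q ≠ c := h.ne_snd
  have hpq : p ≠ q := fun he => by rw [he] at hcp; exact lt_asymm hcp hqc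
  have hvu : ∀ α β, ampVal A q c β ≤ ampVal A p c α := fun α β =>
    (ampVal_mem_Icc' hqc.le β).2.trans (ampVal_mem_Icc hcp.le α).1
  have hsing : ∀ α β, ampVal A p c α = ampVal A q c β ↔ Real.sin α = 0 ∧ Real.sin β = 0 :=
    fun α β => by
      rw [ampVal_eq_right, ampVal_eq_right]
      constructor
      · intro he
        have h1 := mul_nonneg (sub_pos.mpr hcp).le (sq_nonneg (Real.sin α))
        have h2 := mul_nonneg (sub_pos.mpr hqc).le (sq_nonneg (Real.sin β))
        have h3 : (A p - A c) * Real.sin α ^ 2 = 0 := by linarith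
        have h4 : (A c - A q) * Real.sin β ^ 2 = 0 := by linarith
        exact ⟨pow_eq_zero_iff two_ne_zero |>.mp
            ((mul_eq_zero.mp h3).resolve_left (sub_pos.mpr hcp).ne'),
          pow_eq_zero_iff two_ne_zero |>.mp
            ((mul_eq_zero.mp h4).resolve_left (sub_pos.mpr hqc).ne')⟩
      · rintro ⟨h1, h2⟩
        rw [h1, h2]
        ring
  have hXq : ∀ a, 0 < amp A p c q a := fun a => amp_pos hpq.symm hqc' (h.axis_fst q hpq.symm hqc' a)
  have hYp : ∀ b, 0 < scaledAmp A ρ i j q c ε p b := h.scaledAmp_pos hp hpq hpc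
  have hcosX : ∀ α α', amp A p c p α = amp A p c p α' → Real.cos α = Real.cos α' :=
    fun α α' he => by
      rw [amp_left, amp_left] at he
      exact mul_left_cancel₀ h.sqrt_fst_pos.ne' he
  have hcosY : ∀ β β', scaledAmp A ρ i j q c ε q β = scaledAmp A ρ i j q c ε q β' →
      Real.cos β = Real.cos β' := fun β β' he => by
    rw [scaledAmp, scaledAmp, amp_left, amp_left, ← mul_assoc, ← mul_assoc] at he
    exact mul_left_cancel₀ (h.coeff_ne_zero q) he
  have hmid : ∀ α β, separated (amp A p c) (scaledAmp A ρ i j q c ε) α β c =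
      Real.sqrt |A p - A c| * (ε c * weight A ρ i j c * Real.sqrt |A q - A c|) *
        (Real.sin α * Real.sin β) := fun α β => by
    rw [separated_apply, scaledAmp, amp_right hpc, amp_right hqc']
    ring
  have hker : ∀ α β α' β', separated (amp A p c) (scaledAmp A ρ i j q c ε) α β =
      separated (amp A p c) (scaledAmp A ρ i j q c ε) α' β' ↔
      Real.cos α = Real.cos α' ∧ Real.cos β = Real.cos β' ∧
        Real.sin α * Real.sin β = Real.sin α' * Real.sin β' := fun α β α' β' => by
    constructor
    · intro he
      refine ⟨hcosX _ _ (hnet.fst_eq hvu he hYp), hcosY _ _ (hnet.snd_eq' hvu he hXq), ?_⟩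
      have h1 := congrArg (fun w : Euc (m + 1) => w c) he
      simp only [hmid] at h1
      exact mul_left_cancel₀ (mul_ne_zero h.sqrt_fst_pos.ne' (h.coeff_ne_zero c)) h1
    · rintro ⟨h1, h2, h3⟩
      ext l
      by_cases hl : l = c
      · rw [hl, hmid, hmid, h3]
      · rw [separated_apply, separated_apply, scaledAmp, scaledAmp, amp_congr_cos hl h1,
          amp_congr_cos hl h2]
  -- Where `sin s = 0`, all amplitudes but the `c`-th are critical; the `c`-th coordinate still
  -- moves provided `sin β ≠ 0`.
  have hreg : ∀ s β, Real.sin s ≠ 0 ∨ Real.sin β ≠ 0 →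
      ∃ l, deriv (amp A p c l) s * scaledAmp A ρ i j q c ε l β ≠ 0 := fun s β hs => by
    by_cases hs0 : Real.sin s = 0
    · have hc0 : Real.cos s ≠ 0 := fun hc => by
        have := Real.sin_sq_add_cos_sq s
        simp [hs0, hc] at this
      refine ⟨c, ?_⟩
      rw [h.deriv_amp_right, scaledAmp, amp_right hqc', ← mul_assoc (ε c * _)]
      exact mul_ne_zero (mul_ne_zero h.sqrt_fst_pos.ne' hc0) (mul_ne_zero (h.coeff_ne_zero c)
        (hs.resolve_left fun hs1 => hs1 hs0))
    · refine ⟨p, ?_⟩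
      rw [AmpData.deriv_amp_left]
      exact mul_ne_zero (neg_ne_zero.mpr (mul_ne_zero h.sqrt_fst_pos.ne' hs0)) (hYp β).ne'
  have hreg' : ∀ s α, Real.sin s ≠ 0 ∨ Real.sin α ≠ 0 →
      ∃ l, deriv (scaledAmp A ρ i j q c ε l) s * amp A p c l α ≠ 0 := fun s α hs => by
    by_cases hs0 : Real.sin s = 0
    · have hc0 : Real.cos s ≠ 0 := fun hc => by
        have := Real.sin_sq_add_cos_sq s
        simp [hs0, hc] at this
      refine ⟨c, ?_⟩
      rw [h.deriv_scaledAmp_right, amp_right hpc]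
      exact mul_ne_zero (mul_ne_zero (h.coeff_ne_zero c) hc0) (mul_ne_zero h.sqrt_fst_pos.ne'
        (hs.resolve_left fun hs1 => hs1 hs0))
    · refine ⟨q, ?_⟩
      rw [AmpData.deriv_scaledAmp_left]
      exact mul_ne_zero (neg_ne_zero.mpr (mul_ne_zero (h.coeff_ne_zero q) hs0)) (hXq α).ne'
  refine
    { subset := hnet.subset_hypersurface
      continuous := hnet.continuous_param
      image := h.image_eq_range.trans hnet.range_eq.symm
      mem := fun x => hnet.mem _ _
      eq_iff := fun x y => hker _ _ _ _
      mem_singular := fun x => (hS _ _).trans (hsing _ _)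
      leaf_fst_subset := fun x => hnet.leaf_subset_surface _ _
      leaf_snd_subset := fun x => ?_
      mem_leaf_fst := fun x y =>
        hnet.pillow_mem_leaf_iff hker hsing hreg ⟨q, hXq, hcosY⟩ x.1 x.2 y.1 y.2
      mem_leaf_snd := fun x y => ?_ }
  · have := hnet.swap.leaf_subset_surface x.2 x.1
    rwa [separated_swap] at this
  · have := hnet.swap.pillow_mem_leaf_iff (fun α β α' β' => by
        rw [separated_swap (amp A p c), separated_swap (amp A p c), hker, mul_comm, mul_comm (Real.sin β')]
        tauto)
      (fun β α => by rw [eq_comm, hsing, and_comm]) hreg' ⟨p, hYp, hcosX⟩ x.2 x.1 y.2 y.1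
    rw [separated_swap (amp A p c), separated_swap (amp A p c)] at this
    rw [this, pillowLeafSnd, pillowSing, pillowSing, and_comm (a := Real.sin x.2 = 0),
      and_comm (a := Real.sin y.2 = 0)]

/-- The moving roots lie in disjoint intervals bounded by four different axes. In each of these four
coordinates one factor is positive, so the cosines and sines of both angles can be read off from the
point. -/
theorem AmpData.torus_netChart {A : Fin (m + 1) → ℝ} {i j : Fin m} {r : ℝ → ℝ → Fin m → ℝ}
    {ρ : Fin m → ℝ} {i₀ i₁ j₀ j₁ : Fin (m + 1)} {ε : Fin (m + 1) → ℝ}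
    (h : AmpData A i j r ρ i₀ i₁ j₀ j₁ ε) (h01 : A j₁ < A j₀) (h12 : A j₀ < A i₁)
    (h23 : A i₁ < A i₀) (hε : ∀ l, ε l = 1) {C S : Set (Euc (m + 1))}
    (hnet : ConfocalNet A i j r ρ C (amp A i₀ i₁) (scaledAmp A ρ i j j₁ j₀ ε)
      (ampVal A i₀ i₁) (ampVal A j₁ j₀))
    (hS : ∀ α β, separated (amp A i₀ i₁) (scaledAmp A ρ i j j₁ j₀ ε) α β ∉ S) :
    NetChart (quadric A) i j S C
      (fun x => separated (amp A i₀ i₁) (scaledAmp A ρ i j j₁ j₀ ε) x.1 x.2)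
      (fun _ => False) (fun x y => angleEq x.2 y.2) (fun x y => angleEq x.1 y.1)
      (fun x y => angleEq x.1 y.1 ∧ angleEq x.2 y.2) := by
  have n1 : i₀ ≠ j₀ := fun he => by rw [he] at h23; linarith
  have n2 : i₀ ≠ j₁ := fun he => by rw [he] at h23; linarith
  have n3 : i₁ ≠ j₀ := fun he => by rw [he] at h12; linarith
  have n4 : i₁ ≠ j₁ := fun he => by rw [he] at h12; linarith
  have hlt : ∀ α β, ampVal A j₁ j₀ β < ampVal A i₀ i₁ α := fun α β =>
    (ampVal_mem_Icc' h01.le β).2.trans_lt (h12.trans_le (ampVal_mem_Icc h23.le α).1)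
  have hvu := fun α β => (hlt α β).le
  have hX : ∀ l, l ≠ i₀ → l ≠ i₁ → ∀ a, 0 < amp A i₀ i₁ l a := fun l l0 l1 a =>
    amp_pos l0 l1 (h.axis_fst l l0 l1 a)
  have hY : ∀ l, l ≠ j₁ → l ≠ j₀ → ∀ b, 0 < scaledAmp A ρ i j j₁ j₀ ε l b := fun l l1 l0 =>
    h.scaledAmp_pos (hε l) l1 l0
  have hcosX : ∀ α α', amp A i₀ i₁ i₀ α = amp A i₀ i₁ i₀ α' → Real.cos α = Real.cos α' :=
    fun α α' he => by
      rw [amp_left, amp_left] at he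
      exact mul_left_cancel₀ h.sqrt_fst_pos.ne' he
  have hsinX : ∀ α α', amp A i₀ i₁ i₁ α = amp A i₀ i₁ i₁ α' → Real.sin α = Real.sin α' :=
    fun α α' he => by
      rw [amp_right h.ne_fst, amp_right h.ne_fst] at he
      exact mul_left_cancel₀ h.sqrt_fst_pos.ne' he
  have hcosY : ∀ β β', scaledAmp A ρ i j j₁ j₀ ε j₁ β = scaledAmp A ρ i j j₁ j₀ ε j₁ β' →
      Real.cos β = Real.cos β' := fun β β' he => by
    rw [scaledAmp, scaledAmp, amp_left, amp_left, ← mul_assoc, ← mul_assoc] at he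
    exact mul_left_cancel₀ (h.coeff_ne_zero j₁) he
  have hsinY : ∀ β β', scaledAmp A ρ i j j₁ j₀ ε j₀ β = scaledAmp A ρ i j j₁ j₀ ε j₀ β' →
      Real.sin β = Real.sin β' := fun β β' he => by
    rw [scaledAmp, scaledAmp, amp_right h.ne_snd, amp_right h.ne_snd, ← mul_assoc,
      ← mul_assoc] at he
    exact mul_left_cancel₀ (h.coeff_ne_zero j₀) he
  have hker : ∀ α β α' β', separated (amp A i₀ i₁) (scaledAmp A ρ i j j₁ j₀ ε) α β =
      separated (amp A i₀ i₁) (scaledAmp A ρ i j j₁ j₀ ε) α' β' ↔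
      (Real.cos α = Real.cos α' ∧ Real.sin α = Real.sin α') ∧
        Real.cos β = Real.cos β' ∧ Real.sin β = Real.sin β' := fun α β α' β' => by
    constructor
    · intro he
      exact ⟨⟨hcosX _ _ (hnet.fst_eq hvu he (hY _ n2 n1)),
        hsinX _ _ (hnet.fst_eq hvu he (hY _ n4 n3))⟩,
        hcosY _ _ (hnet.snd_eq' hvu he (hX _ n2.symm n4.symm)),
        hsinY _ _ (hnet.snd_eq' hvu he (hX _ n1.symm n3.symm))⟩
    · rintro ⟨h1, h2⟩
      exact h.param_congr h1 h2
  have htrig : ∀ s : ℝ, Real.sin s = 0 → Real.cos s ≠ 0 := fun s hs hc => by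
    have := Real.sin_sq_add_cos_sq s
    simp [hs, hc] at this
  have hreg : ∀ s β, ∃ l, deriv (amp A i₀ i₁ l) s * scaledAmp A ρ i j j₁ j₀ ε l β ≠ 0 :=
    fun s β => by
      by_cases hs0 : Real.sin s = 0
      · refine ⟨i₁, ?_⟩
        rw [h.deriv_amp_right]
        exact mul_ne_zero (mul_ne_zero h.sqrt_fst_pos.ne' (htrig s hs0)) (hY _ n4 n3 β).ne'
      · refine ⟨i₀, ?_⟩
        rw [AmpData.deriv_amp_left]
        exact mul_ne_zero (neg_ne_zero.mpr (mul_ne_zero h.sqrt_fst_pos.ne' hs0))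
          (hY _ n2 n1 β).ne'
  have hreg' : ∀ s α, ∃ l, deriv (scaledAmp A ρ i j j₁ j₀ ε l) s * amp A i₀ i₁ l α ≠ 0 :=
    fun s α => by
      by_cases hs0 : Real.sin s = 0
      · refine ⟨j₀, ?_⟩
        rw [h.deriv_scaledAmp_right]
        exact mul_ne_zero (mul_ne_zero (h.coeff_ne_zero _) (htrig s hs0))
          (hX _ n1.symm n3.symm α).ne'
      · refine ⟨j₁, ?_⟩
        rw [AmpData.deriv_scaledAmp_left]
        exact mul_ne_zero (neg_ne_zero.mpr (mul_ne_zero (h.coeff_ne_zero _) hs0))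
          (hX _ n2.symm n4.symm α).ne'
  refine
    { subset := hnet.subset_hypersurface
      continuous := hnet.continuous_param
      image := h.image_eq_range.trans hnet.range_eq.symm
      mem := fun x => hnet.mem _ _
      eq_iff := fun x y => hker _ _ _ _
      mem_singular := fun x => iff_of_false (hS _ _) id
      leaf_fst_subset := fun x => hnet.leaf_subset_surface _ _
      leaf_snd_subset := fun x => ?_
      mem_leaf_fst := fun x y =>
        hnet.torus_mem_leaf_iff hker (fun α β => (hlt α β).ne') hreg
          ⟨_, hX _ n2.symm n4.symm, hcosY⟩ ⟨_, hX _ n1.symm n3.symm, hsinY⟩ x.1 x.2 y.1 y.2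
      mem_leaf_snd := fun x y => ?_ }
  · have := hnet.swap.leaf_subset_surface x.2 x.1
    rwa [separated_swap] at this
  · have := hnet.swap.torus_mem_leaf_iff (fun α β α' β' => by
        rw [separated_swap (amp A i₀ i₁), separated_swap (amp A i₀ i₁), hker, and_comm])
      (fun β α => (hlt α β).ne) hreg' ⟨_, hY _ n2 n1, hcosX⟩ ⟨_, hY _ n4 n3, hsinX⟩
      x.2 x.1 y.2 y.1
    rwa [separated_swap (amp A i₀ i₁), separated_swap (amp A i₀ i₁)] at this

end AmpNet

/-! ### Every point with the right roots is parametrized. -/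

section Surjectivity

variable {m : ℕ} {A : Fin (m + 1) → ℝ} {i j : Fin m} {r : ℝ → ℝ → Fin m → ℝ}
  {ρ : Fin m → ℝ} {ε : Fin (m + 1) → ℝ}

/-- The roots determine the squares of the coordinates; the angles are chosen to match the signs as
well. The coordinates other than `p`, `c`, `q` keep a fixed sign, hence `hpass`. -/
theorem AmpData.pillow_mem_range {p c q : Fin (m + 1)} (h : AmpData A i j r ρ p c c q ε)
    (hqc : A q < A c) (hcp : A c < A p) {x : Euc (m + 1)} {v₀ u₀ : ℝ} (hv : v₀ ∈ Icc (A c) (A p))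
    (hu : u₀ ∈ Icc (A q) (A c))
    (hx : ∀ α β, ampVal A p c α = v₀ → ampVal A q c β = u₀ →
      ∀ t, secular A x t = t * ∏ k, (t - r α β k))
    (hpass : ∀ l, l ≠ p → l ≠ c → l ≠ q → 0 ≤ ε l * x l) :
    x ∈ range fun x : ℝ × ℝ => separated (amp A p c) (scaledAmp A ρ i j q c ε) x.1 x.2 := by
  have hpc : p ≠ c := h.ne_fst
  have hqc' : q ≠ c := h.ne_snd
  have hpq : p ≠ q := fun he => by rw [he] at hcp; exact lt_asymm hcp hqc
  obtain ⟨α, hα, hα1, hα2⟩ := exists_ampVal_eq (A := A) (p := p) (q := c) hcp.ne'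
    (mul_nonneg (sub_nonneg.mpr hv.1) (sub_nonneg.mpr hcp.le))
    (mul_nonneg (sub_nonneg.mpr hv.2) (sub_nonneg.mpr hcp.le)) (x p * ε p) (x c * ε c)
  -- Only the product of the sines enters the `c`-th coordinate. Its sign is carried by `α`, and
  -- `sin β` is taken nonnegative, whence the final argument `1`.
  obtain ⟨β, hβ, hβ1, hβ2⟩ := exists_ampVal_eq (A := A) (p := q) (q := c) (w := u₀) hqc.ne
    (mul_nonneg_of_nonpos_of_nonpos (sub_nonpos.mpr hu.2) (sub_nonpos.mpr hqc.le))
    (mul_nonneg_of_nonpos_of_nonpos (sub_nonpos.mpr hu.1) (sub_nonpos.mpr hqc.le)) (x q * ε q) 1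
  refine ⟨(α, β), ?_⟩
  ext l
  refine (eq_of_sq_eq_of_mul_nonneg (h.sq_eq_of_secular (hx α β hα hβ) l) ?_).symm
  have hw := (h.weight_pos l).le
  have k1 := h.sqrt_fst_pos.le
  have k2 := h.sqrt_snd_pos.le
  rw [separated_apply, scaledAmp]
  by_cases hlc : l = c
  · subst hlc
    rw [amp_right hpc, amp_right hqc']
    rw [one_mul] at hβ2
    refine le_of_le_of_eq (mul_nonneg (mul_nonneg k1 (mul_nonneg hw k2)) (mul_nonneg hα2 hβ2)) ?_
    ring
  by_cases hlp : l = p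
  · subst hlp
    rw [amp_left]
    have k3 := (amp_pos hpq hpc (h.axis_snd l hpq hpc β)).le
    refine le_of_le_of_eq (mul_nonneg (mul_nonneg k1 (mul_nonneg hw k3)) hα1) ?_
    ring
  have k4 := (amp_pos hlp hlc (h.axis_fst l hlp hlc α)).le
  by_cases hlq : l = q
  · subst hlq
    rw [amp_left]
    refine le_of_le_of_eq (mul_nonneg (mul_nonneg k4 (mul_nonneg hw k2)) hβ1) ?_
    ring
  · have k5 := (amp_pos hlq hlc (h.axis_snd l hlq hlc β)).le
    refine le_of_le_of_eq (mul_nonneg (mul_nonneg k4 (mul_nonneg hw k5)) (hpass l hlp hlc hlq)) ?_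
    ring

theorem AmpData.torus_mem_range {i₀ i₁ j₀ j₁ : Fin (m + 1)}
    (h : AmpData A i j r ρ i₀ i₁ j₀ j₁ ε) (h01 : A j₁ < A j₀) (h12 : A j₀ < A i₁)
    (h23 : A i₁ < A i₀) {x : Euc (m + 1)} {v₀ u₀ : ℝ} (hv : v₀ ∈ Icc (A i₁) (A i₀))
    (hu : u₀ ∈ Icc (A j₁) (A j₀))
    (hx : ∀ α β, ampVal A i₀ i₁ α = v₀ → ampVal A j₁ j₀ β = u₀ →
      ∀ t, secular A x t = t * ∏ k, (t - r α β k))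
    (hpass : ∀ l, l = i₀ ∨ l = i₁ ∨ l = j₀ ∨ l = j₁) :
    x ∈ range fun x : ℝ × ℝ =>
      separated (amp A i₀ i₁) (scaledAmp A ρ i j j₁ j₀ ε) x.1 x.2 := by
  have n1 : i₀ ≠ j₀ := fun he => by rw [he] at h23; linarith
  have n2 : i₀ ≠ j₁ := fun he => by rw [he] at h23; linarith
  have n3 : i₁ ≠ j₀ := fun he => by rw [he] at h12; linarith
  have n4 : i₁ ≠ j₁ := fun he => by rw [he] at h12; linarith
  obtain ⟨α, hα, hα1, hα2⟩ := exists_ampVal_eq (A := A) (p := i₀) (q := i₁) h23.ne'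
    (mul_nonneg (sub_nonneg.mpr hv.1) (sub_nonneg.mpr h23.le))
    (mul_nonneg (sub_nonneg.mpr hv.2) (sub_nonneg.mpr h23.le)) (x i₀ * ε i₀) (x i₁ * ε i₁)
  obtain ⟨β, hβ, hβ1, hβ2⟩ := exists_ampVal_eq (A := A) (p := j₁) (q := j₀) (w := u₀) h01.ne
    (mul_nonneg_of_nonpos_of_nonpos (sub_nonpos.mpr hu.2) (sub_nonpos.mpr h01.le))
    (mul_nonneg_of_nonpos_of_nonpos (sub_nonpos.mpr hu.1) (sub_nonpos.mpr h01.le))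
    (x j₁ * ε j₁) (x j₀ * ε j₀)
  refine ⟨(α, β), ?_⟩
  ext l
  refine (eq_of_sq_eq_of_mul_nonneg (h.sq_eq_of_secular (hx α β hα hβ) l) ?_).symm
  have hw := (h.weight_pos l).le
  have k1 := h.sqrt_fst_pos.le
  have k2 := h.sqrt_snd_pos.le
  rw [separated_apply, scaledAmp]
  rcases hpass l with rfl | rfl | rfl | rfl
  · rw [amp_left]
    have k3 := (amp_pos n2 n1 (h.axis_snd l n2 n1 β)).le
    exact le_of_le_of_eq (mul_nonneg (mul_nonneg k1 (mul_nonneg hw k3)) hα1) (by ring)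
  · rw [amp_right h.ne_fst]
    have k3 := (amp_pos n4 n3 (h.axis_snd l n4 n3 β)).le
    exact le_of_le_of_eq (mul_nonneg (mul_nonneg k1 (mul_nonneg hw k3)) hα2) (by ring)
  · rw [amp_right h.ne_snd]
    have k3 := (amp_pos n1.symm n3.symm (h.axis_fst l n1.symm n3.symm α)).le
    exact le_of_le_of_eq (mul_nonneg (mul_nonneg k3 (mul_nonneg hw k2)) hβ2) (by ring)
  · rw [amp_left]
    have k3 := (amp_pos n2.symm n4.symm (h.axis_fst l n2.symm n4.symm α)).le
    exact le_of_le_of_eq (mul_nonneg (mul_nonneg k3 (mul_nonneg hw k2)) hβ1) (by ring)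

/-- A monic quadratic polynomial with the appropriate signs splits, with roots in given intervals. -/
theorem exists_roots_of_sign {b c l₁ h₁ l₂ h₂ : ℝ} (hlh₁ : l₁ < h₁) (h12 : h₁ ≤ l₂)
    (hlh₂ : l₂ < h₂) (q1 : 0 ≤ l₁ ^ 2 + b * l₁ + c) (q2 : h₁ ^ 2 + b * h₁ + c ≤ 0)
    (q3 : l₂ ^ 2 + b * l₂ + c ≤ 0) (q4 : 0 ≤ h₂ ^ 2 + b * h₂ + c) :
    ∃ u ∈ Icc l₁ h₁, ∃ v ∈ Icc l₂ h₂, ∀ t : ℝ, t ^ 2 + b * t + c = (t - v) * (t - u) := by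
  obtain ⟨u, hu, hu0⟩ := intermediate_value_Icc' hlh₁.le
    (f := fun t : ℝ => t ^ 2 + b * t + c) (by fun_prop) ⟨q2, q1⟩
  simp only at hu0
  have hf : ∀ t : ℝ, t ^ 2 + b * t + c = (t - (-b - u)) * (t - u) := fun t => by
    linear_combination hu0
  rw [hf] at q3 q4
  have hv2 : -b - u ≤ h₂ := by
    by_contra hcon
    have : 0 < (-b - u - h₂) * (h₂ - u) :=
      mul_pos (by linarith) (by linarith [hu.2])
    nlinarith
  by_cases hv1 : l₂ ≤ -b - u
  · exact ⟨u, hu, -b - u, ⟨hv1, hv2⟩, hf⟩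
  -- The intervals may touch. The second root falls below `l₂` only if `u` is the common endpoint,
  -- and then the two roots exchange roles.
  · push Not at hv1
    have hul : l₂ ≤ u := by
      by_contra hcon
      push Not at hcon
      have := mul_pos (sub_pos.mpr hv1) (sub_pos.mpr hcon)
      linarith
    have hul' : u = l₂ := le_antisymm (hu.2.trans h12) hul
    have huh : u = h₁ := le_antisymm hu.2 (h12.trans hul)
    refine ⟨-b - u, ⟨?_, by linarith⟩, u, ⟨hul, by linarith⟩, fun t => by rw [hf]; ring⟩
    rw [hf] at q1
    by_contra hcon
    push Not at hcon
    have := mul_pos (sub_pos.mpr hcon) (sub_pos.mpr (huh ▸ hlh₁ : l₁ < u))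
    linarith

end Surjectivity

/-! ### Explicit factorizations in dimensions three and four. -/

section SmallProducts

theorem prod_erase_three_zero (f : Fin 3 → ℝ) :
    ∏ k ∈ Finset.univ.erase (0 : Fin 3), f k = f 1 * f 2 := by
  rw [show Finset.univ.erase (0 : Fin 3) = {1, 2} by decide]; simp

theorem prod_erase_three_one (f : Fin 3 → ℝ) :
    ∏ k ∈ Finset.univ.erase (1 : Fin 3), f k = f 0 * f 2 := by
  rw [show Finset.univ.erase (1 : Fin 3) = {0, 2} by decide]; simp

theorem prod_erase_three_two (f : Fin 3 → ℝ) :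
    ∏ k ∈ Finset.univ.erase (2 : Fin 3), f k = f 0 * f 1 := by
  rw [show Finset.univ.erase (2 : Fin 3) = {0, 1} by decide]; simp

theorem prod_erase_four_zero (f : Fin 4 → ℝ) :
    ∏ k ∈ Finset.univ.erase (0 : Fin 4), f k = f 1 * f 2 * f 3 := by
  rw [show Finset.univ.erase (0 : Fin 4) = {1, 2, 3} by decide]; simp [mul_assoc]

theorem prod_erase_four_one (f : Fin 4 → ℝ) :
    ∏ k ∈ Finset.univ.erase (1 : Fin 4), f k = f 0 * f 2 * f 3 := by
  rw [show Finset.univ.erase (1 : Fin 4) = {0, 2, 3} by decide]; simp [mul_assoc]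

theorem prod_erase_four_two (f : Fin 4 → ℝ) :
    ∏ k ∈ Finset.univ.erase (2 : Fin 4), f k = f 0 * f 1 * f 3 := by
  rw [show Finset.univ.erase (2 : Fin 4) = {0, 1, 3} by decide]; simp [mul_assoc]

theorem prod_erase_four_three (f : Fin 4 → ℝ) :
    ∏ k ∈ Finset.univ.erase (3 : Fin 4), f k = f 0 * f 1 * f 2 := by
  rw [show Finset.univ.erase (3 : Fin 4) = {0, 1, 2} by decide]; simp [mul_assoc]

theorem exists_secular_eq_three {A : Fin 3 → ℝ} {x : Euc 3} (h0 : secular A x 0 = 0) :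
    ∃ b c : ℝ, ∀ t, secular A x t = t * (t ^ 2 + b * t + c) := by
  have hs : ∀ t, secular A x t = (t - A 0) * (t - A 1) * (t - A 2) +
      (x 0 ^ 2 * ((t - A 1) * (t - A 2)) + x 1 ^ 2 * ((t - A 0) * (t - A 2)) +
        x 2 ^ 2 * ((t - A 0) * (t - A 1))) := fun t => by
    rw [secular, Fin.prod_univ_three, Fin.sum_univ_three, prod_erase_three_zero,
      prod_erase_three_one, prod_erase_three_two]
  refine ⟨-(A 0 + A 1 + A 2) + (x 0 ^ 2 + x 1 ^ 2 + x 2 ^ 2),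
    A 0 * A 1 + A 0 * A 2 + A 1 * A 2 -
      (x 0 ^ 2 * (A 1 + A 2) + x 1 ^ 2 * (A 0 + A 2) + x 2 ^ 2 * (A 0 + A 1)), fun t => ?_⟩
  rw [hs] at h0 ⊢
  linear_combination h0

theorem exists_secular_eq_four {A : Fin 4 → ℝ} {x : Euc 4} {μ : ℝ} (hμ : μ ≠ 0)
    (h0 : secular A x 0 = 0) (h1 : secular A x μ = 0) :
    ∃ b c : ℝ, ∀ t, secular A x t = t * (t - μ) * (t ^ 2 + b * t + c) := by
  have hs : ∀ t, secular A x t = (t - A 0) * (t - A 1) * (t - A 2) * (t - A 3) +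
      (x 0 ^ 2 * ((t - A 1) * (t - A 2) * (t - A 3)) +
        x 1 ^ 2 * ((t - A 0) * (t - A 2) * (t - A 3)) +
        x 2 ^ 2 * ((t - A 0) * (t - A 1) * (t - A 3)) +
        x 3 ^ 2 * ((t - A 0) * (t - A 1) * (t - A 2))) := fun t => by
    rw [secular, Fin.prod_univ_four, Fin.sum_univ_four, prod_erase_four_zero,
      prod_erase_four_one, prod_erase_four_two, prod_erase_four_three]
  obtain ⟨e1, e2, e3, he⟩ : ∃ e1 e2 e3 : ℝ, ∀ t,
      secular A x t = t * (t ^ 3 + e1 * t ^ 2 + e2 * t + e3) := by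
    refine ⟨-(A 0 + A 1 + A 2 + A 3) + (x 0 ^ 2 + x 1 ^ 2 + x 2 ^ 2 + x 3 ^ 2),
      A 0 * A 1 + A 0 * A 2 + A 0 * A 3 + A 1 * A 2 + A 1 * A 3 + A 2 * A 3 -
        (x 0 ^ 2 * (A 1 + A 2 + A 3) + x 1 ^ 2 * (A 0 + A 2 + A 3) +
          x 2 ^ 2 * (A 0 + A 1 + A 3) + x 3 ^ 2 * (A 0 + A 1 + A 2)),
      -(A 0 * A 1 * A 2 + A 0 * A 1 * A 3 + A 0 * A 2 * A 3 + A 1 * A 2 * A 3) +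
        (x 0 ^ 2 * (A 1 * A 2 + A 1 * A 3 + A 2 * A 3) +
          x 1 ^ 2 * (A 0 * A 2 + A 0 * A 3 + A 2 * A 3) +
          x 2 ^ 2 * (A 0 * A 1 + A 0 * A 3 + A 1 * A 3) +
          x 3 ^ 2 * (A 0 * A 1 + A 0 * A 2 + A 1 * A 2)), fun t => ?_⟩
    rw [hs] at h0 ⊢
    linear_combination h0
  rw [he] at h1
  have h2 := (mul_eq_zero.mp h1).resolve_left hμ
  refine ⟨μ + e1, μ ^ 2 + e1 * μ + e2, fun t => ?_⟩
  rw [he]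
  linear_combination t * h2

theorem mul_mul_nonneg₆ {a b c d e f : ℝ} (ha : 0 ≤ a) (hb : 0 ≤ b) (hc : 0 ≤ c) (hd : 0 ≤ d)
    (he : 0 ≤ e) (hf : 0 ≤ f) : 0 ≤ a * b * c * (d * e * f) := by positivity

end SmallProducts

/-! ### Umbilic and partially umbilic points in terms of the roots. -/

section Umbilics

variable {m : ℕ} {F : Euc (m + 1) → ℝ} {p : Euc (m + 1)} {r : Fin m → ℝ} {N : ℝ}

theorem curvature_lt_iff {N a b : ℝ} (hN : 0 < N) (ha : 0 < a) (hb : 0 < b) :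
    2 / (a * N) < 2 / (b * N) ↔ b < a := by
  rw [div_lt_div_iff_of_pos_left two_pos (by positivity) (by positivity)]
  exact mul_lt_mul_iff_of_pos_right hN

theorem curvature_eq_iff {N a b : ℝ} (hN : 0 < N) (ha : 0 < a) (hb : 0 < b) :
    2 / (a * N) = 2 / (b * N) ↔ a = b := by
  constructor
  · intro h
    rcases lt_trichotomy a b with h1 | h1 | h1
    · exact absurd h ((curvature_lt_iff hN hb ha).mpr h1).ne'
    · exact h1
    · exact absurd h ((curvature_lt_iff hN ha hb).mpr h1).ne
  · rintro rfl
    rfl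

/-- Uniqueness of the curvatures lets the existential in the definitions of the umbilic sets be
tested on a known tuple. -/
theorem exists_hasPrincipalCurvatures_iff (h0 : fderiv ℝ F p ≠ 0) {k : Fin m → ℝ}
    (hk : HasPrincipalCurvatures F p k) (P : (Fin m → ℝ) → Prop) :
    (∃ k, HasPrincipalCurvatures F p k ∧ P k) ↔ P k := by
  constructor
  · rintro ⟨k', hk', hP⟩
    rwa [hk.unique h0 hk']
  · exact fun hP => ⟨k, hk, hP⟩

namespace ConfocalNet

variable {A : Fin (m + 1) → ℝ} {i j : Fin m} {r : ℝ → ℝ → Fin m → ℝ} {ρ : Fin m → ℝ}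
  {C : Set (Euc (m + 1))} {X Y : Fin (m + 1) → ℝ → ℝ} {v u : ℝ → ℝ}

theorem quadricGrad_pos (h : ConfocalNet A i j r ρ C X Y v u) (α β : ℝ) :
    0 < ‖quadricGrad A (separated X Y α β)‖ :=
  norm_pos_iff.mpr (quadricGrad_ne_zero h.pos (h.mem_hypersurface α β))

theorem mem_umbilicSet_iff (h : ConfocalNet A i j r ρ C X Y v u) (α β : ℝ) :
    separated X Y α β ∈ umbilicSet (quadric A) ↔ ∀ k l, r α β k = r α β l := by
  rw [umbilicSet, mem_ofPred_eq, and_iff_right (h.mem_hypersurface α β),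
    exists_hasPrincipalCurvatures_iff (fderiv_quadric_ne_zero h.pos (h.mem_hypersurface α β))
      (h.hasPrincipalCurvatures α β) fun k => ∀ i j, k i = k j]
  exact forall₂_congr fun k l =>
    curvature_eq_iff (h.quadricGrad_pos α β) (h.root_pos _ _ _) (h.root_pos _ _ _)

variable {A : Fin 4 → ℝ} {i j : Fin 3} {r : ℝ → ℝ → Fin 3 → ℝ} {ρ : Fin 3 → ℝ}
  {C : Set (Euc 4)} {X Y : Fin 4 → ℝ → ℝ}

theorem mem_partiallyUmbilic12_iff (h : ConfocalNet A i j r ρ C X Y v u) (α β : ℝ) :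
    separated X Y α β ∈ partiallyUmbilic12 (quadric A) ↔
      r α β 0 = r α β 1 ∧ r α β 2 < r α β 1 := by
  rw [partiallyUmbilic12, mem_ofPred_eq, and_iff_right (h.mem_hypersurface α β),
    exists_hasPrincipalCurvatures_iff (fderiv_quadric_ne_zero h.pos (h.mem_hypersurface α β))
      (h.hasPrincipalCurvatures α β) fun k => k 0 = k 1 ∧ k 1 < k 2]
  exact and_congr
    (curvature_eq_iff (h.quadricGrad_pos α β) (h.root_pos _ _ _) (h.root_pos _ _ _))
    (curvature_lt_iff (h.quadricGrad_pos α β) (h.root_pos _ _ _) (h.root_pos _ _ _))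

theorem mem_partiallyUmbilic23_iff (h : ConfocalNet A i j r ρ C X Y v u) (α β : ℝ) :
    separated X Y α β ∈ partiallyUmbilic23 (quadric A) ↔
      r α β 1 < r α β 0 ∧ r α β 1 = r α β 2 := by
  rw [partiallyUmbilic23, mem_ofPred_eq, and_iff_right (h.mem_hypersurface α β),
    exists_hasPrincipalCurvatures_iff (fderiv_quadric_ne_zero h.pos (h.mem_hypersurface α β))
      (h.hasPrincipalCurvatures α β) fun k => k 0 < k 1 ∧ k 1 = k 2]
  exact and_congr
    (curvature_lt_iff (h.quadricGrad_pos α β) (h.root_pos _ _ _) (h.root_pos _ _ _))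
    (curvature_eq_iff (h.quadricGrad_pos α β) (h.root_pos _ _ _) (h.root_pos _ _ _))

end ConfocalNet

end Umbilics

theorem fin_three_cases (l : Fin 3) : l = 0 ∨ l = 1 ∨ l = 2 := by
  fin_cases l <;> simp

theorem fin_four_cases (l : Fin 4) : l = 0 ∨ l = 1 ∨ l = 2 ∨ l = 3 := by
  fin_cases l <;> simp

theorem antitone_vec_two {a b : ℝ} (h : b ≤ a) : Antitone ![a, b] := by
  intro k l hkl
  fin_cases k <;> fin_cases l <;> simp_all

theorem antitone_vec_three {a b c : ℝ} (h : b ≤ a) (h' : c ≤ b) : Antitone ![a, b, c] := by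
  have := h'.trans h
  intro k l hkl
  fin_cases k <;> fin_cases l <;> simp_all

theorem injective_of_strictAnti_three {A : Fin 3 → ℝ} (h21 : A 2 < A 1) (h10 : A 1 < A 0) :
    Function.Injective A := by
  have := h21.trans h10
  intro k l hkl
  fin_cases k <;> fin_cases l <;> simp_all

theorem injective_of_strictAnti_four {A : Fin 4 → ℝ} (h32 : A 3 < A 2) (h21 : A 2 < A 1)
    (h10 : A 1 < A 0) : Function.Injective A := by
  have := h32.trans h21
  have := h21.trans h10
  have := h32.trans (h21.trans h10)
  intro k l hkl
  fin_cases k <;> fin_cases l <;> simp_all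

/-! ### The triaxial ellipsoid as a pillow. -/

section Ellipsoid

variable {A : Fin 3 → ℝ}

/-- On a surface of `ℝ³` both roots move, and the constant value `0` of `ρ` is a placeholder. -/
theorem ampData_ellipsoid (h2 : 0 < A 2) (h21 : A 2 < A 1) (h10 : A 1 < A 0) :
    AmpData A 0 1 (fun α β => ![ampVal A 0 1 α, ampVal A 2 1 β]) (fun _ => 0) 0 1 1 2
      (fun _ => 1) := by
  have hv := ampVal_mem_Icc (A := A) (p := 0) (q := 1) h10.le
  have hu := ampVal_mem_Icc' (A := A) (p := 2) (q := 1) h21.le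
  refine
    { pos := fun k => ?_
      inj := injective_of_strictAnti_three h21 h10
      ne := by decide
      anti := fun α β => antitone_vec_two ((hu β).2.trans (hv α).1)
      root_pos := fun α β k => ?_
      root_fst := fun α β => rfl
      root_snd := fun α β => rfl
      root_other := fun α β k hk hk' => ?_
      sep_fst := fun k hk hk' => ?_
      sep_snd := fun k hk hk' => ?_
      ne_fst := by decide
      ne_snd := by decide
      axis_fst := fun l hl hl' θ heq => ?_
      axis_snd := fun l hl hl' θ heq => ?_
      axis_other := fun l k hk hk' => ?_
      eps := fun l => one_pow 2
      sign := fun l α β => ?_ }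
  · fin_cases k <;> simp <;> linarith
  · have := (hv α).1
    have := (hu β).1
    fin_cases k <;> simp <;> linarith
  · fin_cases k <;> simp_all
  · fin_cases k <;> simp_all
  · fin_cases k <;> simp_all
  · obtain ⟨_, _⟩ := hv θ
    rcases fin_three_cases l with rfl | rfl | rfl <;>
      first | exact absurd rfl hl | exact absurd rfl hl' | linarith
  · obtain ⟨_, _⟩ := hu θ
    rcases fin_three_cases l with rfl | rfl | rfl <;>
      first | exact absurd rfl hl | exact absurd rfl hl' | linarith
  · fin_cases k <;> simp_all
  · obtain ⟨v1, v0⟩ := hv α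
    obtain ⟨u2, u1⟩ := hu β
    rw [Fin.prod_univ_two]
    change 0 ≤ (∏ k ∈ (Finset.univ : Finset (Fin 3)).erase l, (A l - A k)) *
      ((A l - ampVal A 0 1 α) * (A l - ampVal A 2 1 β))
    rcases fin_three_cases l with rfl | rfl | rfl
    · rw [prod_erase_three_zero]
      exact mul_nonneg (mul_nonneg (by linarith) (by linarith))
        (mul_nonneg (by linarith) (by linarith))
    · rw [prod_erase_three_one]
      exact mul_nonneg_of_nonpos_of_nonpos
        (mul_nonpos_of_nonpos_of_nonneg (by linarith) (by linarith))
        (mul_nonpos_of_nonpos_of_nonneg (by linarith) (by linarith))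
    · rw [prod_erase_three_two]
      exact mul_nonneg (mul_nonneg_of_nonpos_of_nonpos (by linarith) (by linarith))
        (mul_nonneg_of_nonpos_of_nonpos (by linarith) (by linarith))

/-- By `secular_apply_self` the quadratic factor of `secular` is nonnegative at the outer axes and
nonpositive at the middle one, which places one root in each gap. -/
theorem hypersurface_eq_range (h2 : 0 < A 2) (h21 : A 2 < A 1) (h10 : A 1 < A 0) :
    hypersurface (quadric A) = range fun x : ℝ × ℝ =>
      separated (amp A 0 1) (scaledAmp A (fun _ => 0) 0 1 2 1 fun _ => 1) x.1 x.2 := by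
  have h := ampData_ellipsoid h2 h21 h10
  apply Subset.antisymm
  · intro x hx
    have h0 := (mem_hypersurface_quadric_iff h.pos x).mp hx
    obtain ⟨b, c, hbc⟩ := exists_secular_eq_three h0
    have hA : ∀ l, A l * (A l ^ 2 + b * A l + c) =
        x l ^ 2 * ∏ k ∈ Finset.univ.erase l, (A l - A k) := fun l => by
      rw [← secular_apply_self, hbc]
    have hs : ∀ l, (A l ^ 2 + b * A l + c) =
        x l ^ 2 / A l * ∏ k ∈ Finset.univ.erase l, (A l - A k) := fun l => by
      have := (h.pos l).ne'
      field_simp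
      linarith [hA l]
    have hw : ∀ l, 0 ≤ x l ^ 2 / A l := fun l => div_nonneg (sq_nonneg _) (h.pos l).le
    obtain ⟨u, hu, v, hv, huv⟩ := exists_roots_of_sign (b := b) (c := c) h21 le_rfl h10
      (by
        rw [hs, prod_erase_three_two]
        exact mul_nonneg (hw _) (mul_nonneg_of_nonpos_of_nonpos (by linarith) (by linarith)))
      (by
        rw [hs, prod_erase_three_one]
        exact mul_nonpos_of_nonneg_of_nonpos (hw _)
          (mul_nonpos_of_nonpos_of_nonneg (by linarith) (by linarith)))
      (by
        rw [hs, prod_erase_three_one]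
        exact mul_nonpos_of_nonneg_of_nonpos (hw _)
          (mul_nonpos_of_nonpos_of_nonneg (by linarith) (by linarith)))
      (by
        rw [hs, prod_erase_three_zero]
        exact mul_nonneg (hw _) (mul_nonneg (by linarith) (by linarith)))
    refine h.pillow_mem_range h21 h10 hv hu (fun α β hα hβ t => ?_) fun l h0 h1 h2 => ?_
    · rw [hbc, huv, Fin.prod_univ_two]
      simp [hα, hβ]
    · fin_cases l <;> simp_all
  · rintro _ ⟨y, rfl⟩
    rw [mem_hypersurface_quadric_iff h.pos]
    dsimp only
    rw [h.secular_eq, zero_mul]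

/-- The principal configuration of a triaxial ellipsoid of `ℝ³`. -/
theorem netChart_ellipsoid (h2 : 0 < A 2) (h21 : A 2 < A 1) (h10 : A 1 < A 0) :
    NetChart (quadric A) 0 1 (umbilicSet (quadric A)) (hypersurface (quadric A))
      (fun x => separated (amp A 0 1) (scaledAmp A (fun _ => 0) 0 1 2 1 fun _ => 1) x.1 x.2)
      pillowSing pillowLeafFst pillowLeafSnd pillowKer := by
  have h := ampData_ellipsoid h2 h21 h10
  have hnet := h.confocalNet (hypersurface_eq_range h2 h21 h10)
    (fun s _ hx _ x hxs => (mem_hypersurface_quadric_iff h.pos x).mpr (hx x hxs).1)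
  refine h.pillow_netChart h21 h10 rfl hnet fun α β => ?_
  rw [hnet.mem_umbilicSet_iff]
  simp [Fin.forall_fin_two, eq_comm]

end Ellipsoid

/-! ### The quartic surfaces in the three ranges of the parameter. -/

section Quartic

variable {A : Fin 4 → ℝ} {μ : ℝ}

/-- The intersection of the quadric `∑ xₗ² / Aₗ = 1` with a confocal quadric. -/
def quarticSet (A : Fin 4 → ℝ) (μ : ℝ) : Set (Euc 4) := {x | secular A x 0 = 0 ∧ secular A x μ = 0}

/-- The part of the quartic surface with `e * x l > 0`. -/
def quarticPart (A : Fin 4 → ℝ) (μ e : ℝ) (l : Fin 4) : Set (Euc 4) :=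
  {x | x ∈ quarticSet A μ ∧ 0 < e * x l}

/-- A coordinate that never vanishes on the quartic surface keeps its sign on connected subsets. -/
theorem quarticPart_subset_of_connected {e : ℝ} {l : Fin 4} (he : e ≠ 0)
    (hne : ∀ x ∈ quarticSet A μ, x l ≠ 0) {s : Set (Euc 4)} (hs : IsPreconnected s)
    (hsub : s ⊆ quarticSet A μ) (hmeet : (s ∩ quarticPart A μ e l).Nonempty) :
    s ⊆ quarticPart A μ e l := by
  obtain ⟨y, hy, hyC⟩ := hmeet
  intro x hx
  refine ⟨hsub hx, ?_⟩
  by_contra hcon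
  have hc : ContinuousOn (fun x : Euc 4 => e * x l) s := by fun_prop
  obtain ⟨z, hz, hz0⟩ := hs.intermediate_value hx hy hc
    (show (0 : ℝ) ∈ Icc (e * x l) (e * y l) from ⟨not_lt.mp hcon, hyC.2.le⟩)
  exact hne z (hsub hz) ((mul_eq_zero.mp hz0).resolve_left he)

section RootsOfQuartic

variable {x : Euc 4}

/-- The first factor on the right is nonnegative, so the sign of the quadratic factor at an axis is
controlled by the second. This locates the two roots other than `0` and `μ` in all three cases. -/
theorem quadratic_factor_apply (hA : ∀ l, 0 < A l) {b c : ℝ} (hμ : ∀ l, A l ≠ μ)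
    (hbc : ∀ t, secular A x t = t * (t - μ) * (t ^ 2 + b * t + c)) (l : Fin 4) :
    A l ^ 2 + b * A l + c = (x l ^ 2 / (A l * (A l - μ) ^ 2)) *
      ((∏ k ∈ Finset.univ.erase l, (A l - A k)) * (A l - μ)) := by
  have h1 := secular_apply_self A x l
  rw [hbc] at h1
  have := (hA l).ne'
  have h2 : A l - μ ≠ 0 := sub_ne_zero.mpr (hμ l)
  field_simp
  linarith

/-- With `μ` in the lowest gap, the two other roots lie in the adjacent intervals `[A 2, A 1]` and
`[A 1, A 0]`; the sign at `A 1` serves both. -/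
theorem exists_roots_low (h3 : 0 < A 3) (h21 : A 2 < A 1) (h10 : A 1 < A 0)
    (hμ : μ ∈ Ioo (A 3) (A 2)) (hx : x ∈ quarticSet A μ) :
    ∃ u ∈ Icc (A 2) (A 1), ∃ v ∈ Icc (A 1) (A 0),
      ∀ t, secular A x t = t * ((t - v) * (t - u) * (t - μ)) := by
  obtain ⟨m3, m2⟩ := hμ
  have hA : ∀ l, 0 < A l := fun l => by fin_cases l <;> simp <;> linarith
  have hne : ∀ l, A l ≠ μ := fun l h => by fin_cases l <;> simp at h <;> linarith
  obtain ⟨b, c, hbc⟩ := exists_secular_eq_four (by linarith : μ ≠ 0) hx.1 hx.2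
  have hs := quadratic_factor_apply hA hne hbc
  have hw : ∀ l, 0 ≤ x l ^ 2 / (A l * (A l - μ) ^ 2) := fun l => by
    have := hA l
    positivity
  have q1 : A 1 ^ 2 + b * A 1 + c ≤ 0 := by
    rw [hs, prod_erase_four_one]
    refine mul_nonpos_of_nonneg_of_nonpos (hw _) (mul_nonpos_of_nonpos_of_nonneg
      (mul_nonpos_of_nonpos_of_nonneg (mul_nonpos_of_nonpos_of_nonneg ?_ ?_) ?_) ?_) <;> linarith
  obtain ⟨u, hu, v, hv, huv⟩ := exists_roots_of_sign (b := b) (c := c) h21 le_rfl h10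
    (by
      rw [hs, prod_erase_four_two]
      refine mul_nonneg (hw _) (mul_nonneg (mul_nonneg
        (mul_nonneg_of_nonpos_of_nonpos ?_ ?_) ?_) ?_) <;> linarith)
    q1 q1
    (by
      rw [hs, prod_erase_four_zero]
      refine mul_nonneg (hw _) (mul_nonneg (mul_nonneg (mul_nonneg ?_ ?_) ?_) ?_) <;> linarith)
  exact ⟨u, hu, v, hv, fun t => by rw [hbc, huv]; ring⟩

theorem exists_roots_high (h3 : 0 < A 3) (h32 : A 3 < A 2) (h21 : A 2 < A 1)
    (hμ : μ ∈ Ioo (A 1) (A 0)) (hx : x ∈ quarticSet A μ) :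
    ∃ u ∈ Icc (A 3) (A 2), ∃ v ∈ Icc (A 2) (A 1),
      ∀ t, secular A x t = t * ((t - μ) * (t - v) * (t - u)) := by
  obtain ⟨m3, m2⟩ := hμ
  have hA : ∀ l, 0 < A l := fun l => by fin_cases l <;> simp <;> linarith
  have hne : ∀ l, A l ≠ μ := fun l h => by fin_cases l <;> simp at h <;> linarith
  obtain ⟨b, c, hbc⟩ := exists_secular_eq_four (by linarith : μ ≠ 0) hx.1 hx.2
  have hs := quadratic_factor_apply hA hne hbc
  have hw : ∀ l, 0 ≤ x l ^ 2 / (A l * (A l - μ) ^ 2) := fun l => by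
    have := hA l
    positivity
  have q1 : A 2 ^ 2 + b * A 2 + c ≤ 0 := by
    rw [hs, prod_erase_four_two]
    refine mul_nonpos_of_nonneg_of_nonpos (hw _) (mul_nonpos_of_nonneg_of_nonpos
      (mul_nonneg (mul_nonneg_of_nonpos_of_nonpos ?_ ?_) ?_) ?_) <;> linarith
  obtain ⟨u, hu, v, hv, huv⟩ := exists_roots_of_sign (b := b) (c := c) h32 le_rfl h21
    (by
      rw [hs, prod_erase_four_three]
      refine mul_nonneg (hw _) (mul_nonneg_of_nonpos_of_nonpos (mul_nonpos_of_nonneg_of_nonpos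
        (mul_nonneg_of_nonpos_of_nonpos ?_ ?_) ?_) ?_) <;> linarith)
    q1 q1
    (by
      rw [hs, prod_erase_four_one]
      refine mul_nonneg (hw _) (mul_nonneg_of_nonpos_of_nonpos (mul_nonpos_of_nonpos_of_nonneg
        (mul_nonpos_of_nonpos_of_nonneg ?_ ?_) ?_) ?_) <;> linarith)
  exact ⟨u, hu, v, hv, fun t => by rw [hbc, huv]; ring⟩

theorem exists_roots_middle (h3 : 0 < A 3) (h32 : A 3 < A 2) (h21 : A 2 < A 1) (h10 : A 1 < A 0)
    (hμ : μ ∈ Ioo (A 2) (A 1)) (hx : x ∈ quarticSet A μ) :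
    ∃ u ∈ Icc (A 3) (A 2), ∃ v ∈ Icc (A 1) (A 0),
      ∀ t, secular A x t = t * ((t - v) * (t - μ) * (t - u)) := by
  obtain ⟨m3, m2⟩ := hμ
  have hA : ∀ l, 0 < A l := fun l => by fin_cases l <;> simp <;> linarith
  have hne : ∀ l, A l ≠ μ := fun l h => by fin_cases l <;> simp at h <;> linarith
  obtain ⟨b, c, hbc⟩ := exists_secular_eq_four (by linarith : μ ≠ 0) hx.1 hx.2
  have hs := quadratic_factor_apply hA hne hbc
  have hw : ∀ l, 0 ≤ x l ^ 2 / (A l * (A l - μ) ^ 2) := fun l => by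
    have := hA l
    positivity
  obtain ⟨u, hu, v, hv, huv⟩ := exists_roots_of_sign (b := b) (c := c) h32 h21.le h10
    (by
      rw [hs, prod_erase_four_three]
      refine mul_nonneg (hw _) (mul_nonneg_of_nonpos_of_nonpos (mul_nonpos_of_nonneg_of_nonpos
        (mul_nonneg_of_nonpos_of_nonpos ?_ ?_) ?_) ?_) <;> linarith)
    (by
      rw [hs, prod_erase_four_two]
      refine mul_nonpos_of_nonneg_of_nonpos (hw _) (mul_nonpos_of_nonneg_of_nonpos
        (mul_nonneg (mul_nonneg_of_nonpos_of_nonpos ?_ ?_) ?_) ?_) <;> linarith)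
    (by
      rw [hs, prod_erase_four_one]
      refine mul_nonpos_of_nonneg_of_nonpos (hw _) (mul_nonpos_of_nonpos_of_nonneg
        (mul_nonpos_of_nonpos_of_nonneg (mul_nonpos_of_nonpos_of_nonneg ?_ ?_) ?_) ?_) <;> linarith)
    (by
      rw [hs, prod_erase_four_zero]
      refine mul_nonneg (hw _) (mul_nonneg (mul_nonneg (mul_nonneg ?_ ?_) ?_) ?_) <;> linarith)
  exact ⟨u, hu, v, hv, fun t => by rw [hbc, huv]; ring⟩

/-- A vanishing coordinate would make `A 3` a root, but `A 3` is positive and lies strictly below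
the roots `μ`, `u`, `v`. -/
theorem apply_three_ne_zero (h3 : 0 < A 3) (h32 : A 3 < A 2) (h21 : A 2 < A 1) (h10 : A 1 < A 0)
    (hμ : μ ∈ Ioo (A 3) (A 2)) (hx : x ∈ quarticSet A μ) : x 3 ≠ 0 := by
  obtain ⟨u, hu, v, hv, huv⟩ := exists_roots_low h3 h21 h10 hμ hx
  intro h0
  have h1 := secular_apply_self A x 3
  rw [huv, h0] at h1
  have h2 : A 3 * ((A 3 - v) * (A 3 - u) * (A 3 - μ)) ≠ 0 :=
    mul_ne_zero h3.ne' (mul_ne_zero (mul_ne_zero (by linarith [hv.1]) (by linarith [hu.1]))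
      (by linarith [hμ.1]))
  exact h2 (by rw [h1]; ring)

theorem apply_zero_ne_zero (h3 : 0 < A 3) (h32 : A 3 < A 2) (h21 : A 2 < A 1) (h10 : A 1 < A 0)
    (hμ : μ ∈ Ioo (A 1) (A 0)) (hx : x ∈ quarticSet A μ) : x 0 ≠ 0 := by
  obtain ⟨u, hu, v, hv, huv⟩ := exists_roots_high h3 h32 h21 hμ hx
  intro h0
  have h1 := secular_apply_self A x 0
  rw [huv, h0] at h1
  have h2 : A 0 * ((A 0 - μ) * (A 0 - v) * (A 0 - u)) ≠ 0 :=
    mul_ne_zero (by linarith) (mul_ne_zero (mul_ne_zero (by linarith [hμ.2])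
      (by linarith [hv.2])) (by linarith [hu.2]))
  exact h2 (by rw [h1]; ring)

end RootsOfQuartic

/-- The sign `e` of the last coordinate selects one of the two components. -/
theorem ampData_low (h3 : 0 < A 3) (h32 : A 3 < A 2) (h21 : A 2 < A 1) (h10 : A 1 < A 0)
    (hμ : μ ∈ Ioo (A 3) (A 2)) {e : ℝ} (he : e ^ 2 = 1) :
    AmpData A 0 1 (fun α β => ![ampVal A 0 1 α, ampVal A 2 1 β, μ]) (fun _ => μ) 0 1 1 2
      ![1, 1, 1, e] := by
  obtain ⟨m3, m2⟩ := hμ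
  have hv := ampVal_mem_Icc (A := A) (p := 0) (q := 1) h10.le
  have hu := ampVal_mem_Icc' (A := A) (p := 2) (q := 1) h21.le
  refine
    { pos := fun k => ?_
      inj := injective_of_strictAnti_four h32 h21 h10
      ne := by decide
      anti := fun α β => antitone_vec_three ((hu β).2.trans (hv α).1) (m2.le.trans (hu β).1)
      root_pos := fun α β k => ?_
      root_fst := fun α β => rfl
      root_snd := fun α β => rfl
      root_other := fun α β k hk hk' => ?_
      sep_fst := fun k hk hk' α => (by linarith [(hv α).1] : μ < _).ne
      sep_snd := fun k hk hk' β => (by linarith [(hu β).1] : μ < _).ne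
      ne_fst := by decide
      ne_snd := by decide
      axis_fst := fun l hl hl' θ heq => ?_
      axis_snd := fun l hl hl' θ heq => ?_
      axis_other := fun l k hk hk' h => ?_
      eps := fun l => ?_
      sign := fun l α β => ?_ }
  · fin_cases k <;> simp <;> linarith
  · have := (hv α).1
    have := (hu β).1
    fin_cases k <;> simp <;> linarith
  · fin_cases k <;> simp_all
  · obtain ⟨_, _⟩ := hv θ
    rcases fin_four_cases l with rfl | rfl | rfl | rfl <;>
      first | exact absurd rfl hl | exact absurd rfl hl' | linarith
  · obtain ⟨_, _⟩ := hu θ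
    rcases fin_four_cases l with rfl | rfl | rfl | rfl <;>
      first | exact absurd rfl hl | exact absurd rfl hl' | linarith
  · fin_cases l <;> simp at h <;> linarith
  · fin_cases l <;> simp [he]
  · obtain ⟨v1, v0⟩ := hv α
    obtain ⟨u2, u1⟩ := hu β
    rw [Fin.prod_univ_three]
    change 0 ≤ (∏ k ∈ (Finset.univ : Finset (Fin 4)).erase l, (A l - A k)) *
      ((A l - ampVal A 0 1 α) * (A l - ampVal A 2 1 β) * (A l - μ))
    rcases fin_four_cases l with rfl | rfl | rfl | rfl
    · refine le_of_le_of_eq (mul_mul_nonneg₆ (a := A 0 - A 1) (b := A 0 - A 2) (c := A 0 - A 3)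
        (d := A 0 - ampVal A 0 1 α) (e := A 0 - ampVal A 2 1 β) (f := A 0 - μ)
        ?_ ?_ ?_ ?_ ?_ ?_) (by rw [prod_erase_four_zero]) <;> linarith
    · refine le_of_le_of_eq (mul_mul_nonneg₆ (a := A 0 - A 1) (b := A 1 - A 2) (c := A 1 - A 3)
        (d := ampVal A 0 1 α - A 1) (e := A 1 - ampVal A 2 1 β) (f := A 1 - μ)
        ?_ ?_ ?_ ?_ ?_ ?_) (by rw [prod_erase_four_one]; ring) <;> linarith
    · refine le_of_le_of_eq (mul_mul_nonneg₆ (a := A 0 - A 2) (b := A 1 - A 2) (c := A 2 - A 3)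
        (d := ampVal A 0 1 α - A 2) (e := ampVal A 2 1 β - A 2) (f := A 2 - μ)
        ?_ ?_ ?_ ?_ ?_ ?_) (by rw [prod_erase_four_two]; ring) <;> linarith
    · refine le_of_le_of_eq (mul_mul_nonneg₆ (a := A 0 - A 3) (b := A 1 - A 3) (c := A 2 - A 3)
        (d := ampVal A 0 1 α - A 3) (e := ampVal A 2 1 β - A 3) (f := μ - A 3)
        ?_ ?_ ?_ ?_ ?_ ?_) (by rw [prod_erase_four_three]; ring) <;> linarith

theorem ampData_high (h3 : 0 < A 3) (h32 : A 3 < A 2) (h21 : A 2 < A 1) (h10 : A 1 < A 0)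
    (hμ : μ ∈ Ioo (A 1) (A 0)) {e : ℝ} (he : e ^ 2 = 1) :
    AmpData A 1 2 (fun α β => ![μ, ampVal A 1 2 α, ampVal A 3 2 β]) (fun _ => μ) 1 2 2 3
      ![e, 1, 1, 1] := by
  obtain ⟨m3, m2⟩ := hμ
  have hv := ampVal_mem_Icc (A := A) (p := 1) (q := 2) h21.le
  have hu := ampVal_mem_Icc' (A := A) (p := 3) (q := 2) h32.le
  refine
    { pos := fun k => ?_
      inj := injective_of_strictAnti_four h32 h21 h10
      ne := by decide
      anti := fun α β => antitone_vec_three ((hv α).2.trans m3.le) ((hu β).2.trans (hv α).1)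
      root_pos := fun α β k => ?_
      root_fst := fun α β => rfl
      root_snd := fun α β => rfl
      root_other := fun α β k hk hk' => ?_
      sep_fst := fun k hk hk' α => (by linarith [(hv α).2] : _ < μ).ne'
      sep_snd := fun k hk hk' β => (by linarith [(hu β).2] : _ < μ).ne'
      ne_fst := by decide
      ne_snd := by decide
      axis_fst := fun l hl hl' θ heq => ?_
      axis_snd := fun l hl hl' θ heq => ?_
      axis_other := fun l k hk hk' h => ?_
      eps := fun l => ?_
      sign := fun l α β => ?_ }
  · fin_cases k <;> simp <;> linarith
  · have := (hv α).1
    have := (hu β).1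
    fin_cases k <;> simp <;> linarith
  · fin_cases k <;> simp_all
  · obtain ⟨_, _⟩ := hv θ
    rcases fin_four_cases l with rfl | rfl | rfl | rfl <;>
      first | exact absurd rfl hl | exact absurd rfl hl' | linarith
  · obtain ⟨_, _⟩ := hu θ
    rcases fin_four_cases l with rfl | rfl | rfl | rfl <;>
      first | exact absurd rfl hl | exact absurd rfl hl' | linarith
  · fin_cases l <;> simp at h <;> linarith
  · fin_cases l <;> simp [he]
  · obtain ⟨v1, v0⟩ := hv α
    obtain ⟨u2, u1⟩ := hu β
    rw [Fin.prod_univ_three]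
    change 0 ≤ (∏ k ∈ (Finset.univ : Finset (Fin 4)).erase l, (A l - A k)) *
      ((A l - μ) * (A l - ampVal A 1 2 α) * (A l - ampVal A 3 2 β))
    rcases fin_four_cases l with rfl | rfl | rfl | rfl
    · refine le_of_le_of_eq (mul_mul_nonneg₆ (a := A 0 - A 1) (b := A 0 - A 2) (c := A 0 - A 3)
        (d := A 0 - ampVal A 1 2 α) (e := A 0 - ampVal A 3 2 β) (f := A 0 - μ)
        ?_ ?_ ?_ ?_ ?_ ?_) (by rw [prod_erase_four_zero]; ring) <;> linarith
    · refine le_of_le_of_eq (mul_mul_nonneg₆ (a := A 0 - A 1) (b := A 1 - A 2) (c := A 1 - A 3)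
        (d := A 1 - ampVal A 1 2 α) (e := A 1 - ampVal A 3 2 β) (f := μ - A 1)
        ?_ ?_ ?_ ?_ ?_ ?_) (by rw [prod_erase_four_one]; ring) <;> linarith
    · refine le_of_le_of_eq (mul_mul_nonneg₆ (a := A 0 - A 2) (b := A 1 - A 2) (c := A 2 - A 3)
        (d := ampVal A 1 2 α - A 2) (e := A 2 - ampVal A 3 2 β) (f := μ - A 2)
        ?_ ?_ ?_ ?_ ?_ ?_) (by rw [prod_erase_four_two]; ring) <;> linarith
    · refine le_of_le_of_eq (mul_mul_nonneg₆ (a := A 0 - A 3) (b := A 1 - A 3) (c := A 2 - A 3)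
        (d := ampVal A 1 2 α - A 3) (e := ampVal A 3 2 β - A 3) (f := μ - A 3)
        ?_ ?_ ?_ ?_ ?_ ?_) (by rw [prod_erase_four_three]; ring) <;> linarith

theorem ampData_middle (h3 : 0 < A 3) (h32 : A 3 < A 2) (h21 : A 2 < A 1) (h10 : A 1 < A 0)
    (hμ : μ ∈ Ioo (A 2) (A 1)) :
    AmpData A 0 2 (fun α β => ![ampVal A 0 1 α, μ, ampVal A 3 2 β]) (fun _ => μ) 0 1 2 3
      (fun _ => 1) := by
  obtain ⟨m3, m2⟩ := hμ
  have hv := ampVal_mem_Icc (A := A) (p := 0) (q := 1) h10.le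
  have hu := ampVal_mem_Icc' (A := A) (p := 3) (q := 2) h32.le
  refine
    { pos := fun k => ?_
      inj := injective_of_strictAnti_four h32 h21 h10
      ne := by decide
      anti := fun α β => antitone_vec_three (m2.le.trans (hv α).1) ((hu β).2.trans m3.le)
      root_pos := fun α β k => ?_
      root_fst := fun α β => rfl
      root_snd := fun α β => rfl
      root_other := fun α β k hk hk' => ?_
      sep_fst := fun k hk hk' α => (by linarith [(hv α).1] : μ < _).ne
      sep_snd := fun k hk hk' β => (by linarith [(hu β).2] : _ < μ).ne'
      ne_fst := by decide
      ne_snd := by decide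
      axis_fst := fun l hl hl' θ heq => ?_
      axis_snd := fun l hl hl' θ heq => ?_
      axis_other := fun l k hk hk' h => ?_
      eps := fun l => one_pow 2
      sign := fun l α β => ?_ }
  · fin_cases k <;> simp <;> linarith
  · have := (hv α).1
    have := (hu β).1
    fin_cases k <;> simp <;> linarith
  · fin_cases k <;> simp_all
  · obtain ⟨_, _⟩ := hv θ
    rcases fin_four_cases l with rfl | rfl | rfl | rfl <;>
      first | exact absurd rfl hl | exact absurd rfl hl' | linarith
  · obtain ⟨_, _⟩ := hu θ
    rcases fin_four_cases l with rfl | rfl | rfl | rfl <;>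
      first | exact absurd rfl hl | exact absurd rfl hl' | linarith
  · fin_cases l <;> simp at h <;> linarith
  · obtain ⟨v1, v0⟩ := hv α
    obtain ⟨u2, u1⟩ := hu β
    rw [Fin.prod_univ_three]
    change 0 ≤ (∏ k ∈ (Finset.univ : Finset (Fin 4)).erase l, (A l - A k)) *
      ((A l - ampVal A 0 1 α) * (A l - μ) * (A l - ampVal A 3 2 β))
    rcases fin_four_cases l with rfl | rfl | rfl | rfl
    · refine le_of_le_of_eq (mul_mul_nonneg₆ (a := A 0 - A 1) (b := A 0 - A 2) (c := A 0 - A 3)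
        (d := A 0 - ampVal A 0 1 α) (e := A 0 - ampVal A 3 2 β) (f := A 0 - μ)
        ?_ ?_ ?_ ?_ ?_ ?_) (by rw [prod_erase_four_zero]; ring) <;> linarith
    · refine le_of_le_of_eq (mul_mul_nonneg₆ (a := A 0 - A 1) (b := A 1 - A 2) (c := A 1 - A 3)
        (d := ampVal A 0 1 α - A 1) (e := A 1 - ampVal A 3 2 β) (f := A 1 - μ)
        ?_ ?_ ?_ ?_ ?_ ?_) (by rw [prod_erase_four_one]; ring) <;> linarith
    · refine le_of_le_of_eq (mul_mul_nonneg₆ (a := A 0 - A 2) (b := A 1 - A 2) (c := A 2 - A 3)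
        (d := ampVal A 0 1 α - A 2) (e := A 2 - ampVal A 3 2 β) (f := μ - A 2)
        ?_ ?_ ?_ ?_ ?_ ?_) (by rw [prod_erase_four_two]; ring) <;> linarith
    · refine le_of_le_of_eq (mul_mul_nonneg₆ (a := A 0 - A 3) (b := A 1 - A 3) (c := A 2 - A 3)
        (d := ampVal A 0 1 α - A 3) (e := ampVal A 3 2 β - A 3) (f := μ - A 3)
        ?_ ?_ ?_ ?_ ?_ ?_) (by rw [prod_erase_four_three]; ring) <;> linarith

theorem netChart_low (h3 : 0 < A 3) (h32 : A 3 < A 2) (h21 : A 2 < A 1) (h10 : A 1 < A 0)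
    (hμ : μ ∈ Ioo (A 3) (A 2)) {e : ℝ} (he : e ^ 2 = 1) :
    NetChart (quadric A) 0 1 (partiallyUmbilic12 (quadric A)) (quarticPart A μ e 3)
      (fun x => separated (amp A 0 1) (scaledAmp A (fun _ => μ) 0 1 2 1 ![1, 1, 1, e]) x.1 x.2)
      pillowSing pillowLeafFst pillowLeafSnd pillowKer := by
  have h := ampData_low h3 h32 h21 h10 hμ he
  have he0 : e ≠ 0 := h.eps_ne_zero 3
  have hrange : quarticPart A μ e 3 = range fun x : ℝ × ℝ =>
      separated (amp A 0 1) (scaledAmp A (fun _ => μ) 0 1 2 1 ![1, 1, 1, e]) x.1 x.2 := by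
    apply Subset.antisymm
    · rintro x ⟨hx, hpos⟩
      obtain ⟨u, hu, v, hv, huv⟩ := exists_roots_low h3 h21 h10 hμ hx
      refine h.pillow_mem_range h21 h10 hv hu (fun α β hα hβ t => ?_) fun l h0 h1 h2 => ?_
      · rw [huv, Fin.prod_univ_three]
        simp [hα, hβ]
      · obtain rfl : l = 3 := by fin_cases l <;> simp_all
        simpa using hpos.le
    · rintro _ ⟨y, rfl⟩
      refine ⟨⟨?_, ?_⟩, ?_⟩
      · dsimp only
        rw [h.secular_eq, zero_mul]
      · dsimp only
        rw [h.secular_eq, Fin.prod_univ_three]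
        simp
      · dsimp only
        rw [separated_apply, scaledAmp]
        have k1 := amp_pos (A := A) (p := 0) (q := 1) (l := 3) (by decide) (by decide)
          (h.axis_fst 3 (by decide) (by decide) y.1)
        have k2 := amp_pos (A := A) (p := 2) (q := 1) (l := 3) (by decide) (by decide)
          (h.axis_snd 3 (by decide) (by decide) y.2)
        have k3 := h.weight_pos 3
        refine lt_of_lt_of_eq (mul_pos k1 (mul_pos k3 k2)) ?_
        simp only [Matrix.cons_val]
        linear_combination -(amp A 0 1 3 y.1 * (weight A (fun _ => μ) 0 1 3 * amp A 2 1 3 y.2)) * he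
  have hnet := h.confocalNet hrange fun s hs hx hmeet =>
    quarticPart_subset_of_connected he0
      (fun x hx => apply_three_ne_zero h3 h32 h21 h10 hμ hx) hs
      (fun x hxs => ⟨(hx x hxs).1, (hx x hxs).2 2 (by decide) (by decide)⟩) hmeet
  refine h.pillow_netChart h21 h10 rfl hnet fun α β => ?_
  rw [hnet.mem_partiallyUmbilic12_iff]
  simp only [Matrix.cons_val]
  -- The root `μ` lies below the two others, so `k₃` is simple and the singular points are exactly
  -- those with coinciding moving roots.
  exact and_iff_left (hμ.2.trans_le (ampVal_mem_Icc' (A := A) (p := 2) (q := 1) h21.le β).1)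

theorem netChart_high (h3 : 0 < A 3) (h32 : A 3 < A 2) (h21 : A 2 < A 1) (h10 : A 1 < A 0)
    (hμ : μ ∈ Ioo (A 1) (A 0)) {e : ℝ} (he : e ^ 2 = 1) :
    NetChart (quadric A) 1 2 (partiallyUmbilic23 (quadric A)) (quarticPart A μ e 0)
      (fun x => separated (amp A 1 2) (scaledAmp A (fun _ => μ) 1 2 3 2 ![e, 1, 1, 1]) x.1 x.2)
      pillowSing pillowLeafFst pillowLeafSnd pillowKer := by
  have h := ampData_high h3 h32 h21 h10 hμ he
  have he0 : e ≠ 0 := h.eps_ne_zero 0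
  have hrange : quarticPart A μ e 0 = range fun x : ℝ × ℝ =>
      separated (amp A 1 2) (scaledAmp A (fun _ => μ) 1 2 3 2 ![e, 1, 1, 1]) x.1 x.2 := by
    apply Subset.antisymm
    · rintro x ⟨hx, hpos⟩
      obtain ⟨u, hu, v, hv, huv⟩ := exists_roots_high h3 h32 h21 hμ hx
      refine h.pillow_mem_range h32 h21 hv hu (fun α β hα hβ t => ?_) fun l h0 h1 h2 => ?_
      · rw [huv, Fin.prod_univ_three]
        simp [hα, hβ]
      · obtain rfl : l = 0 := by fin_cases l <;> simp_all
        simpa using hpos.le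
    · rintro _ ⟨y, rfl⟩
      refine ⟨⟨?_, ?_⟩, ?_⟩
      · dsimp only
        rw [h.secular_eq, zero_mul]
      · dsimp only
        rw [h.secular_eq, Fin.prod_univ_three]
        simp
      · dsimp only
        rw [separated_apply, scaledAmp]
        have k1 := amp_pos (A := A) (p := 1) (q := 2) (l := 0) (by decide) (by decide)
          (h.axis_fst 0 (by decide) (by decide) y.1)
        have k2 := amp_pos (A := A) (p := 3) (q := 2) (l := 0) (by decide) (by decide)
          (h.axis_snd 0 (by decide) (by decide) y.2)
        have k3 := h.weight_pos 0
        refine lt_of_lt_of_eq (mul_pos k1 (mul_pos k3 k2)) ?_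
        simp only [Matrix.cons_val]
        linear_combination -(amp A 1 2 0 y.1 * (weight A (fun _ => μ) 1 2 0 * amp A 3 2 0 y.2)) * he
  have hnet := h.confocalNet hrange fun s hs hx hmeet =>
    quarticPart_subset_of_connected he0
      (fun x hx => apply_zero_ne_zero h3 h32 h21 h10 hμ hx) hs
      (fun x hxs => ⟨(hx x hxs).1, (hx x hxs).2 0 (by decide) (by decide)⟩) hmeet
  refine h.pillow_netChart h32 h21 rfl hnet fun α β => ?_
  rw [hnet.mem_partiallyUmbilic23_iff]
  simp only [Matrix.cons_val]
  -- Here `μ` exceeds the two moving roots, so it is `k₁` that is simple.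
  exact and_iff_right ((ampVal_mem_Icc (A := A) (p := 1) (q := 2) h21.le α).2.trans_lt hμ.1)

theorem netChart_middle (h3 : 0 < A 3) (h32 : A 3 < A 2) (h21 : A 2 < A 1) (h10 : A 1 < A 0)
    (hμ : μ ∈ Ioo (A 2) (A 1)) :
    NetChart (quadric A) 0 2
      (umbilicSet (quadric A) ∪ partiallyUmbilic12 (quadric A) ∪ partiallyUmbilic23 (quadric A))
      (quarticSet A μ)
      (fun x => separated (amp A 0 1) (scaledAmp A (fun _ => μ) 0 2 3 2 fun _ => 1) x.1 x.2)
      (fun _ => False) (fun x y => angleEq x.2 y.2) (fun x y => angleEq x.1 y.1)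
      (fun x y => angleEq x.1 y.1 ∧ angleEq x.2 y.2) := by
  have h := ampData_middle h3 h32 h21 h10 hμ
  have hrange : quarticSet A μ = range fun x : ℝ × ℝ =>
      separated (amp A 0 1) (scaledAmp A (fun _ => μ) 0 2 3 2 fun _ => 1) x.1 x.2 := by
    apply Subset.antisymm
    · intro x hx
      obtain ⟨u, hu, v, hv, huv⟩ := exists_roots_middle h3 h32 h21 h10 hμ hx
      refine h.torus_mem_range h32 h21 h10 hv hu (fun α β hα hβ t => ?_) fun l => ?_
      · rw [huv, Fin.prod_univ_three]
        simp [hα, hβ]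
      · fin_cases l <;> simp
    · rintro _ ⟨y, rfl⟩
      refine ⟨?_, ?_⟩
      · dsimp only
        rw [h.secular_eq, zero_mul]
      · dsimp only
        rw [h.secular_eq, Fin.prod_univ_three]
        simp
  have hnet := h.confocalNet hrange fun s hs hx hmeet x hxs =>
    ⟨(hx x hxs).1, (hx x hxs).2 1 (by decide) (by decide)⟩
  refine h.torus_netChart h32 h21 h10 (fun _ => rfl) hnet fun α β => ?_
  have hv := (ampVal_mem_Icc (A := A) (p := 0) (q := 1) h10.le α).1
  have hu := (ampVal_mem_Icc' (A := A) (p := 3) (q := 2) h32.le β).2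
  rw [mem_union, mem_union, hnet.mem_umbilicSet_iff, hnet.mem_partiallyUmbilic12_iff,
    hnet.mem_partiallyUmbilic23_iff]
  simp only [Matrix.cons_val]
  -- The root `μ` lies strictly between the two moving ones, so no two curvatures coincide.
  rintro ((h1 | h1) | h1)
  · have := h1 0 1
    simp only [Matrix.cons_val] at this
    linarith [hμ.2]
  · linarith [hμ.2, h1.1]
  · linarith [hμ.1, h1.2]

end Quartic

/-! ### The torus of revolution: curvatures, parallels and meridians. -/

section Torus

/-- The orthogonal projection onto the plane `z = 0`. -/
noncomputable def horizontalPart : Euc 3 →L[ℝ] Euc 3 :=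
  LinearMap.toContinuousLinearMap
    { toFun := fun v => !₂[v 0, v 1, 0]
      map_add' := fun v w => by ext i; fin_cases i <;> simp
      map_smul' := fun c v => by ext i; fin_cases i <;> simp }

@[simp] theorem horizontalPart_apply (v : Euc 3) : horizontalPart v = !₂[v 0, v 1, 0] := rfl

variable (R r : ℝ)

/-- The gradient of `torus R r`. -/
noncomputable def torusGrad (p : Euc 3) : Euc 3 :=
  (4 * (p 0 ^ 2 + p 1 ^ 2 + p 2 ^ 2 + R ^ 2 - r ^ 2)) • p - (8 * R ^ 2) • horizontalPart p

theorem hasFDerivAt_coord (p : Euc 3) (i : Fin 3) :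
    HasFDerivAt (fun x : Euc 3 => x i) (EuclideanSpace.proj i : StrongDual ℝ (Euc 3)) p :=
  (EuclideanSpace.proj i : StrongDual ℝ (Euc 3)).hasFDerivAt

theorem hasGradientAt_torus (p : Euc 3) : HasGradientAt (torus R r) (torusGrad R r p) p := by
  rw [hasGradientAt_iff_hasFDerivAt]
  have h := fun i => (hasFDerivAt_coord p i).pow 2
  refine ((((((h 0).add (h 1)).add (h 2)).add_const (R ^ 2)).sub_const (r ^ 2)).pow 2 |>.sub
    (((h 0).add (h 1)).const_mul (4 * R ^ 2))).congr_fderiv ?_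
  ext v
  simp [PiLp.inner_apply, torusGrad, Fin.sum_univ_three]
  ring

/-- The Hessian of `torus R r`. -/
noncomputable def torusHess (p : Euc 3) : Euc 3 →L[ℝ] Euc 3 :=
  (4 * (p 0 ^ 2 + p 1 ^ 2 + p 2 ^ 2 + R ^ 2 - r ^ 2)) • ContinuousLinearMap.id ℝ (Euc 3) +
    (8 • innerSL ℝ p).smulRight p - (8 * R ^ 2) • horizontalPart

theorem hasFDerivAt_torusGrad (p : Euc 3) :
    HasFDerivAt (torusGrad R r) (torusHess R r p) p := by
  have h := fun i => (hasFDerivAt_coord p i).pow 2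
  refine ((((((h 0).add (h 1)).add (h 2)).add_const (R ^ 2)).sub_const (r ^ 2)).const_mul 4
    |>.smul (hasFDerivAt_id p) |>.sub (horizontalPart.hasFDerivAt.const_smul (8 * R ^ 2))
    ).congr_fderiv ?_
  ext v i
  simp only [torusHess, add_apply, sub_apply, smul_apply, ContinuousLinearMap.smulRight_apply,
    PiLp.add_apply, PiLp.sub_apply, PiLp.smul_apply]
  simp [PiLp.inner_apply, Fin.sum_univ_three]
  ring_nf
  simp

/-- The parametrization of the torus by the angle of rotation `x.1` and the angle `x.2` on the
meridian. -/
noncomputable def torusParam (x : ℝ × ℝ) : Euc 3 :=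
  !₂[(R + r * Real.cos x.2) * Real.cos x.1, (R + r * Real.cos x.2) * Real.sin x.1,
    r * Real.sin x.2]

/-- The unit vectors tangent to the parallels and to the meridians. -/
noncomputable def torusFrame (x : ℝ × ℝ) : Fin 2 → Euc 3 :=
  ![!₂[-Real.sin x.1, Real.cos x.1, 0],
    !₂[-(Real.sin x.2 * Real.cos x.1), -(Real.sin x.2 * Real.sin x.1), Real.cos x.2]]

/-- The outer unit normal of the torus. -/
noncomputable def torusNormal (x : ℝ × ℝ) : Euc 3 :=
  !₂[Real.cos x.2 * Real.cos x.1, Real.cos x.2 * Real.sin x.1, Real.sin x.2]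

/-- The principal curvatures of the torus, in increasing order. -/
noncomputable def torusCurvature (x : ℝ × ℝ) : Fin 2 → ℝ :=
  ![Real.cos x.2 / (R + r * Real.cos x.2), 1 / r]

variable {R r}

theorem hasDerivAt_of_apply {n : ℕ} {γ : ℝ → Euc n} {γ' : Euc n} {t : ℝ}
    (h : ∀ l, HasDerivAt (fun s => γ s l) (γ' l) t) : HasDerivAt γ γ' t :=
  (EuclideanSpace.equiv (Fin n) ℝ).symm.hasFDerivAt.comp_hasDerivAt t
    (hasDerivAt_pi (φ := fun s => (γ s).ofLp) (φ' := γ'.ofLp) |>.mpr h)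

theorem torus_radius_pos (hr : 0 < r) (hR : r < R) (β : ℝ) : 0 < R + r * Real.cos β := by
  nlinarith [Real.neg_one_le_cos β]

theorem torus_sum_sq (x : ℝ × ℝ) :
    torusParam R r x 0 ^ 2 + torusParam R r x 1 ^ 2 = (R + r * Real.cos x.2) ^ 2 := by
  simp [torusParam]
  linear_combination (R + r * Real.cos x.2) ^ 2 * Real.sin_sq_add_cos_sq x.1

theorem torus_sum_sq_add (x : ℝ × ℝ) :
    torusParam R r x 0 ^ 2 + torusParam R r x 1 ^ 2 + torusParam R r x 2 ^ 2 + R ^ 2 - r ^ 2 =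
      2 * R * (R + r * Real.cos x.2) := by
  rw [torus_sum_sq]
  simp [torusParam]
  linear_combination r ^ 2 * Real.sin_sq_add_cos_sq x.2

theorem torusParam_mem (x : ℝ × ℝ) : torusParam R r x ∈ hypersurface (torus R r) := by
  rw [hypersurface, mem_ofPred_eq, torus, torus_sum_sq_add, torus_sum_sq]
  ring

theorem norm_torusNormal (x : ℝ × ℝ) : ‖torusNormal x‖ = 1 := by
  rw [EuclideanSpace.norm_eq, Real.sqrt_eq_one]
  simp [torusNormal, Fin.sum_univ_three]
  linear_combination Real.sin_sq_add_cos_sq x.2 +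
    Real.cos x.2 ^ 2 * Real.sin_sq_add_cos_sq x.1

theorem torusGrad_torusParam (x : ℝ × ℝ) :
    torusGrad R r (torusParam R r x) = (8 * R * (R + r * Real.cos x.2) * r) • torusNormal x := by
  rw [torusGrad, torus_sum_sq_add]
  ext i
  fin_cases i <;> simp [torusParam, torusNormal] <;> ring

theorem norm_torusGrad (hr : 0 < r) (hR : r < R) (x : ℝ × ℝ) :
    ‖torusGrad R r (torusParam R r x)‖ = 8 * R * (R + r * Real.cos x.2) * r := by
  have := torus_radius_pos hr hR x.2
  have hR0 := hr.trans hR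
  rw [torusGrad_torusParam, norm_smul, norm_torusNormal, mul_one, Real.norm_of_nonneg]
  positivity

theorem torusGrad_ne_zero (hr : 0 < r) (hR : r < R) (x : ℝ × ℝ) :
    torusGrad R r (torusParam R r x) ≠ 0 := by
  have := torus_radius_pos hr hR x.2
  have hR0 := hr.trans hR
  rw [← norm_ne_zero_iff, norm_torusGrad hr hR]
  positivity

theorem fderiv_torus_ne_zero (hr : 0 < r) (hR : r < R) (x : ℝ × ℝ) :
    fderiv ℝ (torus R r) (torusParam R r x) ≠ 0 := by
  rw [(hasGradientAt_torus R r _).hasFDerivAt.fderiv]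
  simpa using torusGrad_ne_zero hr hR x

theorem orthonormal_torusFrame (x : ℝ × ℝ) : Orthonormal ℝ (torusFrame x) := by
  rw [orthonormal_iff_ite]
  have h1 := Real.sin_sq_add_cos_sq x.1
  have h2 := Real.sin_sq_add_cos_sq x.2
  intro i j
  fin_cases i <;> fin_cases j <;>
    simp only [torusFrame, PiLp.inner_apply, Fin.sum_univ_three] <;> simp
  · ring
  · ring
  · simp only [mul_pow, sq_abs]
    linear_combination h2 + Real.sin x.2 ^ 2 * h1

theorem isCurvatureVector_torusFrame (hr : 0 < r) (hR : r < R) (x : ℝ × ℝ) (i : Fin 2) :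
    IsCurvatureVector (torus R r) (torusParam R r x) (torusCurvature R r x i)
      (torusFrame x i) := by
  have hρ := torus_radius_pos hr hR x.2
  have hR0 := hr.trans hR
  have h1 := Real.sin_sq_add_cos_sq x.1
  have h2 := Real.sin_sq_add_cos_sq x.2
  rw [isCurvatureVector_iff (Eventually.of_forall (hasGradientAt_torus R r))
    (hasFDerivAt_torusGrad R r _) (torusGrad_ne_zero hr hR x), norm_torusGrad hr hR,
    torusGrad_torusParam]
  fin_cases i
  · refine ⟨?_, 0, ?_⟩
    · simp [torusFrame, torusNormal, PiLp.inner_apply, Fin.sum_univ_three]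
      ring
    · have h3 : torusCurvature R r x 0 * (8 * R * (R + r * Real.cos x.2) * r) =
          8 * R * r * Real.cos x.2 := by
        rw [torusCurvature, Matrix.cons_val_zero, div_mul_eq_mul_div, div_eq_iff hρ.ne']
        ring
      simp only [Fin.zero_eta, h3, torusHess, torus_sum_sq_add]
      ext l
      fin_cases l <;>
        simp [torusFrame, torusParam, PiLp.inner_apply, Fin.sum_univ_three] <;> (ring_nf; try simp)
  -- The rank-one and the horizontal terms of the Hessian add up to a normal vector; this is its
  -- coefficient with respect to the gradient.
  · refine ⟨?_, -(Real.sin x.2) / (R + r * Real.cos x.2), ?_⟩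
    · simp [torusFrame, torusNormal, PiLp.inner_apply, Fin.sum_univ_three]
      linear_combination -8 * R * (R + r * Real.cos x.2) * r * Real.cos x.2 * Real.sin x.2 * h1
    · have h3 : torusCurvature R r x 1 * (8 * R * (R + r * Real.cos x.2) * r) =
          8 * R * (R + r * Real.cos x.2) := by
        simp [torusCurvature]
        field_simp
      have h4 : -(Real.sin x.2) / (R + r * Real.cos x.2) *
          (8 * R * (R + r * Real.cos x.2) * r) = -(8 * R * r * Real.sin x.2) := by
        field_simp
      have h5 : inner ℝ (torusParam R r x) (torusFrame x 1) = -(R * Real.sin x.2) := by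
        simp [torusFrame, torusParam, PiLp.inner_apply, Fin.sum_univ_three]
        linear_combination -(R + r * Real.cos x.2) * Real.sin x.2 * h1
      simp only [Fin.mk_one, h3, smul_smul, h4, torusHess, torus_sum_sq_add, add_apply, sub_apply,
        smul_apply, ContinuousLinearMap.smulRight_apply, innerSL_apply_apply, h5]
      ext l
      fin_cases l <;>
        simp [torusFrame, torusParam, torusNormal] <;> ring

/-- After clearing denominators the claim is `0 < R`. This is why there are no umbilics. -/
theorem torusCurvature_lt (hr : 0 < r) (hR : r < R) (x : ℝ × ℝ) :
    torusCurvature R r x 0 < torusCurvature R r x 1 := by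
  have hρ := torus_radius_pos hr hR x.2
  simp only [torusCurvature, Matrix.cons_val_zero, Matrix.cons_val_one]
  rw [div_lt_div_iff₀ hρ hr]
  linarith

theorem hasPrincipalCurvatures_torus (hr : 0 < r) (hR : r < R) (x : ℝ × ℝ) :
    HasPrincipalCurvatures (torus R r) (torusParam R r x) (torusCurvature R r x) := by
  refine ⟨?_, torusFrame x, orthonormal_torusFrame x, isCurvatureVector_torusFrame hr hR x⟩
  rw [Fin.monotone_iff_le_succ]
  intro i
  fin_cases i
  exact (torusCurvature_lt hr hR x).le

theorem torusCurvature_simple (hr : 0 < r) (hR : r < R) (x : ℝ × ℝ) (i j : Fin 2) (h : j ≠ i) :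
    torusCurvature R r x j ≠ torusCurvature R r x i := by
  have := torusCurvature_lt hr hR x
  fin_cases i <;> fin_cases j <;> simp_all [this.ne, this.ne']

theorem memLineField_torus_iff (hr : 0 < r) (hR : r < R) (x : ℝ × ℝ) (i : Fin 2) (v : Euc 3) :
    MemLineField (torus R r) i (torusParam R r x) v ↔ ∃ c : ℝ, v = c • torusFrame x i := by
  rw [memLineField_iff (fderiv_torus_ne_zero hr hR x) (hasPrincipalCurvatures_torus hr hR x),
    and_iff_right fun j hj => torusCurvature_simple hr hR x i j hj]
  constructor
  · exact IsCurvatureVector.exists_eq_smul (fderiv_torus_ne_zero hr hR x)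
      (orthonormal_torusFrame x) (isCurvatureVector_torusFrame hr hR x)
      fun j hj => torusCurvature_simple hr hR x i j hj
  · rintro ⟨c, rfl⟩
    obtain ⟨h1, h2⟩ := isCurvatureVector_torusFrame hr hR x i
    refine ⟨?_, ?_⟩
    · rw [IsTangent] at h1 ⊢
      rw [map_smul, h1, smul_zero]
    · rw [map_smul, ← smul_neg, h2, smul_comm]

theorem exists_cos_sin_eq {a b : ℝ} (h : a ^ 2 + b ^ 2 = 1) :
    ∃ θ, Real.cos θ = a ∧ Real.sin θ = b := by
  have h1 : -1 ≤ a := by nlinarith [sq_nonneg b]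
  have h2 : a ≤ 1 := by nlinarith [sq_nonneg b]
  have h3 : Real.sqrt (1 - a ^ 2) = |b| := by
    rw [← h, add_sub_cancel_left, Real.sqrt_sq_eq_abs]
  rcases le_total 0 b with hb | hb
  · exact ⟨Real.arccos a, Real.cos_arccos h1 h2, by
      rw [Real.sin_arccos, h3, abs_of_nonneg hb]⟩
  · exact ⟨-Real.arccos a, by rw [Real.cos_neg, Real.cos_arccos h1 h2], by
      rw [Real.sin_neg, Real.sin_arccos, h3, abs_of_nonpos hb, neg_neg]⟩

theorem exists_torusParam_eq (hr : 0 < r) (hR : r < R) {p : Euc 3}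
    (hp : p ∈ hypersurface (torus R r)) : ∃ x, torusParam R r x = p := by
  have hR0 := hr.trans hR
  set ρ := Real.sqrt (p 0 ^ 2 + p 1 ^ 2) with hρ
  have hρ0 : 0 ≤ ρ := Real.sqrt_nonneg _
  have hρ2 : ρ ^ 2 = p 0 ^ 2 + p 1 ^ 2 := Real.sq_sqrt (by positivity)
  have h1 : (p 0 ^ 2 + p 1 ^ 2 + p 2 ^ 2 + R ^ 2 - r ^ 2) ^ 2 = (2 * R * ρ) ^ 2 := by
    have : torus R r p = 0 := hp
    rw [torus] at this
    rw [mul_pow, hρ2]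
    linear_combination this
  -- Since `r < R`, the base of the left square in `h1` is positive, and the root of the polynomial
  -- equation can be taken without ambiguity of sign.
  have h2 : (ρ - R) ^ 2 + p 2 ^ 2 = r ^ 2 := by
    have h3 : 0 < p 0 ^ 2 + p 1 ^ 2 + p 2 ^ 2 + R ^ 2 - r ^ 2 := by nlinarith [sq_nonneg (p 2)]
    have h4 := (pow_left_inj₀ h3.le (by positivity) two_ne_zero).mp h1
    linear_combination h4 + hρ2
  have hρpos : 0 < ρ := by
    by_contra hn
    have : ρ = 0 := le_antisymm (not_lt.mp hn) hρ0
    rw [this] at h2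
    nlinarith [sq_nonneg (p 2)]
  obtain ⟨α, ha, hb⟩ := exists_cos_sin_eq (a := p 0 / ρ) (b := p 1 / ρ) (by
    field_simp; exact hρ2.symm)
  obtain ⟨β, hc, hd⟩ := exists_cos_sin_eq (a := (ρ - R) / r) (b := p 2 / r) (by
    field_simp; exact h2)
  refine ⟨(α, β), ?_⟩
  have h5 : R + r * Real.cos β = ρ := by rw [hc]; field_simp; ring
  ext l
  fin_cases l
  · simp [torusParam, h5, ha]; field_simp
  · simp [torusParam, h5, hb]; field_simp
  · simp [torusParam, hd]; field_simp

theorem torusParam_eq_iff (hr : 0 < r) (hR : r < R) (x y : ℝ × ℝ) :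
    torusParam R r x = torusParam R r y ↔ angleEq x.1 y.1 ∧ angleEq x.2 y.2 := by
  constructor
  · intro h
    have h1 := torus_sum_sq (R := R) (r := r) x
    rw [h, torus_sum_sq] at h1
    have h2 := (pow_left_inj₀ (torus_radius_pos hr hR _).le (torus_radius_pos hr hR _).le
      two_ne_zero).mp h1
    have hρ := (torus_radius_pos hr hR x.2).ne'
    have h0 := congrArg (fun p : Euc 3 => p 0) h
    have h1 := congrArg (fun p : Euc 3 => p 1) h
    have h3 := congrArg (fun p : Euc 3 => p 2) h
    simp only [torusParam, h2, PiLp.toLp_apply, Matrix.cons_val_zero, Matrix.cons_val_one,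
      Matrix.cons_val] at h0 h1 h3
    exact ⟨⟨mul_left_cancel₀ hρ h0, mul_left_cancel₀ hρ h1⟩,
      mul_left_cancel₀ hr.ne' (by linarith), mul_left_cancel₀ hr.ne' h3⟩
  · rintro ⟨⟨h1, h2⟩, h3, h4⟩
    simp only [torusParam, h1, h2, h3, h4]

theorem continuous_torusParam : Continuous (torusParam R r) := by
  refine (PiLp.continuous_toLp 2 _).comp (continuous_pi fun l => ?_)
  fin_cases l <;> simp <;> fun_prop

theorem isPrincipalLine_parallel (hr : 0 < r) (hR : r < R) (β s₀ s₁ : ℝ) :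
    IsPrincipalLine (torus R r) 0 (fun α => torusParam R r (α, β)) s₀ s₁ := by
  have hd : ∀ α, HasDerivAt (fun α => torusParam R r (α, β))
      ((R + r * Real.cos β) • torusFrame (α, β) 0) α := by
    intro α
    refine hasDerivAt_of_apply fun l => ?_
    fin_cases l
    · simpa [torusParam, torusFrame] using (Real.hasDerivAt_cos α).const_mul (R + r * Real.cos β)
    · simpa [torusParam, torusFrame] using (Real.hasDerivAt_sin α).const_mul (R + r * Real.cos β)
    · simpa [torusParam, torusFrame] using hasDerivAt_const α (r * Real.sin β)
  refine ⟨ContDiff.contDiffOn ?_, fun α _ => ⟨torusParam_mem _, ?_, ?_⟩⟩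
  · rw [contDiff_euclidean]
    intro l
    fin_cases l <;> simp [torusParam] <;> fun_prop
  · rw [(hd α).deriv]
    exact smul_ne_zero (torus_radius_pos hr hR β).ne' ((orthonormal_torusFrame _).ne_zero 0)
  · rw [(hd α).deriv, memLineField_torus_iff hr hR]
    exact ⟨_, rfl⟩

theorem isPrincipalLine_meridian (hr : 0 < r) (hR : r < R) (α s₀ s₁ : ℝ) :
    IsPrincipalLine (torus R r) 1 (fun β => torusParam R r (α, β)) s₀ s₁ := by
  have hd : ∀ β, HasDerivAt (fun β => torusParam R r (α, β)) (r • torusFrame (α, β) 1) β := by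
    intro β
    have h := ((Real.hasDerivAt_cos β).const_mul r).const_add R
    refine hasDerivAt_of_apply fun l => ?_
    fin_cases l
    · simpa [torusParam, torusFrame, mul_assoc] using h.mul_const (Real.cos α)
    · simpa [torusParam, torusFrame, mul_assoc] using h.mul_const (Real.sin α)
    · simpa [torusParam, torusFrame] using (Real.hasDerivAt_sin β).const_mul r
  refine ⟨ContDiff.contDiffOn ?_, fun β _ => ⟨torusParam_mem _, ?_, ?_⟩⟩
  · rw [contDiff_euclidean]
    intro l
    fin_cases l <;> simp [torusParam] <;> fun_prop
  · rw [(hd β).deriv]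
    exact smul_ne_zero hr.ne' ((orthonormal_torusFrame _).ne_zero 1)
  · rw [(hd β).deriv, memLineField_torus_iff hr hR]
    exact ⟨_, rfl⟩

theorem eq_of_hasDerivAt_zero {f : ℝ → ℝ} {s₀ s₁ : ℝ}
    (h : ∀ t ∈ Ioo s₀ s₁, HasDerivAt f 0 t) {s t : ℝ} (hs : s ∈ Ioo s₀ s₁)
    (ht : t ∈ Ioo s₀ s₁) : f s = f t :=
  isOpen_Ioo.is_const_of_deriv_eq_zero isPreconnected_Ioo
    (fun u hu => (h u hu).differentiableAt.differentiableWithinAt)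
    (fun u hu => (h u hu).deriv) hs ht

/-- A line tangent to the parallels keeps `x² + y²` and `z` constant, and these determine `R + r cos
β` and `r sin β`. -/
theorem mem_leaf_zero_torus_iff (hr : 0 < r) (hR : r < R) (x y : ℝ × ℝ) :
    torusParam R r y ∈ leaf (torus R r) 0 (torusParam R r x) ↔ angleEq x.2 y.2 := by
  constructor
  · rintro ⟨γ, s₀, s₁, hγ, s, hs, t, ht, hx, hy⟩
    have key : ∀ u ∈ Ioo s₀ s₁, HasDerivAt (fun u => γ u 0 ^ 2 + γ u 1 ^ 2) 0 u ∧
        HasDerivAt (fun u => γ u 2) 0 u := by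
      intro u hu
      obtain ⟨z, hz⟩ := exists_torusParam_eq hr hR (hγ.2 u hu).1
      have hd := hγ.hasDerivAt hu
      have hl := (hγ.2 u hu).2.2
      rw [← hz, memLineField_torus_iff hr hR] at hl
      obtain ⟨c, hc⟩ := hl
      rw [hc] at hd
      refine ⟨(((hasDerivAt_apply hd 0).pow 2).add ((hasDerivAt_apply hd 1).pow 2)).congr_deriv ?_,
        (hasDerivAt_apply hd 2).congr_deriv ?_⟩
      · rw [← hz]
        simp [torusParam, torusFrame]
        ring
      · simp [torusFrame]
    have h1 := eq_of_hasDerivAt_zero (fun u hu => (key u hu).1) hs ht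
    have h2 := eq_of_hasDerivAt_zero (fun u hu => (key u hu).2) hs ht
    simp only [hx, hy] at h1 h2
    rw [torus_sum_sq, torus_sum_sq] at h1
    have h3 := (pow_left_inj₀ (torus_radius_pos hr hR _).le (torus_radius_pos hr hR _).le
      two_ne_zero).mp h1
    refine ⟨mul_left_cancel₀ hr.ne' (by linarith), mul_left_cancel₀ hr.ne' ?_⟩
    simpa [torusParam] using h2
  · rintro ⟨h1, h2⟩
    refine ⟨_, _, _, isPrincipalLine_parallel hr hR x.2 (min x.1 y.1 - 1) (max x.1 y.1 + 1),
      x.1, ?_, y.1, ?_, rfl, ?_⟩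
    · constructor <;> linarith [min_le_left x.1 y.1, le_max_left x.1 y.1]
    · constructor <;> linarith [min_le_right x.1 y.1, le_max_right x.1 y.1]
    · rw [torusParam_eq_iff hr hR]
      exact ⟨⟨rfl, rfl⟩, h1, h2⟩

/-- A line tangent to the meridians keeps the normalized horizontal vector `(x, y) / √(x² + y²) =
(cos α, sin α)` constant. -/
theorem mem_leaf_one_torus_iff (hr : 0 < r) (hR : r < R) (x y : ℝ × ℝ) :
    torusParam R r y ∈ leaf (torus R r) 1 (torusParam R r x) ↔ angleEq x.1 y.1 := by
  constructor
  · rintro ⟨γ, s₀, s₁, hγ, s, hs, t, ht, hx, hy⟩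
    have key : ∀ u ∈ Ioo s₀ s₁,
        HasDerivAt (fun u => γ u 0 / Real.sqrt (γ u 0 ^ 2 + γ u 1 ^ 2)) 0 u ∧
        HasDerivAt (fun u => γ u 1 / Real.sqrt (γ u 0 ^ 2 + γ u 1 ^ 2)) 0 u := by
      intro u hu
      obtain ⟨z, hz⟩ := exists_torusParam_eq hr hR (hγ.2 u hu).1
      have hd := hγ.hasDerivAt hu
      have hl := (hγ.2 u hu).2.2
      rw [← hz, memLineField_torus_iff hr hR] at hl
      obtain ⟨c, hc⟩ := hl
      rw [hc] at hd
      have hρ := torus_radius_pos hr hR z.2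
      have hsum : γ u 0 ^ 2 + γ u 1 ^ 2 = (R + r * Real.cos z.2) ^ 2 := by
        rw [← hz, torus_sum_sq]
      have h0 : γ u 0 = (R + r * Real.cos z.2) * Real.cos z.1 := by
        rw [← hz]; simp [torusParam]
      have h1 : γ u 1 = (R + r * Real.cos z.2) * Real.sin z.1 := by
        rw [← hz]; simp [torusParam]
      have hsqrt := (((hasDerivAt_apply hd 0).fun_pow 2).fun_add
        ((hasDerivAt_apply hd 1).fun_pow 2)).sqrt (by rw [hsum]; positivity)
      have hne : Real.sqrt (γ u 0 ^ 2 + γ u 1 ^ 2) ≠ 0 := by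
        rw [hsum, Real.sqrt_sq hρ.le]; exact hρ.ne'
      have h2 := Real.sin_sq_add_cos_sq z.1
      refine ⟨((hasDerivAt_apply hd 0).fun_div hsqrt hne).congr_deriv ?_,
        ((hasDerivAt_apply hd 1).fun_div hsqrt hne).congr_deriv ?_⟩
      · rw [hsum, Real.sqrt_sq hρ.le, h0, h1]
        simp only [torusFrame, PiLp.smul_apply, smul_eq_mul, Matrix.cons_val_one,
          Matrix.cons_val_zero]
        field_simp
        linear_combination (2 * (R + r * Real.cos z.2) * c * Real.sin z.2 * Real.cos z.1) * h2
      · rw [hsum, Real.sqrt_sq hρ.le, h0, h1]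
        simp only [torusFrame, PiLp.smul_apply, smul_eq_mul, Matrix.cons_val_one,
          Matrix.cons_val_zero]
        field_simp
        linear_combination (2 * (R + r * Real.cos z.2) * c * Real.sin z.2 * Real.sin z.1) * h2
    have h1 := eq_of_hasDerivAt_zero (fun u hu => (key u hu).1) hs ht
    have h2 := eq_of_hasDerivAt_zero (fun u hu => (key u hu).2) hs ht
    simp only [hx, hy, torus_sum_sq, Real.sqrt_sq (torus_radius_pos hr hR _).le] at h1 h2
    simp only [torusParam, PiLp.toLp_apply, Matrix.cons_val_zero, Matrix.cons_val_one,
      mul_div_cancel_left₀ _ (torus_radius_pos hr hR _).ne'] at h1 h2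
    exact ⟨h1, h2⟩
  · rintro ⟨h1, h2⟩
    refine ⟨_, _, _, isPrincipalLine_meridian hr hR x.1 (min x.2 y.2 - 1) (max x.2 y.2 + 1),
      x.2, ?_, y.2, ?_, rfl, ?_⟩
    · constructor <;> linarith [min_le_left x.2 y.2, le_max_left x.2 y.2]
    · constructor <;> linarith [min_le_right x.2 y.2, le_max_right x.2 y.2]
    · rw [torusParam_eq_iff hr hR]
      exact ⟨⟨h1, h2⟩, rfl, rfl⟩

theorem leaf_subset_hypersurface {m : ℕ} (F : Euc (m + 1) → ℝ) (i : Fin m) (p : Euc (m + 1)) :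
    leaf F i p ⊆ hypersurface F := by
  rintro _ ⟨γ, s₀, s₁, hγ, s, hs, t, ht, rfl, rfl⟩
  exact (hγ.2 t ht).1

theorem netChart_torus (hr : 0 < r) (hR : r < R) :
    NetChart (torus R r) 0 1 (umbilicSet (torus R r)) (hypersurface (torus R r))
      (torusParam R r) (fun _ => False) (fun x y => angleEq x.2 y.2)
      (fun x y => angleEq x.1 y.1) (fun x y => angleEq x.1 y.1 ∧ angleEq x.2 y.2) where
  subset := Subset.rfl
  continuous := continuous_torusParam
  image := by
    apply Subset.antisymm
    · rintro _ ⟨x, -, rfl⟩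
      exact torusParam_mem x
    · intro p hp
      obtain ⟨x, rfl⟩ := exists_torusParam_eq hr hR hp
      obtain ⟨α, hα, h1, h2⟩ := exists_mem_Icc_trig x.1
      obtain ⟨β, hβ, h3, h4⟩ := exists_mem_Icc_trig x.2
      exact ⟨(α, β), ⟨hα, hβ⟩, (torusParam_eq_iff hr hR _ _).mpr ⟨⟨h1, h2⟩, h3, h4⟩⟩
  mem := torusParam_mem
  eq_iff := torusParam_eq_iff hr hR
  mem_singular := by
    refine fun x => iff_false_intro ?_
    rintro ⟨-, k, hk, hkk⟩
    obtain rfl := (hasPrincipalCurvatures_torus hr hR x).unique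
      (fderiv_torus_ne_zero hr hR x) hk
    exact torusCurvature_simple hr hR x 0 1 (by simp) (hkk 1 0)
  leaf_fst_subset := fun x => leaf_subset_hypersurface _ _ _
  leaf_snd_subset := fun x => leaf_subset_hypersurface _ _ _
  mem_leaf_fst := mem_leaf_zero_torus_iff hr hR
  mem_leaf_snd := mem_leaf_one_torus_iff hr hR

end Torus

/-! ### Equivalence of nets with the same model. -/

section ChartComparison

variable {m n : ℕ} {F : Euc (m + 1) → ℝ} {G : Euc (n + 1) → ℝ} {i j : Fin m} {i' j' : Fin n}
  {S C : Set (Euc (m + 1))} {S' C' : Set (Euc (n + 1))} {Φ : ℝ × ℝ → Euc (m + 1)}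
  {Ψ : ℝ × ℝ → Euc (n + 1)} {sing : ℝ × ℝ → Prop} {L₀ L₁ K : ℝ × ℝ → ℝ × ℝ → Prop}

/-- A map out of a compact charted set is continuous if it is continuous in the chart. -/
theorem NetChart.exists_continuous_lift (h : NetChart F i j S C Φ sing L₀ L₁ K)
    (h' : NetChart G i' j' S' C' Ψ sing L₀ L₁ K) :
    ∃ f : C → C', Continuous f ∧ ∀ x, (f ⟨Φ x, h.mem x⟩ : Euc (n + 1)) = Ψ x := by
  have hsurj : ∀ p : C, ∃ x ∈ Icc 0 (2 * Real.pi) ×ˢ Icc 0 (2 * Real.pi), Φ x = p := by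
    rintro ⟨p, hp⟩
    rwa [← h.image] at hp
  choose σ hσ hσ' using hsurj
  let f : C → C' := fun p => ⟨Ψ (σ p), h'.mem _⟩
  have hf : ∀ x, (f ⟨Φ x, h.mem x⟩ : Euc (n + 1)) = Ψ x := fun x =>
    (h'.eq_iff _ _).mpr ((h.eq_iff _ _).mp (hσ' ⟨Φ x, h.mem x⟩))
  refine ⟨f, ?_, hf⟩
  let φ : ↥(Icc 0 (2 * Real.pi) ×ˢ Icc 0 (2 * Real.pi)) → C := fun x => ⟨Φ x, h.mem x⟩
  have hφ : Continuous φ := (h.continuous.comp continuous_subtype_val).subtype_mk _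
  have : CompactSpace ↥(Icc (0 : ℝ) (2 * Real.pi) ×ˢ Icc (0 : ℝ) (2 * Real.pi)) :=
    isCompact_iff_compactSpace.mp (isCompact_Icc.prod isCompact_Icc)
  -- A continuous surjection from a compact space onto a Hausdorff space is a quotient map, so
  -- continuity of `f` can be tested on angles.
  have hq : IsQuotientMap φ := hφ.isClosedMap.isQuotientMap hφ
    fun p => ⟨⟨σ p, hσ p⟩, Subtype.ext (hσ' p)⟩
  rw [hq.continuous_iff, continuous_induced_rng]
  exact (h'.continuous.comp continuous_subtype_val).congr fun x => (hf x).symm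

/-- Two nets with the same combinatorial model are equivalent. -/
theorem NetChart.principallyEquivalent {G : Euc 3 → ℝ} {Ψ : ℝ × ℝ → Euc 3}
    (h : NetChart F i j S C Φ sing L₀ L₁ K)
    (h' : NetChart G 0 1 (umbilicSet G) (hypersurface G) Ψ sing L₀ L₁ K) :
    PrincipallyEquivalent F i j S C G := by
  obtain ⟨f, hf, hfΦ⟩ := h.exists_continuous_lift h'
  obtain ⟨g, hg, hgΨ⟩ := h'.exists_continuous_lift h
  have hsurj : ∀ p : C, ∃ x, p = ⟨Φ x, h.mem x⟩ := by
    rintro ⟨p, hp⟩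
    have hp' := hp
    rw [← h.image] at hp'
    obtain ⟨x, -, rfl⟩ := hp'
    exact ⟨x, rfl⟩
  have hsurj' : ∀ p : hypersurface G, ∃ x, p = ⟨Ψ x, h'.mem x⟩ := by
    rintro ⟨p, hp⟩
    have hp' := hp
    rw [← h'.image] at hp'
    obtain ⟨x, -, rfl⟩ := hp'
    exact ⟨x, rfl⟩
  have hf' : ∀ x, f ⟨Φ x, h.mem x⟩ = ⟨Ψ x, h'.mem x⟩ := fun x => Subtype.ext (hfΦ x)
  have hg' : ∀ x, g ⟨Ψ x, h'.mem x⟩ = ⟨Φ x, h.mem x⟩ := fun x => Subtype.ext (hgΨ x)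
  let e : C ≃ₜ hypersurface G :=
    { toFun := f
      invFun := g
      left_inv := fun p => by
        obtain ⟨x, rfl⟩ := hsurj p
        rw [hf', hg']
      right_inv := fun p => by
        obtain ⟨x, rfl⟩ := hsurj' p
        rw [hg', hf']
      continuous_toFun := hf
      continuous_invFun := hg }
  have he : ∀ x, (e ⟨Φ x, h.mem x⟩ : Euc 3) = Ψ x := hfΦ
  refine ⟨e, fun p q => ?_, fun p q => ?_, fun p => ?_⟩
  · obtain ⟨x, rfl⟩ := hsurj p
    obtain ⟨y, rfl⟩ := hsurj q
    rw [he, he, h.mem_leaf_fst, h'.mem_leaf_fst]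
  · obtain ⟨x, rfl⟩ := hsurj p
    obtain ⟨y, rfl⟩ := hsurj q
    rw [he, he, h.mem_leaf_snd, h'.mem_leaf_snd]
  · obtain ⟨x, rfl⟩ := hsurj p
    rw [he, h.mem_singular, h'.mem_singular]

theorem NetChart.carriesNet (h : NetChart F i j S C Φ sing L₀ L₁ K)
    (h₀ : ∀ x, ¬sing x → L₀ x x) (h₁ : ∀ x, ¬sing x → L₁ x x)
    (hs₀ : ∀ x y, sing x → ¬L₀ x y) (hs₁ : ∀ x y, sing x → ¬L₁ x y) :
    CarriesNet F i j S C := by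
  have hsurj : ∀ p ∈ C, ∃ x, Φ x = p := by
    intro p hp
    rw [← h.image] at hp
    obtain ⟨x, -, rfl⟩ := hp
    exact ⟨x, rfl⟩
  refine ⟨h.subset, fun p hp hpS => ?_, fun p hp hpS => ?_, fun p hp => ?_⟩ <;>
    obtain ⟨x, rfl⟩ := hsurj p hp
  · rw [h.mem_singular] at hpS
    exact ⟨(h.mem_leaf_fst x x).mpr (h₀ x hpS), (h.mem_leaf_snd x x).mpr (h₁ x hpS)⟩
  · rw [h.mem_singular] at hpS
    constructor <;> refine eq_empty_of_forall_notMem fun q hq => ?_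
    · obtain ⟨y, rfl⟩ := hsurj q (h.leaf_fst_subset x hq)
      exact hs₀ x y hpS ((h.mem_leaf_fst x y).mp hq)
    · obtain ⟨y, rfl⟩ := hsurj q (h.leaf_snd_subset x hq)
      exact hs₁ x y hpS ((h.mem_leaf_snd x y).mp hq)
  · exact ⟨h.leaf_fst_subset x, h.leaf_snd_subset x⟩

theorem NetChart.isPreconnected (h : NetChart F i j S C Φ sing L₀ L₁ K) : IsPreconnected C := by
  rw [← h.image]
  exact (isPreconnected_Icc.prod isPreconnected_Icc).image _ h.continuous.continuousOn

theorem NetChart.nonempty (h : NetChart F i j S C Φ sing L₀ L₁ K) : C.Nonempty :=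
  ⟨_, h.mem 0⟩

theorem NetChart.carriesNet_pillow
    (h : NetChart F i j S C Φ pillowSing pillowLeafFst pillowLeafSnd K) :
    CarriesNet F i j S C :=
  h.carriesNet (fun _ hx => ⟨hx, hx, rfl⟩) (fun _ hx => ⟨hx, hx, rfl⟩)
    (fun _ _ hx hL => hL.1 hx) fun _ _ hx hL => hL.1 hx

end ChartComparison

/-! ### The two components of the quartic surface. -/

section Components

variable {A : Fin 4 → ℝ} {μ : ℝ} {l : Fin 4}

/-- Each half is connected, and no connected subset of the surface leaves it. -/
theorem connectedComponentIn_quarticSet (hne : ∀ x ∈ quarticSet A μ, x l ≠ 0)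
    (hconn : ∀ e : ℝ, e ^ 2 = 1 → IsPreconnected (quarticPart A μ e l)) {e : ℝ} (he : e ^ 2 = 1)
    {p : Euc 4} (hp : p ∈ quarticPart A μ e l) :
    connectedComponentIn (quarticSet A μ) p = quarticPart A μ e l := by
  apply Subset.antisymm
  · exact quarticPart_subset_of_connected (by rintro rfl; norm_num at he) hne
      isPreconnected_connectedComponentIn (connectedComponentIn_subset _ _)
      ⟨p, mem_connectedComponentIn hp.1, hp⟩
  · exact (hconn e he).subset_connectedComponentIn hp fun x hx => hx.1

theorem exists_mem_quarticPart (hne : ∀ x ∈ quarticSet A μ, x l ≠ 0) {p : Euc 4}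
    (hp : p ∈ quarticSet A μ) : ∃ e : ℝ, (e = 1 ∨ e = -1) ∧ p ∈ quarticPart A μ e l := by
  rcases lt_or_gt_of_ne (hne p hp) with h | h
  · exact ⟨-1, Or.inr rfl, hp, by linarith⟩
  · exact ⟨1, Or.inl rfl, hp, by linarith⟩

theorem card_connectedComponents_quarticSet (hne : ∀ x ∈ quarticSet A μ, x l ≠ 0)
    (hconn : ∀ e : ℝ, e ^ 2 = 1 → IsPreconnected (quarticPart A μ e l))
    (hnon : ∀ e : ℝ, e ^ 2 = 1 → (quarticPart A μ e l).Nonempty) :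
    Nat.card (ConnectedComponents (quarticSet A μ)) = 2 := by
  have hcomp : ∀ e : ℝ, e ^ 2 = 1 → ∀ p q : quarticSet A μ, (p : Euc 4) ∈ quarticPart A μ e l →
      ((p : ConnectedComponents (quarticSet A μ)) = q ↔ (q : Euc 4) ∈ quarticPart A μ e l) := by
    intro e he p q hp
    rw [← connectedComponentIn_quarticSet hne hconn he hp, connectedComponentIn_eq_image p.2,
      eq_comm, ConnectedComponents.coe_eq_coe']
    simp
  obtain ⟨p, hp⟩ := hnon 1 (by norm_num)
  obtain ⟨q, hq⟩ := hnon (-1) (by norm_num)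
  rw [Nat.card_eq_two_iff]
  refine ⟨((⟨p, hp.1⟩ : quarticSet A μ) : ConnectedComponents (quarticSet A μ)),
    ((⟨q, hq.1⟩ : quarticSet A μ) : ConnectedComponents (quarticSet A μ)), ?_, ?_⟩
  · rw [Ne, hcomp 1 (by norm_num) _ _ hp]
    intro h
    have h1 := h.2
    have h2 := hq.2
    simp only at h1
    linarith
  · rw [eq_univ_iff_forall]
    intro c
    obtain ⟨s, rfl⟩ := ConnectedComponents.surjective_coe c
    rw [mem_insert_iff, mem_singleton_iff, eq_comm, hcomp 1 (by norm_num) ⟨p, hp.1⟩ s hp, eq_comm,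
      hcomp (-1) (by norm_num) ⟨q, hq.1⟩ s hq]
    obtain ⟨e, rfl | rfl, hs⟩ := exists_mem_quarticPart hne s.2
    · exact Or.inl hs
    · exact Or.inr hs

/-- If the two halves of the quartic surface carry pillow nets, they are its components. -/
theorem quarticSet_of_netChart {i j : Fin 3} {S : Set (Euc 4)} {Φ : ℝ → ℝ × ℝ → Euc 4}
    (hne : ∀ x ∈ quarticSet A μ, x l ≠ 0)
    (h : ∀ e : ℝ, e ^ 2 = 1 → NetChart (quadric A) i j S (quarticPart A μ e l) (Φ e)
      pillowSing pillowLeafFst pillowLeafSnd pillowKer) :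
    Nat.card (ConnectedComponents (quarticSet A μ)) = 2 ∧ ∀ p ∈ quarticSet A μ,
      CarriesNet (quadric A) i j S (connectedComponentIn (quarticSet A μ) p) ∧
      ∀ B : Fin 3 → ℝ, 0 < B 2 → B 2 < B 1 → B 1 < B 0 →
        PrincipallyEquivalent (quadric A) i j S (connectedComponentIn (quarticSet A μ) p)
          (quadric B) := by
  have hconn := fun e he => (h e he).isPreconnected
  refine ⟨card_connectedComponents_quarticSet hne hconn fun e he => (h e he).nonempty,
    fun p hp => ?_⟩
  obtain ⟨e, he, hpe⟩ := exists_mem_quarticPart hne hp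
  have he : e ^ 2 = 1 := by rcases he with rfl | rfl <;> norm_num
  rw [connectedComponentIn_quarticSet hne hconn he hpe]
  exact ⟨(h e he).carriesNet_pillow, fun B h2 h21 h10 =>
    (h e he).principallyEquivalent (netChart_ellipsoid h2 h21 h10)⟩

theorem quartic_eq_quarticSet {a b c d μ : ℝ} (ha : 0 < a) (hb : 0 < b) (hc : 0 < c) (hd : 0 < d)
    (ha' : μ ≠ a ^ 2) (hb' : μ ≠ b ^ 2) (hc' : μ ≠ c ^ 2) (hd' : μ ≠ d ^ 2) :
    quartic a b c d μ = quarticSet ![a ^ 2, b ^ 2, c ^ 2, d ^ 2] μ := by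
  have hμ : ∀ k, μ ≠ (![a ^ 2, b ^ 2, c ^ 2, d ^ 2] : Fin 4 → ℝ) k := by
    simp [Fin.forall_fin_succ, ha', hb', hc', hd']
  have hA : ∀ k, 0 < (![a ^ 2, b ^ 2, c ^ 2, d ^ 2] : Fin 4 → ℝ) k := by
    intro k
    fin_cases k <;> simp <;> positivity
  have hsub : (![a ^ 2 - μ, b ^ 2 - μ, c ^ 2 - μ, d ^ 2 - μ] : Fin 4 → ℝ) =
      fun i => (![a ^ 2, b ^ 2, c ^ 2, d ^ 2] : Fin 4 → ℝ) i - μ := by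
    ext k
    fin_cases k <;> rfl
  ext p
  rw [quartic, quarticSet, mem_ofPred_eq, mem_ofPred_eq, hsub, quadric_sub_eq_zero_iff _ _ hμ,
    ellipsoid4, mem_hypersurface_quadric_iff hA]

end Components

end PrincipalNet

/-! ### The three positions of `μ` among the squared axes. -/

theorem proposition5 (a b c d μ : ℝ) (hd : 0 < d) (hcd : d < c) (hbc : c < b) (hab : b < a) :
    (μ ∈ Set.Ioo (d ^ 2) (c ^ 2) →
      Nat.card (ConnectedComponents (quartic a b c d μ)) = 2 ∧
      ∀ p ∈ quartic a b c d μ,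
        CarriesNet (ellipsoid4 a b c d) 0 1 (partiallyUmbilic12 (ellipsoid4 a b c d))
          (connectedComponentIn (quartic a b c d μ) p) ∧
        ∀ a' b' c' : ℝ, 0 < c' → c' < b' → b' < a' →
          PrincipallyEquivalent (ellipsoid4 a b c d) 0 1
            (partiallyUmbilic12 (ellipsoid4 a b c d))
            (connectedComponentIn (quartic a b c d μ) p) (ellipsoid3 a' b' c')) ∧
    (μ ∈ Set.Ioo (b ^ 2) (a ^ 2) →
      Nat.card (ConnectedComponents (quartic a b c d μ)) = 2 ∧
      ∀ p ∈ quartic a b c d μ,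
        CarriesNet (ellipsoid4 a b c d) 1 2 (partiallyUmbilic23 (ellipsoid4 a b c d))
          (connectedComponentIn (quartic a b c d μ) p) ∧
        ∀ a' b' c' : ℝ, 0 < c' → c' < b' → b' < a' →
          PrincipallyEquivalent (ellipsoid4 a b c d) 1 2
            (partiallyUmbilic23 (ellipsoid4 a b c d))
            (connectedComponentIn (quartic a b c d μ) p) (ellipsoid3 a' b' c')) ∧
    (μ ∈ Set.Ioo (c ^ 2) (b ^ 2) →
      CarriesNet (ellipsoid4 a b c d) 0 2
        (umbilicSet (ellipsoid4 a b c d) ∪ partiallyUmbilic12 (ellipsoid4 a b c d) ∪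
          partiallyUmbilic23 (ellipsoid4 a b c d))
        (quartic a b c d μ) ∧
      ∀ R r : ℝ, 0 < r → r < R →
        PrincipallyEquivalent (ellipsoid4 a b c d) 0 2
          (umbilicSet (ellipsoid4 a b c d) ∪ partiallyUmbilic12 (ellipsoid4 a b c d) ∪
            partiallyUmbilic23 (ellipsoid4 a b c d))
          (quartic a b c d μ) (torus R r)) := by
  have hc := hd.trans hcd
  have hb := hc.trans hbc
  have ha := hb.trans hab
  have hsq : ∀ {x y : ℝ}, 0 < x → x < y → x ^ 2 < y ^ 2 := fun hx hxy =>
    pow_lt_pow_left₀ hxy hx.le two_ne_zero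
  have h3 := pow_pos hd 2
  have h32 := hsq hd hcd
  have h21 := hsq hc hbc
  have h10 := hsq hb hab
  have hQ := quartic_eq_quarticSet (μ := μ) ha hb hc hd
  refine ⟨fun hμ => ?_, fun hμ => ?_, fun hμ => ?_⟩
  · rw [hQ (hμ.2.trans (h21.trans h10)).ne (hμ.2.trans h21).ne hμ.2.ne hμ.1.ne']
    obtain ⟨h1, h2⟩ := quarticSet_of_netChart (fun x => apply_three_ne_zero (A := ![a ^ 2, b ^ 2, c ^ 2, d ^ 2]) h3 h32 h21 h10 hμ)
      fun e he => netChart_low h3 h32 h21 h10 hμ he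
    exact ⟨h1, fun p hp => ⟨(h2 p hp).1, fun a' b' c' hc' hbc' hab' => (h2 p hp).2 ![a' ^ 2, b' ^ 2, c' ^ 2]
      (pow_pos hc' 2) (hsq hc' hbc') (hsq (hc'.trans hbc') hab')⟩⟩
  · rw [hQ hμ.2.ne hμ.1.ne' (h21.trans hμ.1).ne' (h32.trans (h21.trans hμ.1)).ne']
    obtain ⟨h1, h2⟩ := quarticSet_of_netChart (fun x => apply_zero_ne_zero (A := ![a ^ 2, b ^ 2, c ^ 2, d ^ 2]) h3 h32 h21 h10 hμ)
      fun e he => netChart_high h3 h32 h21 h10 hμ he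
    exact ⟨h1, fun p hp => ⟨(h2 p hp).1, fun a' b' c' hc' hbc' hab' => (h2 p hp).2 ![a' ^ 2, b' ^ 2, c' ^ 2]
      (pow_pos hc' 2) (hsq hc' hbc') (hsq (hc'.trans hbc') hab')⟩⟩
  · rw [hQ (hμ.2.trans h10).ne hμ.2.ne hμ.1.ne' (h32.trans hμ.1).ne']
    have h := netChart_middle (A := ![a ^ 2, b ^ 2, c ^ 2, d ^ 2]) h3 h32 h21 h10 hμ
    exact ⟨h.carriesNet (fun _ _ => ⟨rfl, rfl⟩) (fun _ _ => ⟨rfl, rfl⟩) (fun _ _ => False.elim)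
      fun _ _ => False.elim, fun R r hr hR => h.principallyEquivalent (netChart_torus hr hR)⟩
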